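/- **Ball-Box Theorem.** Let $G$ be a connected real Lie group with Lie algebra $\mathfrak g$ and exponential map $\exp_G$, and let $D\subset\mathfrak g$ be a linear subspace which generates $\mathfrak g$: with $V^0=0$, $V^1=D$, $V^{i+1}=V^i+[D,V^i]$, one has $V^m=\mathfrak g$ for some $m$. Let $\mathfrak g=\bigoplus_{j=1}^m W_j$ be a direct sum decomposition with $V^i=\bigoplus_{j\le i}W_j$ for all $i$; write $x=\sum_j x_j$, $x_j\in W_j$ (and $x_j=0$ for $j>m$). Let $$[x,y]_n=\sum_{j,k}\,[x_j,y_k]_{j+k}=\lim_{\varepsilon\to0}\delta_\varepsilon^{-1}[\delta_\varepsilon x,\delta_\varepsilon y],\qquad \delta_\varepsilon x=\sum_j\varepsilon^jx_j ,$$ be the associated nilpotent Lie bracket on $\mathfrak g$, and let $N$ (the nilpotentisation) be the simply connected Lie group with Lie algebra $(\mathfrak g,[\cdot,\cdot]_n)$, identified with $\mathfrak g$ by its exponential map $\exp_N$; its product is given by the Baker-Campbell-Hausdorff formula, and $\exp_G$ is thus also a map $N\to G$. Let $X_1,\dots,X_p$ be a basis of $D$. Then there are a natural number $M$ and a surjective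 map $g:\{1,\dots,M\}\to\{1,\dots,p\}$ such that every $x$ in some neighbourhood of the identity of $G$ and every $y$ in some neighbourhood of the identity of $N$ can be written as $$x=\prod_{i=1}^M\exp_G(t_iX_{g(i)}),\qquad y=\prod_{i=1}^M\exp_N(\tau_iX_{g(i)})\qquad(t_i,\tau_i\in\mathbb R),$$ and such that the following holds. For $H\in\{G,N\}$ and $x\in H$ put $$\Delta^1_H(x)=\inf\Big\{\sum_{i=1}^M|t_i| : x=\prod_{i=1}^M\exp_H(t_iX_{g(i)})\Big\}\in[0,\infty],\qquad Box^1_H(\varepsilon)=\{x\in H:\Delta^1_H(x)<\varepsilon\}$$ (with $\inf\emptyset=\infty$). There are constants $C>1$ and $\varepsilon_0>0$ such that for all $0<\varepsilon<\varepsilon_0$ $$\exp_G\big(Box^1_N(\varepsilon)\big)\subset Box^1_G(C\varepsilon)\subset\exp_G\big(Box^1_N(C^2\varepsilon)\big).$$ -/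

import Mathlib

open scoped Manifold ContDiff ENNReal

instance minSmoothness_three_leInfty : ENat.LEInfty (minSmoothness ℝ 3) where
  out := by
    rw [minSmoothness_of_isRCLikeNormedField]
    exact ENat.LEInfty.out

noncomputable section

/-! ### The exponential map of a Lie group -/

/-- The exponential map of a real Lie group: `lieExp v` is the value at time `1` of the integral
curve, starting at the identity, of the left-invariant vector field with value `v` at the
identity. (Such a curve exists and is unique; the second branch is never taken.) -/
def lieExp {E : Type*} [NormedAddCommGroup E] [NormedSpace ℝ E]
    {G : Type*} [TopologicalSpace G] [ChartedSpace E G] [Group G]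
    (v : GroupLieAlgebra 𝓘(ℝ, E) G) : G :=
  open Classical in
  if h : ∃ γ : ℝ → G, γ 0 = 1 ∧
      IsMIntegralCurve (I := 𝓘(ℝ, E)) γ (mulInvariantVectorField (I := 𝓘(ℝ, E)) v)
  then h.choose 1 else 1

/-! ### Nilpotentisation of a Lie algebra with a generating subspace -/

section Nilpotentisation

variable {L : Type*} [LieRing L] [LieAlgebra ℝ L]

/-- The filtration `V⁰ = 0`, `V¹ = D`, `Vⁱ⁺¹ = Vⁱ + [D, Vⁱ]`. -/
def bracketFiltration (D : Submodule ℝ L) : ℕ → Submodule ℝ L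
  | 0 => ⊥
  | 1 => D
  | (i + 2) => bracketFiltration D (i + 1) ⊔
      Submodule.span ℝ {z | ∃ x ∈ D, ∃ y ∈ bracketFiltration D (i + 1), ⁅x, y⁆ = z}

/-- The projection `x ↦ xⱼ` onto the `j`-th summand of a direct sum decomposition `L = ⨁ Wⱼ`. -/
def gradedProj (W : ℕ → Submodule ℝ L) [DirectSum.Decomposition W] (j : ℕ) : L →ₗ[ℝ] L :=
  (W j).subtype ∘ₗ DirectSum.component ℝ ℕ (fun i => W i) j ∘ₗ
    (DirectSum.decomposeLinearEquiv W).toLinearMap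

/-- The adjoint operator `y ↦ [x, y]ₙ` of the nilpotent bracket
`[x, y]ₙ = ∑_{j, k ≤ m} [xⱼ, yₖ]_{j+k}`, where `L = W₁ ⊕ ⋯ ⊕ Wₘ`. -/
def nilAd (W : ℕ → Submodule ℝ L) [DirectSum.Decomposition W] (m : ℕ) (x : L) :
    Module.End ℝ L :=
  ∑ j ∈ Finset.range (m + 1), ∑ k ∈ Finset.range (m + 1),
    gradedProj W (j + k) ∘ₗ (LieAlgebra.ad ℝ L (gradedProj W j x)) ∘ₗ gradedProj W k

/-- The Baker-Campbell-Hausdorff product of the nilpotent bracket `[·, ·]ₙ`, of step at most `m`,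
in its integral form
`x · y = x + ∫₀¹ ψ(A(t)) y dt`, where `A(t) = exp(ad x) exp(t ad y)` and
`ψ(z) = z log z / (z - 1) = z ∑ₖ (-1)ᵏ / (k + 1) (z - 1)ᵏ`.
Here `ad` is nilpotent, so that all the series are finite; `A` and `Q = ψ(A)` are polynomials in
the variable `t` with coefficients in `End L`, and the last line integrates `Q(t) y`
over `[0, 1]` term by term. -/
def nilBCH (W : ℕ → Submodule ℝ L) [DirectSum.Decomposition W] (m : ℕ) (x y : L) : L :=
  let A : Polynomial (Module.End ℝ L) :=
    Polynomial.C (∑ j ∈ Finset.range (m + 1), (j.factorial : ℝ)⁻¹ • nilAd W m x ^ j) *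
      ∑ j ∈ Finset.range (m + 1),
        Polynomial.monomial j ((j.factorial : ℝ)⁻¹ • nilAd W m y ^ j)
  let Q : Polynomial (Module.End ℝ L) :=
    A * ∑ k ∈ Finset.range (m + 1), ((-1) ^ k / ((k : ℝ) + 1)) • (A - 1) ^ k
  x + Q.sum fun n a => ((n : ℝ) + 1)⁻¹ • a y

/-- The nilpotentisation `N`: the simply connected group with Lie algebra `(L, [·, ·]ₙ)`,
identified with `L` by its exponential map. Thus `Nilpotentisation.exp` is the exponential map
`exp_N`, `Nilpotentisation.log` its inverse, and the product is given by the
Baker-Campbell-Hausdorff formula. -/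
structure Nilpotentisation (W : ℕ → Submodule ℝ L) [DirectSum.Decomposition W] (m : ℕ) where
  /-- The exponential map of `N`. -/
  exp ::
  /-- The inverse of the exponential map of `N`. -/
  log : L

instance (W : ℕ → Submodule ℝ L) [DirectSum.Decomposition W] (m : ℕ) :
    Mul (Nilpotentisation W m) where
  mul x y := Nilpotentisation.exp (nilBCH W m x.log y.log)

instance (W : ℕ → Submodule ℝ L) [DirectSum.Decomposition W] (m : ℕ) :
    One (Nilpotentisation W m) where
  one := Nilpotentisation.exp 0

end Nilpotentisation

/-! ### Words, costs and boxes

In this section `H` is a group with Lie algebra (in exponential notation) `L` and exponential map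
`e : L → H`, and `Y 0, …, Y (M - 1)` is a finite sequence of vectors. -/

section Boxes

variable {L : Type*} [AddCommGroup L] [Module ℝ L] {H : Type*} [Mul H] [One H]

/-- The ordered product `e (t₁ Y₁) e (t₂ Y₂) ⋯ e (t_M Y_M)`. -/
def wordProd (e : L → H) {M : ℕ} (Y : Fin M → L) (t : Fin M → ℝ) : H :=
  (List.ofFn fun i => e (t i • Y i)).prod

/-- The minimal `ℓ¹` cost `Δ¹(x) = inf {∑ |tᵢ| : x = ∏ e (tᵢ Yᵢ)}`, equal to `∞` if `x` is not such
a product. -/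
def delta1 (e : L → H) {M : ℕ} (Y : Fin M → L) (x : H) : ℝ≥0∞ :=
  ⨅ (t : Fin M → ℝ) (_ : x = wordProd e Y t), ENNReal.ofReal (∑ i, |t i|)

/-- The box `Box¹(ε) = {x : Δ¹(x) < ε}`. -/
def box1 (e : L → H) {M : ℕ} (Y : Fin M → L) (ε : ℝ) : Set H :=
  {x | delta1 e Y x < ENNReal.ofReal ε}

end Boxes

end

/-!
In exponential coordinates the product of `G` near the identity is the Baker-Campbell-Hausdorff
product of the bracket of `𝔤`. The dilation `δ_ε` turns it into the product of the rescaled bracket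
`[x, y]_ε = δ_ε⁻¹ [δ_ε x, δ_ε y]` and multiplies the cost of a word by `ε`. Since
`[Vⁱ, Vʲ] ⊆ Vⁱ⁺ʲ`, the rescaled bracket is polynomial in `ε`, with value `[·, ·]ₙ` at `ε = 0`, so
the groups `G` seen at scale `ε` form a differentiable family through `N`.

As the `Xᵢ` generate the nilpotent Lie algebra, there is a word which is the identity of `N` and at
which the word map of `N` is a submersion; this is seen in a faithful linear representation, the
adjoint action extended by the derivation that multiplies `Wⱼ` by `j`. The inverse function theorem,
applied with `ε` as an additional variable, then shows that the boxes of a fixed size of all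
rescaled brackets with `ε` small contain a common ball. By continuity this ball contains the boxes
of another fixed size, and dilating back compares the boxes of `G` and of `N` at every small scale.
-/

namespace BallBox

open Set Filter Topology NormedSpace
open scoped NNReal

noncomputable section

/-! ### The exponential and the logarithmic series in a Banach algebra -/

theorem norm_pow_mul_le {A : Type*} [NormedRing A] (a b : A) (k : ℕ) :
    ‖a ^ k * b‖ ≤ ‖a‖ ^ k * ‖b‖ := by
  induction k with
  | zero => simp
  | succ k ih =>
    calc ‖a ^ (k + 1) * b‖ = ‖a * (a ^ k * b)‖ := by rw [pow_succ', mul_assoc]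
      _ ≤ ‖a‖ * (‖a‖ ^ k * ‖b‖) := norm_mul_le_of_le le_rfl ih
      _ = ‖a‖ ^ (k + 1) * ‖b‖ := by rw [pow_succ', mul_assoc]

section LogSeries

variable {A : Type*} [NormedRing A] [NormedAlgebra ℝ A]

/-- The series of `log (1 + a) / a`, which converges for `‖a‖ < 1`. -/
def logSeries (a : A) : A := ∑' k : ℕ, ((-1) ^ k / ((k : ℝ) + 1)) • a ^ k

/-- The function `ψ(a) = a log a / (a - 1)` of the integral form of the Baker-Campbell-Hausdorff
formula. -/
def bchPsi (a : A) : A := a * logSeries (a - 1)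

theorem abs_logSeries_coeff_le_one (k : ℕ) : |((-1) ^ k / ((k : ℝ) + 1))| ≤ 1 := by
  have one_le : (1 : ℝ) ≤ |(k : ℝ) + 1| := by
    rw [abs_of_pos (by positivity)]
    linarith [k.cast_nonneg (α := ℝ)]
  rw [abs_div, abs_pow, abs_neg, abs_one, one_pow]
  exact div_le_one_of_le₀ one_le (by positivity)

variable [CompleteSpace A]

theorem summable_logSeries {a : A} (ha : ‖a‖ < 1) :
    Summable fun k : ℕ => ((-1) ^ k / ((k : ℝ) + 1)) • a ^ k := by
  refine .of_norm_bounded (g := fun k => ‖a‖ ^ k * ‖(1 : A)‖)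
    ((summable_geometric_of_lt_one (norm_nonneg _) ha).mul_right _) fun k => ?_
  calc ‖((-1) ^ k / ((k : ℝ) + 1)) • a ^ k‖ ≤ 1 * ‖a ^ k * 1‖ := by
        rw [norm_smul, mul_one]
        gcongr
        exact abs_logSeries_coeff_le_one k
    _ ≤ ‖a‖ ^ k * ‖(1 : A)‖ := by rw [one_mul]; exact norm_pow_mul_le a 1 k

theorem commute_logSeries {a b : A} (ha : ‖a‖ < 1) (h : Commute b a) :
    Commute b (logSeries a) := by
  rw [commute_iff_eq, logSeries, ← (summable_logSeries ha).tsum_mul_left,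
    ← (summable_logSeries ha).tsum_mul_right]
  exact tsum_congr fun k => ((h.pow_right k).smul_right _).eq

theorem contDiffAt_logSeries : ContDiffAt ℝ 1 (logSeries : A → A) 0 := by
  set series := FormalMultilinearSeries.ofScalars A fun k : ℕ => ((-1) ^ k / ((k : ℝ) + 1))
  have one_le_radius : 1 ≤ series.radius := by
    refine series.le_radius_of_bound (r := 1) (max 1 ‖(1 : A)‖) fun n => ?_
    rw [FormalMultilinearSeries.ofScalars_norm_eq_mul, NNReal.coe_one, one_pow, mul_one]
    calc _ ≤ 1 * ‖ContinuousMultilinearMap.mkPiAlgebraFin ℝ n A‖ := by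
          gcongr
          exact abs_logSeries_coeff_le_one n
      _ ≤ max 1 ‖(1 : A)‖ := by
          rw [one_mul]
          exact ContinuousMultilinearMap.norm_mkPiAlgebraFin_le
  have sum_eq : series.sum = logSeries := funext (FormalMultilinearSeries.ofScalars_sum_eq _)
  exact sum_eq ▸
    (series.hasFPowerSeriesOnBall (one_pos.trans_le one_le_radius)).analyticAt.contDiffAt

theorem contDiffAt_bchPsi : ContDiffAt ℝ 1 (bchPsi : A → A) 1 := by
  have sub_one : ContDiffAt ℝ 1 (fun a : A => a - 1) 1 := contDiffAt_id.sub contDiffAt_const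
  exact contDiffAt_id.mul
    (ContDiffAt.comp (g := logSeries) 1 ((sub_self (1 : A)).symm ▸ contDiffAt_logSeries) sub_one)

end LogSeries

section Exponential

variable {A : Type*} [NormedRing A] [NormedAlgebra ℝ A]

/-- The integral `∫₀ˢ exp (τ u) dτ`, that is `(exp (s u) - 1) / u` when `u` is invertible. -/
def expPrimitive (u : A) (s : ℝ) : A := ∫ τ in (0 : ℝ)..s, exp (τ • u)

/-- The function `(1 - exp (-u)) / u`: for `u = ad x`, the differential of the exponential map
at `x` in the left trivialisation. -/
def dexpFactor (u : A) : A := expPrimitive (-u) 1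

theorem expPrimitive_zero (u : A) : expPrimitive u 0 = 0 := intervalIntegral.integral_same

variable [CompleteSpace A]

theorem contDiff_exp : ContDiff ℝ 1 (exp : A → A) :=
  let _ : NormedAlgebra ℚ A := NormedAlgebra.restrictScalars ℚ ℝ A
  contDiff_iff_contDiffAt.2 fun a => (exp_analytic (𝕂 := ℝ) a).contDiffAt

theorem exp_mul_exp_neg (u : A) : exp u * exp (-u) = 1 := by
  let _ : NormedAlgebra ℚ A := NormedAlgebra.restrictScalars ℚ ℝ A
  rw [← exp_add_of_commute (Commute.refl u).neg_right, add_neg_cancel, exp_zero]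

theorem exp_neg_mul_exp (u : A) : exp (-u) * exp u = 1 := by
  simpa only [neg_neg] using exp_mul_exp_neg (-u)

theorem continuous_exp_smul (u : A) : Continuous fun s : ℝ => exp (s • u) :=
  contDiff_exp.continuous.comp (by fun_prop)

theorem hasDerivAt_expPrimitive (u : A) (s : ℝ) : HasDerivAt (expPrimitive u) (exp (s • u)) s :=
  (continuous_exp_smul u).integral_hasStrictDerivAt 0 s |>.hasDerivAt

theorem continuous_expPrimitive (u : A) : Continuous (expPrimitive u) :=
  continuous_iff_continuousAt.2 fun s => (hasDerivAt_expPrimitive u s).continuousAt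

theorem dexpFactor_zero : dexpFactor (0 : A) = 1 := by
  simp [dexpFactor, expPrimitive]

theorem continuous_dexpFactor : Continuous (dexpFactor : A → A) :=
  intervalIntegral.continuous_parametric_intervalIntegral_of_continuous'
    (f := fun (u : A) (τ : ℝ) => exp (τ • -u)) (contDiff_exp.continuous.comp (by fun_prop)) 0 1

theorem expPrimitive_mul (u : A) (s : ℝ) : expPrimitive u s * u = exp (s • u) - 1 := by
  have integral_deriv : ∫ τ in (0 : ℝ)..s, exp (τ • u) * u = exp (s • u) - exp ((0 : ℝ) • u) :=
    intervalIntegral.integral_eq_sub_of_hasDerivAt (fun τ _ => hasDerivAt_exp_smul_const u τ)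
      (((continuous_exp_smul u).mul continuous_const).intervalIntegrable _ _)
  rw [zero_smul, exp_zero] at integral_deriv
  rw [← integral_deriv]
  exact (((ContinuousLinearMap.mul ℝ A).flip u).intervalIntegral_comp_comm
    ((continuous_exp_smul u).intervalIntegrable _ _)).symm

theorem commute_expPrimitive {u v : A} (h : Commute v u) (s : ℝ) :
    Commute v (expPrimitive u s) := by
  have integrable := (continuous_exp_smul u).intervalIntegrable (μ := MeasureTheory.volume) 0 s
  have left := (ContinuousLinearMap.mul ℝ A v).intervalIntegral_comp_comm integrable
  have right := ((ContinuousLinearMap.mul ℝ A).flip v).intervalIntegral_comp_comm integrable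
  calc v * expPrimitive u s = ∫ τ in (0 : ℝ)..s, v * exp (τ • u) := left.symm
    _ = ∫ τ in (0 : ℝ)..s, exp (τ • u) * v :=
        intervalIntegral.integral_congr fun τ _ => (h.smul_right τ).exp_right.eq
    _ = expPrimitive u s * v := right

theorem mul_expPrimitive (u : A) (s : ℝ) : u * expPrimitive u s = exp (s • u) - 1 := by
  rw [(commute_expPrimitive (Commute.refl u) s).eq, expPrimitive_mul]

theorem commute_exp_expPrimitive (u : A) (s : ℝ) : Commute (exp (s • u)) (expPrimitive u s) :=
  commute_expPrimitive ((Commute.refl u).smul_left s).exp_left s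

theorem exp_mul_dexpFactor (u : A) : exp u * dexpFactor u = expPrimitive u 1 := by
  let _ : NormedAlgebra ℚ A := NormedAlgebra.restrictScalars ℚ ℝ A
  calc exp u * dexpFactor u = ∫ τ in (0 : ℝ)..1, exp u * exp (τ • -u) :=
        ((ContinuousLinearMap.mul ℝ A (exp u)).intervalIntegral_comp_comm
          ((continuous_exp_smul (-u)).intervalIntegrable _ _)).symm
    _ = ∫ τ in (0 : ℝ)..1, exp ((1 - τ) • u) := by
        refine intervalIntegral.integral_congr fun τ _ => ?_
        rw [← exp_add_of_commute ((Commute.refl u).neg_right.smul_right τ), sub_smul, one_smul,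
          smul_neg, sub_eq_add_neg]
    _ = expPrimitive u 1 := by
        rw [intervalIntegral.integral_comp_sub_left (fun τ : ℝ => exp (τ • u)), sub_self, sub_zero,
          expPrimitive]

end Exponential

section LogExp

variable {A : Type*} [NormedRing A] [NormedAlgebra ℝ A]

/-- The element `u` is so small that the logarithmic series converges at `exp (s u)`, uniformly for
`s` in a neighbourhood of `[0, 1]`. -/
def IsSmallExponent (u : A) : Prop := ∀ s ∈ Ioo (-1 : ℝ) 2, ‖exp (s • u) - 1‖ ≤ 1 / 2

theorem IsSmallExponent.norm_exp_sub_one_lt {u : A} (hu : IsSmallExponent u) :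
    ‖exp u - 1‖ < 1 := by
  have at_one := hu 1 (by norm_num)
  rw [one_smul] at at_one
  linarith

theorem hasDerivAt_pow_of_commute {f : ℝ → A} {f' : A} {s : ℝ} (hf : HasDerivAt f f' s)
    (hc : Commute (f s) f') (k : ℕ) :
    HasDerivAt (fun x => f x ^ (k + 1)) (((k : ℝ) + 1) • (f s ^ k * f')) s := by
  refine (hf.fun_pow' (k + 1)).congr_deriv ?_
  have summand_eq : ∀ i ∈ Finset.range (k + 1),
      f s ^ ((k + 1).pred - i) * f' * f s ^ i = f s ^ k * f' := fun i hi => by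
    rw [mul_assoc, ← (hc.pow_left i).eq, ← mul_assoc, ← pow_add, Nat.pred_succ,
      Nat.sub_add_cancel (Nat.le_of_lt_succ (Finset.mem_range.1 hi))]
  rw [Finset.sum_congr rfl summand_eq, Finset.sum_const, Finset.card_range,
    ← Nat.cast_smul_eq_nsmul ℝ, Nat.cast_succ]

/-- The `k`-th term of the expansion of `log (exp (s u)) / u` in powers of
`exp (s u) - 1 = u * expPrimitive u s`. -/
def logExpTerm (u : A) (k : ℕ) (s : ℝ) : A :=
  ((-1) ^ k / ((k : ℝ) + 1)) • (u ^ k * expPrimitive u s ^ (k + 1))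

theorem logExpTerm_zero (u : A) (k : ℕ) : logExpTerm u k 0 = 0 := by
  rw [logExpTerm, expPrimitive_zero, zero_pow k.succ_ne_zero, mul_zero, smul_zero]

variable [CompleteSpace A]

theorem eventually_isSmallExponent : ∀ᶠ u : A in 𝓝 0, IsSmallExponent u := by
  obtain ⟨δ, hδ, near_one⟩ := Metric.continuousAt_iff.1
    (contDiff_exp (A := A)).continuous.continuousAt (1 / 2) (by norm_num)
  filter_upwards [Metric.ball_mem_nhds (0 : A) (half_pos hδ)] with u hu s hs
  have norm_lt : ‖s • u‖ < δ := by
    have abs_le_two : |s| ≤ 2 := abs_le.2 ⟨by linarith [hs.1], hs.2.le⟩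
    rw [mem_ball_zero_iff] at hu
    calc ‖s • u‖ = |s| * ‖u‖ := norm_smul s u
      _ ≤ 2 * ‖u‖ := by gcongr
      _ < δ := by linarith
  have close := near_one (x := s • u) (by rwa [dist_zero_right])
  rw [exp_zero, dist_eq_norm] at close
  exact close.le

theorem logExpTerm_one (u : A) (k : ℕ) :
    logExpTerm u k 1 = ((-1) ^ k / ((k : ℝ) + 1)) • (exp u - 1) ^ k * expPrimitive u 1 := by
  have mul_eq : u * expPrimitive u 1 = exp u - 1 := by rw [mul_expPrimitive, one_smul]
  rw [logExpTerm, ← mul_eq, (commute_expPrimitive (Commute.refl u) 1).mul_pow, smul_mul_assoc,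
    mul_assoc, ← pow_succ]

theorem hasDerivAt_logExpTerm (u : A) (k : ℕ) (s : ℝ) :
    HasDerivAt (logExpTerm u k) ((1 - exp (s • u)) ^ k * exp (s • u)) s := by
  have deriv_pow := hasDerivAt_pow_of_commute (hasDerivAt_expPrimitive u s)
    (commute_exp_expPrimitive u s).symm k
  refine ((deriv_pow.const_mul (u ^ k)).const_smul ((-1) ^ k / ((k : ℝ) + 1))).congr_deriv ?_
  have one_sub_pow : (1 - exp (s • u)) ^ k = (-1 : ℝ) ^ k • (u ^ k * expPrimitive u s ^ k) := by
    rw [← (commute_expPrimitive (Commute.refl u) s).mul_pow, mul_expPrimitive, ← smul_pow,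
      neg_one_smul, neg_sub]
  rw [one_sub_pow, mul_smul_comm, smul_smul, smul_mul_assoc, mul_assoc,
    div_mul_cancel₀ _ (by positivity)]

theorem hasDerivAt_tsum_logExpTerm {u : A} (hu : IsSmallExponent u) {s : ℝ}
    (hs : s ∈ Ioo (-1 : ℝ) 2) : HasDerivAt (fun s => ∑' k, logExpTerm u k s) 1 s := by
  have norm_one_sub : ∀ s ∈ Ioo (-1 : ℝ) 2, ‖1 - exp (s • u)‖ ≤ 1 / 2 := fun s hs => by
    rw [norm_sub_rev]
    exact hu s hs
  have norm_exp : ∀ s ∈ Ioo (-1 : ℝ) 2, ‖exp (s • u)‖ ≤ ‖(1 : A)‖ + 1 / 2 := fun s hs =>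
    norm_le_norm_add_const_of_dist_le (by rw [dist_eq_norm]; exact hu s hs)
  have deriv_tsum := hasDerivAt_tsum_of_isPreconnected
    ((summable_geometric_of_lt_one (by norm_num) (by norm_num)).mul_right (‖(1 : A)‖ + 1 / 2))
    isOpen_Ioo isPreconnected_Ioo (fun k s _ => hasDerivAt_logExpTerm u k s)
    (fun k s hs => (norm_pow_mul_le _ _ k).trans (show _ ≤ (1 / 2 : ℝ) ^ k * _ by
      gcongr; exacts [norm_one_sub s hs, norm_exp s hs]))
    (y₀ := 0) (by norm_num) (by simp only [logExpTerm_zero, summable_zero]) hs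
  have norm_lt_one : ‖1 - exp (s • u)‖ < 1 := (norm_one_sub s hs).trans_lt (by norm_num)
  have geometric := geom_series_mul_neg (1 - exp (s • u)) norm_lt_one
  rw [sub_sub_cancel] at geometric
  rwa [(summable_geometric_of_norm_lt_one norm_lt_one).tsum_mul_right, geometric] at deriv_tsum

theorem logSeries_mul_expPrimitive {u : A} (hu : IsSmallExponent u) :
    logSeries (exp u - 1) * expPrimitive u 1 = 1 := by
  have integral_one : ∫ _ in (0 : ℝ)..1, (1 : A) =
      (∑' k, logExpTerm u k 1) - ∑' k, logExpTerm u k 0 :=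
    intervalIntegral.integral_eq_sub_of_hasDerivAt
      (fun s hs => hasDerivAt_tsum_logExpTerm hu (by
        rw [uIcc_of_le zero_le_one] at hs; constructor <;> linarith [hs.1, hs.2]))
      intervalIntegrable_const
  simp only [logExpTerm_zero, tsum_zero, sub_zero, intervalIntegral.integral_const,
    one_smul, logExpTerm_one] at integral_one
  rw [logSeries, ← (summable_logSeries hu.norm_exp_sub_one_lt).tsum_mul_right, ← integral_one]

theorem bchPsi_exp_mul_dexpFactor {u : A} (hu : IsSmallExponent u) :
    bchPsi (exp u) * dexpFactor u = 1 := by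
  have comm : Commute (exp u) (logSeries (exp u - 1)) :=
    commute_logSeries hu.norm_exp_sub_one_lt
      ((Commute.refl (exp u)).sub_right (Commute.one_right (exp u)))
  rw [bchPsi, comm.eq, mul_assoc, exp_mul_dexpFactor, logSeries_mul_expPrimitive hu]

theorem dexpFactor_mul_bchPsi_exp {u : A} (hu : IsSmallExponent u) :
    dexpFactor u * bchPsi (exp u) = 1 := by
  have comm_exp : Commute (dexpFactor u) (exp u) :=
    (commute_expPrimitive (Commute.refl u).neg_right.exp_left 1).symm
  have comm_logSeries : Commute (dexpFactor u) (logSeries (exp u - 1)) :=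
    commute_logSeries hu.norm_exp_sub_one_lt (comm_exp.sub_right (Commute.one_right _))
  rw [← bchPsi_exp_mul_dexpFactor hu]
  exact (comm_exp.mul_right comm_logSeries).eq

end LogExp

/-! ### The Baker-Campbell-Hausdorff product of a continuous bracket -/

section Paths

variable {A : Type*} [NormedRing A] [NormedAlgebra ℝ A]

/-- The paths `t ↦ t a`. -/
def linearPath : A →L[ℝ] C(unitInterval, A) :=
  ContinuousLinearMap.mul ℝ C(unitInterval, A) ⟨fun t => (t : ℝ) • 1, by fun_prop⟩ ∘L
    ContinuousLinearMap.const ℝ unitInterval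

theorem linearPath_apply (a : A) (t : unitInterval) : linearPath a t = (t : ℝ) • a :=
  smul_one_mul (t : ℝ) a

/-- Integration of paths over the unit interval. -/
def pathIntegral : C(unitInterval, A) →L[ℝ] A :=
  LinearMap.mkContinuous
    { toFun := fun f => ∫ t in (0 : ℝ)..1, IccExtend zero_le_one f t
      map_add' := fun f g => by
        rw [← intervalIntegral.integral_add (f.continuous.Icc_extend'.intervalIntegrable _ _)
          (g.continuous.Icc_extend'.intervalIntegrable _ _)]
        rfl
      map_smul' := fun c f => intervalIntegral.integral_smul c (IccExtend zero_le_one f) } 1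
    fun f => by
      have norm_le := intervalIntegral.norm_integral_le_of_norm_le_const (a := 0) (b := 1)
        (f := IccExtend zero_le_one f) fun t _ => f.norm_coe_le_norm _
      rwa [sub_zero, abs_one, mul_one, ← one_mul ‖f‖] at norm_le

theorem pathIntegral_apply (f : C(unitInterval, A)) :
    pathIntegral f = ∫ t in (0 : ℝ)..1, IccExtend zero_le_one f t := rfl

variable [CompleteSpace A]

theorem exp_path_apply (f : C(unitInterval, A)) (t : unitInterval) : exp f t = exp (f t) :=
  let _ : NormedAlgebra ℚ A := NormedAlgebra.restrictScalars ℚ ℝ A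
  let _ : NormedAlgebra ℚ C(unitInterval, A) := NormedAlgebra.restrictScalars ℚ ℝ _
  map_exp ((Pi.evalRingHom (fun _ : unitInterval => A) t).comp ContinuousMap.coeFnRingHom)
    (ContinuousMap.evalCLM ℝ t : C(unitInterval, A) →L[ℝ] A).continuous f

theorem bchPsi_path_apply {f : C(unitInterval, A)} (hf : ‖f - 1‖ < 1) (t : unitInterval) :
    bchPsi f t = bchPsi (f t) :=
  congrArg (f t * ·)
    ((ContinuousMap.evalCLM ℝ t : C(unitInterval, A) →L[ℝ] A).map_tsum (summable_logSeries hf))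

end Paths

section BCH

variable {E : Type*} [NormedAddCommGroup E] [NormedSpace ℝ E]

/-- The Baker-Campbell-Hausdorff product of a continuous bracket `B`, in integral form. -/
def bch (B : E →L[ℝ] E →L[ℝ] E) (x y : E) : E :=
  x + ∫ t in (0 : ℝ)..1, bchPsi (exp (B x) * exp (t • B y)) y

/-- The path `t ↦ exp (ad x) exp (t ad y)`. -/
def adPath (B : E →L[ℝ] E →L[ℝ] E) (x y : E) : C(unitInterval, E →L[ℝ] E) :=
  exp (ContinuousLinearMap.const ℝ unitInterval (B x)) * exp (linearPath (B y))

theorem adPath_zero (B : E →L[ℝ] E →L[ℝ] E) : adPath B 0 0 = 1 := by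
  rw [adPath, map_zero, map_zero, map_zero, exp_zero]
  exact mul_one (1 : C(unitInterval, E →L[ℝ] E))

theorem bch_zero_zero (B : E →L[ℝ] E →L[ℝ] E) : bch B 0 0 = 0 := by
  simp only [bch, map_zero, intervalIntegral.integral_zero, add_zero]

theorem map_bchPsi {A A' : Type*} [NormedRing A] [NormedAlgebra ℝ A] [NormedRing A']
    [NormedAlgebra ℝ A'] (c : A ≃A[ℝ] A') (a : A) : c (bchPsi a) = bchPsi (c a) := by
  have map_logSeries : c (logSeries (a - 1)) = logSeries (c a - 1) :=
    (c.toContinuousLinearEquiv.map_tsum (f := fun k : ℕ =>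
      ((-1) ^ k / ((k : ℝ) + 1)) • (a - 1) ^ k)).trans <| tsum_congr fun k => by
        change c (_ • (a - 1) ^ k) = _
        rw [map_smul, map_pow, map_sub, map_one]
  rw [bchPsi, bchPsi, map_mul, map_logSeries]

variable [CompleteSpace E]

theorem adPath_apply (B : E →L[ℝ] E →L[ℝ] E) (x y : E) (t : unitInterval) :
    adPath B x y t = exp (B x) * exp ((t : ℝ) • B y) := by
  rw [adPath, ContinuousMap.mul_apply, exp_path_apply, exp_path_apply, linearPath_apply]
  rfl

theorem bch_eq_pathIntegral {B : E →L[ℝ] E →L[ℝ] E} {x y : E} (h : ‖adPath B x y - 1‖ < 1) :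
    bch B x y = x + pathIntegral (bchPsi (adPath B x y)) y := by
  rw [bch, pathIntegral_apply, ContinuousLinearMap.intervalIntegral_apply
    ((bchPsi (adPath B x y)).continuous.Icc_extend'.intervalIntegrable _ _)]
  congr 1
  refine intervalIntegral.integral_congr fun t ht => ?_
  rw [uIcc_of_le zero_le_one] at ht
  simp only [IccExtend_of_mem zero_le_one _ ht, bchPsi_path_apply h, adPath_apply]

theorem contDiff_adPath : ContDiff ℝ 1
    fun p : (E →L[ℝ] E →L[ℝ] E) × E × E => adPath p.1 p.2.1 p.2.2 := by
  have contDiff_left : ContDiff ℝ 1 fun p : (E →L[ℝ] E →L[ℝ] E) × E × E => p.1 p.2.1 :=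
    contDiff_fst.clm_apply (contDiff_fst.comp contDiff_snd)
  have contDiff_right : ContDiff ℝ 1 fun p : (E →L[ℝ] E →L[ℝ] E) × E × E => p.1 p.2.2 :=
    contDiff_fst.clm_apply (contDiff_snd.comp contDiff_snd)
  exact (contDiff_exp.comp
      ((ContinuousLinearMap.const ℝ unitInterval).contDiff.comp contDiff_left)).mul
    (contDiff_exp.comp (linearPath.contDiff.comp contDiff_right))

theorem eventually_norm_adPath_sub_one_lt (B : E →L[ℝ] E →L[ℝ] E) :
    ∀ᶠ p : (E →L[ℝ] E →L[ℝ] E) × E × E in 𝓝 (B, 0, 0), ‖adPath p.1 p.2.1 p.2.2 - 1‖ < 1 := by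
  have near_one := (contDiff_adPath (E := E)).continuous.tendsto (B, 0, 0)
  rw [adPath_zero] at near_one
  filter_upwards [near_one (Metric.ball_mem_nhds 1 one_pos)] with p hp
  exact mem_ball_iff_norm.1 hp

theorem contDiffAt_bch (B : E →L[ℝ] E →L[ℝ] E) :
    ContDiffAt ℝ 1 (fun p : (E →L[ℝ] E →L[ℝ] E) × E × E => bch p.1 p.2.1 p.2.2) (B, 0, 0) := by
  have contDiffAt_psi : ContDiffAt ℝ 1
      (fun p : (E →L[ℝ] E →L[ℝ] E) × E × E => bchPsi (adPath p.1 p.2.1 p.2.2)) (B, 0, 0) :=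
    ContDiffAt.comp (g := bchPsi) (B, 0, 0) ((adPath_zero B).symm ▸ contDiffAt_bchPsi)
      contDiff_adPath.contDiffAt
  have contDiffAt_operator : ContDiffAt ℝ 1 (fun p : (E →L[ℝ] E →L[ℝ] E) × E × E =>
      pathIntegral (bchPsi (adPath p.1 p.2.1 p.2.2))) (B, 0, 0) :=
    (pathIntegral (A := E →L[ℝ] E)).contDiff.contDiffAt.comp _ contDiffAt_psi
  have contDiffAt_integral : ContDiffAt ℝ 1 (fun p : (E →L[ℝ] E →L[ℝ] E) × E × E =>
      p.2.1 + pathIntegral (bchPsi (adPath p.1 p.2.1 p.2.2)) p.2.2) (B, 0, 0) :=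
    (contDiff_fst.comp contDiff_snd).contDiffAt.add
      (contDiffAt_operator.clm_apply (contDiff_snd.comp contDiff_snd).contDiffAt)
  exact contDiffAt_integral.congr_of_eventuallyEq
    ((eventually_norm_adPath_sub_one_lt B).mono fun p hp => bch_eq_pathIntegral hp)

theorem bch_map {B B' : E →L[ℝ] E →L[ℝ] E} (Φ : E ≃L[ℝ] E)
    (h : ∀ x y, Φ (B' x y) = B (Φ x) (Φ y)) (x y : E) :
    bch B (Φ x) (Φ y) = Φ (bch B' x y) := by
  let _ : NormedAlgebra ℚ (E →L[ℝ] E) := NormedAlgebra.restrictScalars ℚ ℝ _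
  set conj := Φ.conjContinuousAlgEquiv
  have conj_ad : ∀ x, B (Φ x) = conj (B' x) := fun x => by
    ext z
    rw [ContinuousLinearEquiv.conjContinuousAlgEquiv_apply_apply, h, Φ.apply_symm_apply]
  have conj_exp : ∀ u, exp (conj u) = conj (exp u) := fun u =>
    (map_exp conj conj.continuous u).symm
  rw [bch, bch, map_add]
  congr 1
  rw [intervalIntegral.integral_of_le zero_le_one, intervalIntegral.integral_of_le zero_le_one,
    ← ContinuousLinearEquiv.integral_comp_comm]
  refine MeasureTheory.integral_congr_ae (Eventually.of_forall fun t => ?_)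
  simp only [conj_ad]
  rw [← map_smul, conj_exp, conj_exp, ← map_mul, ← map_bchPsi,
    ContinuousLinearEquiv.conjContinuousAlgEquiv_apply_apply, Φ.symm_apply_apply]

end BCH

/-! ### The differential of the exponential map -/

theorem gronwallBound_zero_mul (K ε x : ℝ) :
    gronwallBound 0 K ε x = gronwallBound 0 K 1 x * ε := by
  unfold gronwallBound
  split_ifs <;> ring

theorem norm_sub_sub_le_of_lipschitzOnWith {X Y : Type*} [NormedAddCommGroup X] [NormedSpace ℝ X]
    [NormedAddCommGroup Y] [NormedSpace ℝ Y] {f : X → Y} {f' : X → X →L[ℝ] Y} {U : Set X}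
    (hU : Convex ℝ U) (hf : ∀ x ∈ U, HasFDerivAt f (f' x) x) {K : ℝ≥0}
    (hK : LipschitzOnWith K f' U) {x h : X} (hx : x ∈ U) (hxh : x + h ∈ U) :
    ‖f (x + h) - f x - f' x h‖ ≤ K * ‖h‖ * ‖h‖ := by
  have segment_subset : segment ℝ x (x + h) ⊆ U := hU.segment_subset hx hxh
  have norm_deriv_sub_le : ∀ y ∈ segment ℝ x (x + h), ‖f' y - f' x‖ ≤ K * ‖h‖ := fun y hy => by
    refine (hK.norm_sub_le (segment_subset hy) hx).trans ?_
    gcongr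
    simpa only [add_sub_cancel_left] using norm_sub_le_of_mem_segment hy
  have mean_value := (convex_segment x (x + h)).norm_image_sub_le_of_norm_hasFDerivWithin_le'
    (fun y hy => (hf y (segment_subset hy)).hasFDerivWithinAt) norm_deriv_sub_le
    (left_mem_segment ℝ x (x + h)) (right_mem_segment ℝ x (x + h))
  rwa [add_sub_cancel_left] at mean_value

section MaurerCartanFrame

variable {E : Type*} [NormedAddCommGroup E] [NormedSpace ℝ E]
  {F : Type*} [NormedAddCommGroup F] [NormedSpace ℝ F]

/-- A family of vector fields `g ↦ L g v` on a convex open set `U`, linear in `v : E`, which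
satisfies the Maurer-Cartan equation for the bracket `B`: the left-invariant fields of a Lie group
in a chart are of this form. The derivative `L'` of `L` is bounded by `K` and `K`-Lipschitz. -/
structure IsMaurerCartanFrame (B : E →L[ℝ] E →L[ℝ] E) (L : F → E →L[ℝ] F)
    (L' : F → F →L[ℝ] E →L[ℝ] F) (U : Set F) (K : ℝ≥0) : Prop where
  isOpen : IsOpen U
  convex : Convex ℝ U
  hasFDerivAt : ∀ g ∈ U, HasFDerivAt L (L' g) g
  lipschitzOnWith : LipschitzOnWith K L' U
  norm_le : ∀ g ∈ U, ‖L' g‖ ≤ K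
  maurerCartan : ∀ g ∈ U, ∀ v w, L' g (L g v) w - L' g (L g w) v = L g (B v w)

/-- The variation in the direction `w` of the integral curve `g` of the field with parameter
`v`. -/
def jacobiField (B : E →L[ℝ] E →L[ℝ] E) (L : F → E →L[ℝ] F) (g : ℝ → F) (v w : E) (s : ℝ) : F :=
  L (g s) (expPrimitive (-(B v)) s w)

variable {B : E →L[ℝ] E →L[ℝ] E} {L : F → E →L[ℝ] F} {L' : F → F →L[ℝ] E →L[ℝ] F} {U : Set F}
  {K : ℝ≥0}

theorem IsMaurerCartanFrame.lipschitzOnWith_apply (hL : IsMaurerCartanFrame B L L' U K) (v : E) :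
    LipschitzOnWith (K * ‖v‖₊) (fun g => L g v) U := by
  refine LipschitzOnWith.of_dist_le_mul fun x hx y hy => ?_
  have norm_sub_le : ‖L x - L y‖ ≤ K * ‖x - y‖ :=
    hL.convex.norm_image_sub_le_of_norm_hasFDerivWithin_le
      (fun z hz => (hL.hasFDerivAt z hz).hasFDerivWithinAt) hL.norm_le hy hx
  rw [dist_eq_norm, dist_eq_norm, ← sub_apply]
  calc ‖(L x - L y) v‖ ≤ ‖L x - L y‖ * ‖v‖ := ContinuousLinearMap.le_opNorm _ _
    _ ≤ K * ‖x - y‖ * ‖v‖ := by gcongr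
    _ = (K * ‖v‖₊ : ℝ≥0) * ‖x - y‖ := by push_cast; ring

theorem IsMaurerCartanFrame.norm_sub_linearisation_le (hL : IsMaurerCartanFrame B L L' U K)
    {g J : F} (hg : g ∈ U) (hgJ : g + J ∈ U) (v w : E) :
    ‖L (g + J) (v + w) - (L g v + (L g w + L' g J v))‖ ≤
      K * ‖J‖ * ‖J‖ * ‖v + w‖ + K * ‖J‖ * ‖w‖ := by
  have decomposition : L (g + J) (v + w) - (L g v + (L g w + L' g J v)) =
      (L (g + J) - L g - L' g J) (v + w) + L' g J w := by
    simp only [sub_apply, map_add]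
    abel
  have remainder_le := norm_sub_sub_le_of_lipschitzOnWith hL.convex hL.hasFDerivAt
    hL.lipschitzOnWith hg hgJ
  calc ‖L (g + J) (v + w) - (L g v + (L g w + L' g J v))‖
      ≤ ‖L (g + J) - L g - L' g J‖ * ‖v + w‖ + ‖L' g‖ * ‖J‖ * ‖w‖ := by
        rw [decomposition]
        exact (norm_add_le _ _).trans (add_le_add (ContinuousLinearMap.le_opNorm _ _)
          (ContinuousLinearMap.le_opNorm₂ _ _ _))
    _ ≤ K * ‖J‖ * ‖J‖ * ‖v + w‖ + K * ‖J‖ * ‖w‖ := by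
        gcongr
        exact hL.norm_le g hg

variable [CompleteSpace E]

theorem hasDerivAt_expPrimitive_neg_apply (u : E →L[ℝ] E) (w : E) (s : ℝ) :
    HasDerivAt (fun s => expPrimitive (-u) s w) (w - u (expPrimitive (-u) s w)) s := by
  refine ((hasDerivAt_expPrimitive (-u) s).clm_apply (hasDerivAt_const s w)).congr_deriv ?_
  have exp_eq : exp (s • -u) = 1 - u * expPrimitive (-u) s := by
    rw [← neg_add_eq_sub, ← neg_mul, mul_expPrimitive, sub_add_cancel]
  rw [map_zero, add_zero, exp_eq]
  rfl

theorem IsMaurerCartanFrame.hasDerivAt_jacobiField (hL : IsMaurerCartanFrame B L L' U K)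
    {g : ℝ → F} {v : E} {s : ℝ} (hgU : g s ∈ U) (hg : HasDerivAt g (L (g s) v) s) (w : E) :
    HasDerivAt (jacobiField B L g v w) (L (g s) w + L' (g s) (jacobiField B L g v w s) v) s := by
  have deriv_frame : HasDerivAt (fun s => L (g s)) (L' (g s) (L (g s) v)) s :=
    (hL.hasFDerivAt (g s) hgU).comp_hasDerivAt s hg
  refine (deriv_frame.clm_apply (hasDerivAt_expPrimitive_neg_apply (B v) w s)).congr_deriv ?_
  rw [map_sub, ← hL.maurerCartan (g s) hgU, jacobiField]
  abel

theorem IsMaurerCartanFrame.exists_norm_jacobiField_le (hL : IsMaurerCartanFrame B L L' U K)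
    {g : ℝ → F} (hg : ContinuousOn g (Icc 0 1)) (hgU : ∀ s ∈ Icc (0 : ℝ) 1, g s ∈ U) (v : E) :
    ∃ C ≥ 0, ∀ s ∈ Icc (0 : ℝ) 1, ∀ w, ‖jacobiField B L g v w s‖ ≤ C * ‖w‖ := by
  have continuousOn_frame : ContinuousOn L U := fun x hx =>
    (hL.hasFDerivAt x hx).continuousAt.continuousWithinAt
  have continuousOn_jacobi : ContinuousOn (fun s => L (g s) ∘L expPrimitive (-(B v)) s)
      (Icc 0 1) :=
    (continuousOn_frame.comp hg hgU).clm_comp (continuous_expPrimitive _).continuousOn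
  obtain ⟨C, hC⟩ := isCompact_Icc.exists_bound_of_continuousOn continuousOn_jacobi
  exact ⟨C, (norm_nonneg _).trans (hC 0 (left_mem_Icc.2 zero_le_one)),
    fun s hs w => ContinuousLinearMap.le_of_opNorm_le _ (hC s hs) w⟩

-- The curve `g + jacobiField` solves the equation of the integral curve with parameter `v + w` up
-- to an error of order `‖w‖²`, so that Grönwall's inequality applies.
theorem IsMaurerCartanFrame.norm_sub_sub_jacobiField_le (hL : IsMaurerCartanFrame B L L' U K)
    {g f : ℝ → F} {v w : E} {C : ℝ} (hC : 0 ≤ C) (hw : ‖w‖ ≤ 1)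
    (hgU : ∀ s ∈ Icc (0 : ℝ) 1, g s ∈ U) (hg : ∀ s ∈ Icc (0 : ℝ) 1, HasDerivAt g (L (g s) v) s)
    (hfU : ∀ s ∈ Icc (0 : ℝ) 1, f s ∈ U)
    (hf : ∀ s ∈ Icc (0 : ℝ) 1, HasDerivAt f (L (f s) (v + w)) s) (h₀ : f 0 = g 0)
    (hJ : ∀ s ∈ Icc (0 : ℝ) 1, ‖jacobiField B L g v w s‖ ≤ C * ‖w‖)
    (hJU : ∀ s ∈ Icc (0 : ℝ) 1, g s + jacobiField B L g v w s ∈ U) :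
    ‖f 1 - g 1 - jacobiField B L g v w 1‖ ≤
      gronwallBound 0 (K * (‖v‖ + 1)) 1 1 * (K * C * C * (‖v‖ + 1) + K * C) * ‖w‖ ^ 2 := by
  set J := jacobiField B L g v w
  have norm_add_le_add_one : ‖v + w‖ ≤ ‖v‖ + 1 := (norm_add_le _ _).trans (by gcongr)
  have lipschitz : LipschitzOnWith (K * (‖v‖₊ + 1)) (fun x => L x (v + w)) U :=
    (hL.lipschitzOnWith_apply (v + w)).weaken (by gcongr; exact norm_add_le_add_one)
  have deriv_approx : ∀ s ∈ Icc (0 : ℝ) 1,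
      HasDerivAt (fun s => g s + J s) (L (g s) v + (L (g s) w + L' (g s) (J s) v)) s :=
    fun s hs => (hg s hs).add (hL.hasDerivAt_jacobiField (hgU s hs) (hg s hs) w)
  have error_le : ∀ s ∈ Icc (0 : ℝ) 1,
      dist (L (g s) v + (L (g s) w + L' (g s) (J s) v)) (L (g s + J s) (v + w)) ≤
        (K * C * C * (‖v‖ + 1) + K * C) * ‖w‖ ^ 2 := fun s hs => by
    rw [dist_comm, dist_eq_norm]
    calc ‖L (g s + J s) (v + w) - (L (g s) v + (L (g s) w + L' (g s) (J s) v))‖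
        ≤ K * ‖J s‖ * ‖J s‖ * ‖v + w‖ + K * ‖J s‖ * ‖w‖ :=
          hL.norm_sub_linearisation_le (hgU s hs) (hJU s hs) v w
      _ ≤ K * (C * ‖w‖) * (C * ‖w‖) * (‖v‖ + 1) + K * (C * ‖w‖) * ‖w‖ := by
          gcongr <;> exact hJ s hs
      _ = (K * C * C * (‖v‖ + 1) + K * C) * ‖w‖ ^ 2 := by ring
  have init_eq : f 0 = g 0 + J 0 := by
    simp only [J, jacobiField, expPrimitive_zero, zero_apply, map_zero, add_zero, h₀]
  have gronwall := dist_le_of_approx_trajectories_ODE_of_mem (a := 0) (b := 1) (εf := 0) (δ := 0)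
    (v := fun _ x => L x (v + w)) (s := fun _ => U) (fun _ _ => lipschitz)
    (HasDerivAt.continuousOn hf) (fun s hs => (hf s (Ico_subset_Icc_self hs)).hasDerivWithinAt)
    (fun _ _ => (dist_self _).le) (fun s hs => hfU s (Ico_subset_Icc_self hs))
    (HasDerivAt.continuousOn deriv_approx)
    (fun s hs => (deriv_approx s (Ico_subset_Icc_self hs)).hasDerivWithinAt)
    (fun s hs => error_le s (Ico_subset_Icc_self hs))
    (fun s hs => hJU s (Ico_subset_Icc_self hs))
    (dist_le_zero.2 init_eq) 1 (right_mem_Icc.2 zero_le_one)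
  rw [zero_add, gronwallBound_zero_mul, sub_zero, dist_eq_norm] at gronwall
  rw [sub_sub, mul_assoc]
  exact_mod_cast gronwall

theorem IsMaurerCartanFrame.hasFDerivAt_timeOne (hL : IsMaurerCartanFrame B L L' U K)
    {e : E → F} {V : Set E} (hV : IsOpen V)
    (hcurve : ∀ v ∈ V, ∀ s ∈ Icc (0 : ℝ) 1,
      HasDerivAt (fun s : ℝ => e (s • v)) (L (e (s • v)) v) s)
    (hmem : ∀ v ∈ V, ∀ s ∈ Icc (0 : ℝ) 1, e (s • v) ∈ U) {v : E} (hv : v ∈ V) :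
    HasFDerivAt e (L (e v) ∘L dexpFactor (B v)) v := by
  let g : ℝ → F := fun s => e (s • v)
  have continuousOn_g : ContinuousOn g (Icc 0 1) := HasDerivAt.continuousOn (hcurve v hv)
  obtain ⟨C, hC, norm_jacobi_le⟩ := hL.exists_norm_jacobiField_le continuousOn_g (hmem v hv) v
  obtain ⟨δ, hδ, thickening_subset⟩ :=
    (isCompact_Icc.image_of_continuousOn continuousOn_g).exists_thickening_subset_open hL.isOpen
      (image_subset_iff.2 (hmem v hv))
  have eventually_mem : ∀ᶠ w in 𝓝 (0 : E), v + w ∈ V :=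
    (continuous_const_add v).tendsto' 0 v (add_zero v) (hV.mem_nhds hv)
  have eventually_lt : ∀ᶠ w in 𝓝 (0 : E), C * ‖w‖ < δ :=
    (continuous_norm.const_mul C).tendsto' 0 0 (by rw [norm_zero, mul_zero])
      |>.eventually (gt_mem_nhds hδ)
  have eventually_le_one : ∀ᶠ w in 𝓝 (0 : E), ‖w‖ ≤ 1 :=
    (eventually_mem_set.2 (Metric.closedBall_mem_nhds 0 one_pos)).mono fun w hw =>
      mem_closedBall_zero_iff.1 hw
  rw [hasFDerivAt_iff_isLittleO_nhds_zero]
  refine (Asymptotics.IsBigO.of_bound (g := fun w : E => ‖w‖ ^ 2)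
    (gronwallBound 0 (K * (‖v‖ + 1)) 1 1 * (K * C * C * (‖v‖ + 1) + K * C)) ?_).trans_isLittleO
    (Asymptotics.isLittleO_norm_pow_id one_lt_two)
  filter_upwards [eventually_mem, eventually_lt, eventually_le_one] with w hwV hwδ hw
  have jacobi_mem : ∀ s ∈ Icc (0 : ℝ) 1, g s + jacobiField B L g v w s ∈ U := fun s hs =>
    thickening_subset (Metric.mem_thickening_iff.2 ⟨g s, mem_image_of_mem g hs, by
      rw [dist_self_add_left]
      exact (norm_jacobi_le s hs w).trans_lt hwδ⟩)
  have estimate := hL.norm_sub_sub_jacobiField_le hC hw (hmem v hv) (hcurve v hv)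
    (hmem _ hwV) (hcurve _ hwV) (by simp only [zero_smul])
    (fun s hs => norm_jacobi_le s hs w) jacobi_mem
  simp only [jacobiField, one_smul] at estimate
  rwa [norm_pow, norm_norm]

end MaurerCartanFrame

/-! ### The Baker-Campbell-Hausdorff formula -/

section Flow

variable {E : Type*} [NormedAddCommGroup E] [NormedSpace ℝ E]
  {P : Type*} [NormedAddCommGroup P] [NormedSpace ℝ P]

theorem isPicardLindelof_of_parameter {T : E → P →L[ℝ] E} {x₀ : E} {ρ C r : ℝ≥0} {K : ℝ≥0}
    (hK : LipschitzOnWith K T (Metric.closedBall x₀ ρ))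
    (hC : ∀ y ∈ Metric.closedBall x₀ ρ, ‖T y‖ ≤ C) (hr : C * r * 4 ≤ ρ) {p : P} (hp : ‖p‖ ≤ r) :
    IsPicardLindelof (fun _ y => T y p) (⟨0, by norm_num⟩ : Icc (-2 : ℝ) 2) x₀ ρ (ρ / 2)
      (C * r) (K * ‖p‖₊) := by
  have norm_le : ∀ y ∈ Metric.closedBall x₀ ρ, ‖T y p‖ ≤ (C * r : ℝ≥0) := fun y hy =>
    (ContinuousLinearMap.le_opNorm _ _).trans (by push_cast; gcongr; exact hC y hy)
  have lipschitz : LipschitzOnWith (K * ‖p‖₊) (fun y => T y p) (Metric.closedBall x₀ ρ) := by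
    refine LipschitzOnWith.of_dist_le_mul fun y hy z hz => ?_
    rw [dist_eq_norm, dist_eq_norm, ← sub_apply]
    calc ‖(T y - T z) p‖ ≤ ‖T y - T z‖ * ‖p‖ := ContinuousLinearMap.le_opNorm _ _
      _ ≤ K * ‖y - z‖ * ‖p‖ := by gcongr; exact hK.norm_sub_le hy hz
      _ = (K * ‖p‖₊ : ℝ≥0) * ‖y - z‖ := by push_cast; ring
  refine IsPicardLindelof.of_time_independent norm_le lipschitz ?_
  rw [sub_zero, sub_neg_eq_add, zero_add, max_self]
  push_cast
  linarith [show (C : ℝ) * r * 4 ≤ ρ from mod_cast hr]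

variable [CompleteSpace E]

-- Mathlib's Picard-Lindelöf theorem does not record that the solution stays in the ball.
theorem exists_picard_mem_closedBall {f : ℝ → E → E} {tmin tmax : ℝ} {t₀ : Icc tmin tmax}
    {x₀ x : E} {a r L K : ℝ≥0} (hf : IsPicardLindelof f t₀ x₀ a r L K)
    (hx : x ∈ Metric.closedBall x₀ r) :
    ∃ α : ℝ → E, α t₀ = x ∧ Continuous α ∧ (∀ t, α t ∈ Metric.closedBall x₀ a) ∧
      ∀ t ∈ Icc tmin tmax, HasDerivWithinAt α (f t (α t)) (Icc tmin tmax) t := by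
  obtain ⟨α, fixed⟩ := ODE.FunSpace.exists_isFixedPt_next hf hx
  have mem_closedBall : ∀ t, α.compProj t ∈ Metric.closedBall x₀ a := fun _ =>
    α.compProj_mem_closedBall hf.mul_max_le
  refine ⟨α.compProj, by rw [ODE.FunSpace.compProj_val, ← fixed, ODE.FunSpace.next_apply₀],
    α.continuous_compProj, mem_closedBall, fun t ht => ?_⟩
  have deriv_picard := ODE.hasDerivWithinAt_picard_Icc t₀.2 hf.continuousOn_uncurry
    α.continuous_compProj.continuousOn (fun t _ => mem_closedBall t) x ht
  refine deriv_picard.congr_of_mem (fun t' ht' => ?_) ht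
  nth_rw 1 [← fixed]
  rw [ODE.FunSpace.compProj_of_mem ht', ODE.FunSpace.next_apply]

theorem exists_solution_mem_ball {T : E → P →L[ℝ] E} {x₀ : E} (hT : ContDiffAt ℝ 1 T x₀) {R : ℝ}
    (hR : 0 < R) :
    ∃ r > 0, ∀ x ∈ Metric.ball x₀ r, ∀ p : P, ‖p‖ < r → ∃ α : ℝ → E, α 0 = x ∧
      ContinuousOn (fun t => T (α t) p) (Ioo (-2) 2) ∧
      ∀ t ∈ Ioo (-2 : ℝ) 2, α t ∈ Metric.ball x₀ R ∧ HasDerivAt α (T (α t) p) t := by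
  obtain ⟨K, s, hs, lipschitz⟩ := hT.exists_lipschitzOnWith
  have eventually_norm_lt : ∀ᶠ x in 𝓝 x₀, ‖T x‖ < ‖T x₀‖ + 1 :=
    hT.continuousAt.norm.eventually_lt continuousAt_const (lt_add_one _)
  obtain ⟨ρ, hρ, ball_subset⟩ := Metric.nhds_basis_closedBall.mem_iff.1
    (inter_mem (inter_mem hs eventually_norm_lt) (Metric.ball_mem_nhds x₀ hR))
  lift ρ to ℝ≥0 using hρ.le
  set C : ℝ≥0 := ‖T x₀‖₊ + 1
  set r : ℝ≥0 := min (ρ / 2) (ρ / (C * 4))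
  have r_pos : 0 < r := lt_min (half_pos hρ) (div_pos hρ (by positivity))
  have mul_le : C * r * 4 ≤ ρ := by
    calc C * r * 4 ≤ C * (ρ / (C * 4)) * 4 := by gcongr; exact min_le_right _ _
      _ = ρ := by rw [mul_right_comm, mul_div_cancel₀ _ (by positivity)]
  refine ⟨r, r_pos, fun x hx p hp => ?_⟩
  have mem_closedBall : x ∈ Metric.closedBall x₀ (ρ / 2 : ℝ≥0) :=
    Metric.closedBall_subset_closedBall (min_le_left _ _) (Metric.ball_subset_closedBall hx)
  have picard := isPicardLindelof_of_parameter (lipschitz.mono fun y hy => (ball_subset hy).1.1)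
    (fun y hy => (ball_subset hy).1.2.le) mul_le hp.le
  obtain ⟨α, init, continuous_sol, mem_ball, deriv_sol⟩ :=
    exists_picard_mem_closedBall picard mem_closedBall
  refine ⟨α, init, ?_, fun t ht => ⟨(ball_subset (mem_ball t)).2,
    (deriv_sol t (Ioo_subset_Icc_self ht)).hasDerivAt (Icc_mem_nhds ht.1 ht.2)⟩⟩
  exact (lipschitz.continuousOn.comp continuous_sol.continuousOn
    fun t _ => (ball_subset (mem_ball t)).1.1).clm_apply continuousOn_const

end Flow

section Representation

variable {E : Type*} [NormedAddCommGroup E] [NormedSpace ℝ E]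
  {A : Type*} [NormedRing A] [NormedAlgebra ℝ A]

/-- The map `ρ` sends the bracket `B` to the commutator: it is a representation of `(E, B)`. For
`ρ = B` this is the Jacobi identity. -/
def IsRep (B : E →L[ℝ] E →L[ℝ] E) (ρ : E →L[ℝ] A) : Prop :=
  ∀ x y, ρ (B x y) = ρ x * ρ y - ρ y * ρ x

theorem isMaurerCartanFrame_of_isRep {B : E →L[ℝ] E →L[ℝ] E} {ρ : E →L[ℝ] A} (hρ : IsRep B ρ) :
    let L : A →L[ℝ] E →L[ℝ] A :=
      (ContinuousLinearMap.compL ℝ E A A).flip ρ ∘L ContinuousLinearMap.mul ℝ A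
    IsMaurerCartanFrame B L (fun _ => L) univ ‖L‖₊ :=
  let L : A →L[ℝ] E →L[ℝ] A :=
    (ContinuousLinearMap.compL ℝ E A A).flip ρ ∘L ContinuousLinearMap.mul ℝ A
  { isOpen := isOpen_univ
    convex := convex_univ
    hasFDerivAt := fun _ _ => L.hasFDerivAt
    lipschitzOnWith := ((LipschitzWith.const L).weaken zero_le).lipschitzOnWith
    norm_le := fun _ _ => le_rfl
    maurerCartan := fun g _ v w => by
      change g * ρ v * ρ w - g * ρ w * ρ v = g * ρ (B v w)
      rw [hρ, mul_sub, mul_assoc, mul_assoc] }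

variable [CompleteSpace A]

theorem eq_mul_exp_of_hasDerivAt {f : ℝ → A} {c : A}
    (hf : ∀ t ∈ Icc (0 : ℝ) 1, HasDerivAt f (f t * c) t) :
    ∀ t ∈ Icc (0 : ℝ) 1, f t = f 0 * exp (t • c) := by
  have deriv_zero : ∀ t ∈ Icc (0 : ℝ) 1, HasDerivAt (fun t => f t * exp (t • -c)) 0 t :=
    fun t ht => ((hf t ht).mul (hasDerivAt_exp_smul_const' (-c) t)).congr_deriv (by noncomm_ring)
  intro t ht
  have const := constant_of_has_deriv_right_zero (HasDerivAt.continuousOn deriv_zero)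
    (fun t ht => (deriv_zero t (Ico_subset_Icc_self ht)).hasDerivWithinAt) t ht
  rw [zero_smul, exp_zero, mul_one, smul_neg] at const
  rw [← const, mul_assoc, exp_neg_mul_exp, mul_one]

variable [CompleteSpace E]

theorem hasFDerivAt_exp_rep {B : E →L[ℝ] E →L[ℝ] E} {ρ : E →L[ℝ] A} (hρ : IsRep B ρ) (v : E) :
    HasFDerivAt (fun v => exp (ρ v))
      ((ContinuousLinearMap.mul ℝ A (exp (ρ v)) ∘L ρ) ∘L dexpFactor (B v)) v :=
  (isMaurerCartanFrame_of_isRep hρ).hasFDerivAt_timeOne isOpen_univ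
    (fun v _ s _ => by
      simp only [map_smul]
      exact hasDerivAt_exp_smul_const (ρ v) s)
    (fun _ _ _ _ => mem_univ _) (mem_univ v)

/-- A curve along which `exp (ρ w)` solves `f' = f * ρ y` for every representation `ρ`: it lifts
`t ↦ exp (t y)` to exponential coordinates. -/
def IsLiftAt (B : E →L[ℝ] E →L[ℝ] E) (y : E) (w : ℝ → E) (t : ℝ) : Prop :=
  ∃ w', HasDerivAt w w' t ∧ dexpFactor (B (w t)) w' = y

theorem exp_rep_eq_of_isLiftAt {B : E →L[ℝ] E →L[ℝ] E} {ρ : E →L[ℝ] A} (hρ : IsRep B ρ)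
    {y : E} {w : ℝ → E} (hw : ∀ t ∈ Icc (0 : ℝ) 1, IsLiftAt B y w t) :
    ∀ t ∈ Icc (0 : ℝ) 1, exp (ρ (w t)) = exp (ρ (w 0)) * exp (t • ρ y) :=
  eq_mul_exp_of_hasDerivAt (f := fun t => exp (ρ (w t))) fun t ht => by
    obtain ⟨w', deriv_w, dexp_eq⟩ := hw t ht
    refine ((hasFDerivAt_exp_rep hρ (w t)).comp_hasDerivAt t deriv_w).congr_deriv ?_
    change exp (ρ (w t)) * ρ (dexpFactor (B (w t)) w') = exp (ρ (w t)) * ρ y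
    rw [dexp_eq]

theorem exists_isLiftAt_bchPsi (B : E →L[ℝ] E →L[ℝ] E) {R : ℝ} (hR : 0 < R) :
    ∃ r > 0, ∀ x y, ‖x‖ < r → ‖y‖ < r → ∃ w : ℝ → E, w 0 = x ∧
      ContinuousOn (fun t => bchPsi (exp (B (w t))) y) (Ioo (-2) 2) ∧
      ∀ t ∈ Ioo (-2 : ℝ) 2, ‖w t‖ < R ∧ HasDerivAt w (bchPsi (exp (B (w t))) y) t ∧
        IsLiftAt B y w t := by
  have eventually_small : ∀ᶠ w in 𝓝 (0 : E), IsSmallExponent (B w) :=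
    (B.continuous.tendsto' 0 0 (map_zero B)).eventually eventually_isSmallExponent
  obtain ⟨δ, hδ, small⟩ := Metric.eventually_nhds_iff_ball.1 eventually_small
  have contDiffAt_field : ContDiffAt ℝ 1 (fun w => bchPsi (exp (B w))) (0 : E) := by
    have psi : ContDiffAt ℝ 1 (bchPsi : (E →L[ℝ] E) → _) (exp (B 0)) := by
      rw [map_zero, exp_zero]
      exact contDiffAt_bchPsi
    exact psi.comp (f := fun w => exp (B w)) 0 (contDiff_exp.comp B.contDiff).contDiffAt
  obtain ⟨r, hr, exists_solution⟩ := exists_solution_mem_ball contDiffAt_field (lt_min hR hδ)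
  refine ⟨r, hr, fun x y hx hy => ?_⟩
  obtain ⟨w, init, continuous_field, solves⟩ :=
    exists_solution x (mem_ball_zero_iff.2 hx) y hy
  refine ⟨w, init, continuous_field, fun t ht => ?_⟩
  obtain ⟨mem_ball, deriv_w⟩ := solves t ht
  have mem_ball_δ := Metric.ball_subset_ball (min_le_right R δ) mem_ball
  exact ⟨(mem_ball_zero_iff.1 mem_ball).trans_le (min_le_left R δ), deriv_w, _, deriv_w,
    congrArg (fun S : E →L[ℝ] E => S y) (dexpFactor_mul_bchPsi_exp (small _ mem_ball_δ))⟩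

theorem Icc_zero_one_subset_Ioo : Icc (0 : ℝ) 1 ⊆ Ioo (-2) 2 :=
  Icc_subset_Ioo (by norm_num) (by norm_num)

theorem exists_bch_curve {B : E →L[ℝ] E →L[ℝ] E} (hB : IsRep B B) {R : ℝ} (hR : 0 < R) :
    ∃ r > 0, ∀ x y, ‖x‖ < r → ‖y‖ < r → ∃ w : ℝ → E, w 0 = x ∧ w 1 = bch B x y ∧
      ∀ t ∈ Ioo (-2 : ℝ) 2, ‖w t‖ < R ∧ IsLiftAt B y w t := by
  obtain ⟨r, hr, exists_lift⟩ := exists_isLiftAt_bchPsi B hR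
  refine ⟨r, hr, fun x y hx hy => ?_⟩
  obtain ⟨w, init, continuous_field, hw⟩ := exists_lift x y hx hy
  refine ⟨w, init, ?_, fun t ht => ⟨(hw t ht).1, (hw t ht).2.2⟩⟩
  have uIcc_subset : uIcc (0 : ℝ) 1 ⊆ Ioo (-2) 2 :=
    uIcc_of_le (zero_le_one' ℝ) ▸ Icc_zero_one_subset_Ioo
  have exp_ad_eq := exp_rep_eq_of_isLiftAt hB fun t ht => (hw t (Icc_zero_one_subset_Ioo ht)).2.2
  calc w 1 = x + ∫ t in (0 : ℝ)..1, bchPsi (exp (B (w t))) y := by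
        rw [intervalIntegral.integral_eq_sub_of_hasDerivAt
          (fun t ht => (hw t (uIcc_subset ht)).2.1)
          (continuous_field.mono uIcc_subset).intervalIntegrable, init, add_sub_cancel]
    _ = bch B x y := by
        rw [bch]
        congr 1
        refine intervalIntegral.integral_congr fun t ht => ?_
        rw [uIcc_of_le zero_le_one] at ht
        simp only [exp_ad_eq t ht, init]

theorem exists_exp_mul_exp_eq {B : E →L[ℝ] E →L[ℝ] E} (hB : IsRep B B) {ρ : E →L[ℝ] A}
    (hρ : IsRep B ρ) :
    ∃ r > 0, ∀ x y, ‖x‖ < r → ‖y‖ < r → exp (ρ x) * exp (ρ y) = exp (ρ (bch B x y)) := by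
  obtain ⟨r, hr, exists_curve⟩ := exists_bch_curve hB one_pos
  refine ⟨r, hr, fun x y hx hy => ?_⟩
  obtain ⟨w, init, terminal, hw⟩ := exists_curve x y hx hy
  have exp_eq := exp_rep_eq_of_isLiftAt hρ (fun t ht => (hw t (Icc_zero_one_subset_Ioo ht)).2)
    1 (right_mem_Icc.2 zero_le_one)
  rw [← terminal, exp_eq, init, one_smul]

theorem exp_rep_mul {B : E →L[ℝ] E →L[ℝ] E} {ρ : E →L[ℝ] A} (hρ : IsRep B ρ) (x v : E) :
    exp (ρ x) * ρ v = ρ (exp (B x) v) * exp (ρ x) := by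
  have deriv_zero : ∀ s : ℝ, HasDerivAt
      (fun s : ℝ => exp (s • -ρ x) * (ρ (exp (s • B x) v) * exp (s • ρ x))) 0 s := fun s => by
    have deriv_ad : HasDerivAt (fun s : ℝ => exp (s • B x) v) (B x (exp (s • B x) v)) s := by
      refine ((hasDerivAt_exp_smul_const' (B x) s).clm_apply (hasDerivAt_const s v)).congr_deriv ?_
      rw [map_zero, add_zero]
      rfl
    refine ((hasDerivAt_exp_smul_const (-ρ x) s).mul ((ρ.hasFDerivAt.comp_hasDerivAt s deriv_ad).mul
      (hasDerivAt_exp_smul_const' (ρ x) s))).congr_deriv ?_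
    rw [hρ, Pi.mul_apply]
    simp only [Function.comp_apply]
    noncomm_ring
  have const := constant_of_has_deriv_right_zero (a := 0) (b := 1)
    (HasDerivAt.continuousOn fun t _ => deriv_zero t)
    (fun t _ => (deriv_zero t).hasDerivWithinAt) 1 (right_mem_Icc.2 zero_le_one)
  simp only [zero_smul, exp_zero, one_smul, mul_one, one_mul, one_apply_eq_self] at const
  rw [← const, ← mul_assoc, exp_mul_exp_neg, one_mul]

end Representation

/-! ### Graded brackets and their nilpotentisation -/

/-- A Lie bracket `B` on `E = W₁ ⊕ ⋯ ⊕ Wₘ`, compatible with the filtration by the sums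
`W₁ ⊕ ⋯ ⊕ Wᵢ`; here `proj j` is the projection onto `Wⱼ`. -/
structure GradedBracket (E : Type*) [NormedAddCommGroup E] [NormedSpace ℝ E] where
  /-- The number of summands. -/
  step : ℕ
  /-- The projections onto the summands. -/
  proj : ℕ → E →L[ℝ] E
  /-- The bracket. -/
  bracket : E →L[ℝ] E →L[ℝ] E
  proj_proj_same : ∀ i x, proj i (proj i x) = proj i x
  proj_proj_of_ne : ∀ i j x, i ≠ j → proj i (proj j x) = 0
  sum_proj : ∀ x, ∑ j ∈ Finset.range (step + 1), proj j x = x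
  proj_zero : ∀ x, proj 0 x = 0
  bracket_skew : ∀ x y, bracket x y = -bracket y x
  isRep_bracket : IsRep bracket bracket
  proj_bracket : ∀ i j k x y, j + k < i → proj i (bracket (proj j x) (proj k y)) = 0

namespace GradedBracket

variable {E : Type*} [NormedAddCommGroup E] [NormedSpace ℝ E] (𝔤 : GradedBracket E)

theorem proj_eq_zero {j : ℕ} (hj : 𝔤.step < j) (x : E) : 𝔤.proj j x = 0 := by
  rw [← 𝔤.sum_proj x, map_sum]
  refine Finset.sum_eq_zero fun i hi => 𝔤.proj_proj_of_ne _ _ _ ?_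
  rw [Finset.mem_range] at hi
  omega

theorem ext_proj {x y : E} (h : ∀ i ≤ 𝔤.step, 𝔤.proj i x = 𝔤.proj i y) : x = y := by
  rw [← 𝔤.sum_proj x, ← 𝔤.sum_proj y]
  exact Finset.sum_congr rfl fun i hi => h i (by rw [Finset.mem_range] at hi; omega)

/-- The operator acting on the `j`-th summand as multiplication by `c j`. -/
def weighted (c : ℕ → ℝ) : E →L[ℝ] E := ∑ j ∈ Finset.range (𝔤.step + 1), c j • 𝔤.proj j

theorem weighted_apply (c : ℕ → ℝ) (x : E) :
    𝔤.weighted c x = ∑ j ∈ Finset.range (𝔤.step + 1), c j • 𝔤.proj j x := by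
  simp only [weighted, sum_apply, smul_apply]

theorem proj_weighted (c : ℕ → ℝ) (i : ℕ) (x : E) :
    𝔤.proj i (𝔤.weighted c x) = c i • 𝔤.proj i x := by
  rw [weighted_apply, map_sum]
  by_cases hi : i ∈ Finset.range (𝔤.step + 1)
  · rw [Finset.sum_eq_single_of_mem i hi]
    · rw [map_smul, 𝔤.proj_proj_same]
    · intro j _ hj
      rw [map_smul, 𝔤.proj_proj_of_ne _ _ _ hj.symm, smul_zero]
  · have step_lt : 𝔤.step < i := by rw [Finset.mem_range] at hi; omega
    rw [𝔤.proj_eq_zero step_lt, smul_zero]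
    exact Finset.sum_eq_zero fun j _ => 𝔤.proj_eq_zero step_lt _

theorem weighted_proj (c : ℕ → ℝ) (i : ℕ) (x : E) :
    𝔤.weighted c (𝔤.proj i x) = c i • 𝔤.proj i x := by
  refine 𝔤.ext_proj fun j _ => ?_
  rw [proj_weighted, map_smul]
  rcases eq_or_ne j i with rfl | hji
  · rfl
  · rw [𝔤.proj_proj_of_ne _ _ _ hji, smul_zero, smul_zero]

/-- The dilations `δ_ε`. -/
def dilation (ε : ℝ) : E →L[ℝ] E := 𝔤.weighted fun j => ε ^ j

theorem dilation_dilation (a b : ℝ) (x : E) :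
    𝔤.dilation a (𝔤.dilation b x) = 𝔤.dilation (a * b) x :=
  𝔤.ext_proj fun i _ => by simp only [dilation, proj_weighted, smul_smul, mul_pow]

theorem dilation_one (x : E) : 𝔤.dilation 1 x = x :=
  𝔤.ext_proj fun i _ => by simp only [dilation, proj_weighted, one_pow, one_smul]

/-- The dilations as linear automorphisms. -/
def dilationEquiv {ε : ℝ} (hε : ε ≠ 0) : E ≃L[ℝ] E :=
  ContinuousLinearEquiv.equivOfInverse (𝔤.dilation ε) (𝔤.dilation ε⁻¹)
    (fun x => by rw [dilation_dilation, inv_mul_cancel₀ hε, dilation_one])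
    (fun x => by rw [dilation_dilation, mul_inv_cancel₀ hε, dilation_one])

theorem dilationEquiv_apply {ε : ℝ} (hε : ε ≠ 0) (x : E) :
    𝔤.dilationEquiv hε x = 𝔤.dilation ε x := rfl

/-- The component of degree `(i, j, k)` of the bracket. -/
def component (i j k : ℕ) : E →L[ℝ] E →L[ℝ] E :=
  ContinuousLinearMap.compL ℝ E E E (𝔤.proj i) ∘L 𝔤.bracket.bilinearComp (𝔤.proj j) (𝔤.proj k)

theorem component_apply (i j k : ℕ) (x y : E) :
    𝔤.component i j k x y = 𝔤.proj i (𝔤.bracket (𝔤.proj j x) (𝔤.proj k y)) := rfl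

/-- The rescaled bracket `δ_ε⁻¹ [δ_ε x, δ_ε y]`, extended to `ε = 0`. -/
def scaled (ε : ℝ) : E →L[ℝ] E →L[ℝ] E :=
  ∑ j ∈ Finset.range (𝔤.step + 1), ∑ k ∈ Finset.range (𝔤.step + 1),
    ∑ i ∈ Finset.range (𝔤.step + 1), ε ^ (j + k - i) • 𝔤.component i j k

theorem scaled_apply (ε : ℝ) (x y : E) :
    𝔤.scaled ε x y = ∑ j ∈ Finset.range (𝔤.step + 1), ∑ k ∈ Finset.range (𝔤.step + 1),
      ∑ i ∈ Finset.range (𝔤.step + 1),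
        ε ^ (j + k - i) • 𝔤.proj i (𝔤.bracket (𝔤.proj j x) (𝔤.proj k y)) := by
  simp only [scaled, sum_apply, smul_apply, component_apply]

theorem contDiff_scaled : ContDiff ℝ 1 𝔤.scaled := by
  unfold scaled
  refine ContDiff.sum fun j _ => ContDiff.sum fun k _ => ContDiff.sum fun i _ => ?_
  have contDiff_smul : ContDiff ℝ 1 ((ContinuousLinearMap.id ℝ ℝ).smulRight (𝔤.component i j k)) :=
    ContinuousLinearMap.contDiff _
  exact contDiff_smul.comp (contDiff_id.pow (j + k - i))

theorem bracket_eq_sum (x y : E) : 𝔤.bracket x y =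
    ∑ j ∈ Finset.range (𝔤.step + 1), ∑ k ∈ Finset.range (𝔤.step + 1),
      𝔤.bracket (𝔤.proj j x) (𝔤.proj k y) := by
  conv_lhs => rw [← 𝔤.sum_proj x, ← 𝔤.sum_proj y]
  simp only [map_sum, sum_apply]
  exact Finset.sum_comm

theorem dilation_scaled (ε : ℝ) (x y : E) :
    𝔤.dilation ε (𝔤.scaled ε x y) = 𝔤.bracket (𝔤.dilation ε x) (𝔤.dilation ε y) := by
  rw [scaled_apply, bracket_eq_sum, map_sum]
  refine Finset.sum_congr rfl fun j _ => ?_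
  rw [map_sum]
  refine Finset.sum_congr rfl fun k _ => ?_
  have bracket_dilation : 𝔤.bracket (𝔤.proj j (𝔤.dilation ε x)) (𝔤.proj k (𝔤.dilation ε y)) =
      ε ^ (j + k) • 𝔤.bracket (𝔤.proj j x) (𝔤.proj k y) := by
    simp only [dilation, proj_weighted, map_smul, smul_apply, smul_smul, pow_add]
    rw [mul_comm]
  rw [bracket_dilation, map_sum]
  conv_rhs => rw [← 𝔤.sum_proj (𝔤.bracket (𝔤.proj j x) (𝔤.proj k y)), Finset.smul_sum]
  refine Finset.sum_congr rfl fun i _ => ?_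
  rw [map_smul, dilation, weighted_proj]
  rcases lt_or_ge (j + k) i with hi | hi
  · rw [𝔤.proj_bracket _ _ _ _ _ hi, smul_zero, smul_zero, smul_zero]
  · rw [smul_smul, ← pow_add, Nat.sub_add_cancel hi]

/-- The nilpotent bracket. -/
def nil : E →L[ℝ] E →L[ℝ] E := 𝔤.scaled 0

theorem nil_apply (x y : E) : 𝔤.nil x y =
    ∑ j ∈ Finset.range (𝔤.step + 1), ∑ k ∈ Finset.range (𝔤.step + 1),
      𝔤.proj (j + k) (𝔤.bracket (𝔤.proj j x) (𝔤.proj k y)) := by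
  rw [nil, scaled_apply]
  refine Finset.sum_congr rfl fun j _ => Finset.sum_congr rfl fun k _ => ?_
  by_cases hjk : j + k ∈ Finset.range (𝔤.step + 1)
  · rw [Finset.sum_eq_single_of_mem _ hjk, Nat.sub_self, pow_zero, one_smul]
    intro i _ hi
    rcases lt_or_gt_of_ne hi with hlt | hgt
    · rw [zero_pow (by omega), zero_smul]
    · rw [𝔤.proj_bracket _ _ _ _ _ hgt, smul_zero]
  · rw [Finset.mem_range] at hjk
    rw [𝔤.proj_eq_zero (j := j + k) (by omega)]
    refine Finset.sum_eq_zero fun i hi => ?_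
    rw [Finset.mem_range] at hi
    rw [zero_pow (by omega), zero_smul]

theorem nil_skew (x y : E) : 𝔤.nil x y = -𝔤.nil y x := by
  rw [nil_apply, nil_apply, Finset.sum_comm, ← Finset.sum_neg_distrib]
  refine Finset.sum_congr rfl fun j _ => ?_
  rw [← Finset.sum_neg_distrib]
  refine Finset.sum_congr rfl fun k _ => ?_
  rw [𝔤.bracket_skew, map_neg, add_comm]

theorem isRep_scaled {ε : ℝ} (hε : ε ≠ 0) : IsRep (𝔤.scaled ε) (𝔤.scaled ε) := by
  intro x y
  ext z
  apply (𝔤.dilationEquiv hε).injective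
  simp only [dilationEquiv_apply, sub_apply, mul_apply_eq_comp, map_sub, dilation_scaled]
  exact DFunLike.congr_fun (𝔤.isRep_bracket (𝔤.dilation ε x) (𝔤.dilation ε y)) (𝔤.dilation ε z)

theorem isRep_nil : IsRep 𝔤.nil 𝔤.nil := by
  intro x y
  have continuous_scaled := 𝔤.contDiff_scaled.continuous
  have jacobi : (fun ε => 𝔤.scaled ε (𝔤.scaled ε x y)) = fun ε =>
      𝔤.scaled ε x * 𝔤.scaled ε y - 𝔤.scaled ε y * 𝔤.scaled ε x := by
    refine Continuous.ext_on (dense_compl_singleton (0 : ℝ)) (by fun_prop) (by fun_prop)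
      fun ε hε => ?_
    exact 𝔤.isRep_scaled hε x y
  exact congrFun jacobi 0

theorem dilation_nil (ε : ℝ) (x y : E) :
    𝔤.dilation ε (𝔤.nil x y) = 𝔤.nil (𝔤.dilation ε x) (𝔤.dilation ε y) := by
  simp only [nil_apply, map_sum]
  refine Finset.sum_congr rfl fun j _ => Finset.sum_congr rfl fun k _ => ?_
  simp only [dilation, weighted_proj, proj_weighted, map_smul, smul_apply, smul_smul, pow_add]
  rw [mul_comm]

/-- The derivation acting as multiplication by `j` on the `j`-th summand. -/
def grading : E →L[ℝ] E := 𝔤.weighted fun j => j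

theorem grading_nil (x y : E) :
    𝔤.grading (𝔤.nil x y) = 𝔤.nil (𝔤.grading x) y + 𝔤.nil x (𝔤.grading y) := by
  simp only [nil_apply, map_sum, ← Finset.sum_add_distrib]
  refine Finset.sum_congr rfl fun j _ => Finset.sum_congr rfl fun k _ => ?_
  simp only [grading, weighted_proj, proj_weighted, map_smul, smul_apply, ← add_smul]
  push_cast
  rfl

theorem grading_injective : Function.Injective 𝔤.grading := by
  refine (injective_iff_map_eq_zero _).2 fun x hx => 𝔤.ext_proj fun i _ => ?_
  rw [map_zero]
  rcases Nat.eq_zero_or_pos i with rfl | hi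
  · exact 𝔤.proj_zero x
  · have smul_proj := 𝔤.proj_weighted (fun j => (j : ℝ)) i x
    rw [show 𝔤.weighted (fun j => (j : ℝ)) x = 0 from hx, map_zero] at smul_proj
    exact (smul_eq_zero.1 smul_proj.symm).resolve_left (by positivity)

/-- The faithful representation `x ↦ ((y, c) ↦ ([x, y]ₙ - c d(x), 0))` of the nilpotent bracket on
`E × ℝ`: the restriction to `E` of the adjoint representation of the extension of `(E, [·, ·]ₙ)` by
the derivation `d = grading`. -/
def rep : E →L[ℝ] (E × ℝ →L[ℝ] E × ℝ) :=
  ContinuousLinearMap.compL ℝ (E × ℝ) E (E × ℝ) (ContinuousLinearMap.inl ℝ E ℝ) ∘L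
    ((ContinuousLinearMap.compL ℝ (E × ℝ) E E).flip (ContinuousLinearMap.fst ℝ E ℝ) ∘L 𝔤.nil -
      ContinuousLinearMap.smulRightL ℝ (E × ℝ) E (ContinuousLinearMap.snd ℝ E ℝ) ∘L 𝔤.grading)

theorem rep_apply (x : E) (z : E × ℝ) :
    𝔤.rep x z = (𝔤.nil x z.1 - z.2 • 𝔤.grading x, 0) := rfl

theorem isRep_rep : IsRep 𝔤.nil 𝔤.rep := by
  intro x y
  refine ContinuousLinearMap.ext fun z => ?_
  have jacobi := DFunLike.congr_fun (𝔤.isRep_nil x y) z.1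
  simp only [sub_apply, mul_apply_eq_comp] at jacobi
  have skew : 𝔤.nil (𝔤.grading x) y = -𝔤.nil y (𝔤.grading x) := 𝔤.nil_skew _ _
  simp only [rep_apply, sub_apply, mul_apply_eq_comp, map_sub, map_smul, zero_smul, sub_zero,
    grading_nil, jacobi, Prod.mk_sub_mk, skew, smul_add, smul_neg]
  congr 1
  abel

theorem rep_injective : Function.Injective 𝔤.rep := by
  refine (injective_iff_map_eq_zero _).2 fun x hx => ?_
  have rep_snd : 𝔤.rep x (0, 1) = 0 := by rw [hx]; rfl
  rw [rep_apply] at rep_snd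
  simp only [map_zero, one_smul, zero_sub, Prod.mk_eq_zero, neg_eq_zero, and_true] at rep_snd
  exact 𝔤.grading_injective (by rw [rep_snd, map_zero])

end GradedBracket

/-! ### Words -/

section ExpWord

variable {ι : Type*}

/-- The word whose product of exponentials is inverse to the one of `l`. -/
def invWord (l : List (ι × ℝ)) : List (ι × ℝ) := (l.map fun a => (a.1, -a.2)).reverse

/-- The word `l` with all its exponents multiplied by `c`. -/
def scaleWord (c : ℝ) (l : List (ι × ℝ)) : List (ι × ℝ) := l.map fun a => (a.1, c * a.2)

theorem scaleWord_invWord (c : ℝ) (l : List (ι × ℝ)) :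
    scaleWord c (invWord l) = invWord (scaleWord c l) := by
  simp [scaleWord, invWord, List.map_reverse]

theorem scaleWord_append (c : ℝ) (l₁ l₂ : List (ι × ℝ)) :
    scaleWord c (l₁ ++ l₂) = scaleWord c l₁ ++ scaleWord c l₂ :=
  List.map_append

theorem scaleWord_map_zero (c : ℝ) (l : List ι) :
    scaleWord c (l.map fun i => (i, (0 : ℝ))) = l.map fun i => (i, (0 : ℝ)) := by
  simp [scaleWord]

variable {A : Type*} [NormedRing A] [NormedAlgebra ℝ A] (Y : ι → A)

/-- The product of the exponentials `exp (t Yᵢ)` along a word of pairs `(i, t)`. -/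
def expWord (l : List (ι × ℝ)) : A := (l.map fun a => exp (a.2 • Y a.1)).prod

theorem expWord_nil : expWord Y [] = 1 := rfl

theorem expWord_cons (a : ι × ℝ) (l : List (ι × ℝ)) :
    expWord Y (a :: l) = exp (a.2 • Y a.1) * expWord Y l :=
  List.prod_cons

theorem expWord_append (l₁ l₂ : List (ι × ℝ)) :
    expWord Y (l₁ ++ l₂) = expWord Y l₁ * expWord Y l₂ := by
  rw [expWord, List.map_append, List.prod_append, expWord, expWord]

theorem expWord_singleton (a : ι × ℝ) : expWord Y [a] = exp (a.2 • Y a.1) := by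
  rw [expWord_cons, expWord_nil, mul_one]

theorem expWord_map_zero (l : List ι) : expWord Y (l.map fun i => (i, (0 : ℝ))) = 1 := by
  induction l with
  | nil => rfl
  | cons i l ih => rw [List.map_cons, expWord_cons, ih, zero_smul, exp_zero, mul_one]

theorem expWord_mul_invWord [CompleteSpace A] (l : List (ι × ℝ)) :
    expWord Y l * expWord Y (invWord l) = 1 := by
  induction l with
  | nil => exact mul_one 1
  | cons a l ih =>
    have invWord_cons : invWord (a :: l) = invWord l ++ [(a.1, -a.2)] := List.reverse_cons
    rw [invWord_cons, expWord_append, expWord_singleton, expWord_cons, mul_assoc,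
      ← mul_assoc (expWord Y l), ih, one_mul, neg_smul, exp_mul_exp_neg]

end ExpWord

theorem surjective_expWord {ι E : Type*} [NormedAddCommGroup E] [NormedSpace ℝ E] [CompleteSpace E]
    (Y : ι → E →L[ℝ] E) (l : List (ι × ℝ)) : Function.Surjective ⇑(expWord Y l) :=
  fun y => ⟨(expWord Y (invWord l) : E →L[ℝ] E) y, DFunLike.congr_fun (expWord_mul_invWord Y l) y⟩

section OrbitSpan

variable {E : Type*} [NormedAddCommGroup E] [NormedSpace ℝ E] (B : E →L[ℝ] E →L[ℝ] E) {ι : Type*}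
  (X : ι → E)

/-- The span of the vectors `exp (t₁ ad X₁) ⋯ exp (tᵢ₋₁ ad Xᵢ₋₁) Xᵢ` along a word: the image of the
right-trivialised derivative of the product `exp (t₁ X₁) ⋯ exp (tₖ Xₖ)` in the exponents. -/
def orbitSpan : List (ι × ℝ) → Submodule ℝ E
  | [] => ⊥
  | a :: l => Submodule.span ℝ {X a.1} ⊔
      (orbitSpan l).map (exp (a.2 • B (X a.1)) : E →L[ℝ] E).toLinearMap

theorem orbitSpan_append (l₁ l₂ : List (ι × ℝ)) :
    orbitSpan B X (l₁ ++ l₂) = orbitSpan B X l₁ ⊔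
      (orbitSpan B X l₂).map (expWord (B ∘ X) l₁).toLinearMap := by
  induction l₁ with
  | nil =>
    rw [List.nil_append, orbitSpan, bot_sup_eq, expWord_nil]
    exact (Submodule.map_id _).symm
  | cons a l ih =>
    rw [List.cons_append, orbitSpan, orbitSpan, ih, Submodule.map_sup, ← Submodule.map_comp,
      ← sup_assoc, expWord_cons]
    rfl

theorem hasDerivAt_mem_of_forall_mem {f : ℝ → E} {f' : E} {s : ℝ} (hf : HasDerivAt f f' s)
    {T : Submodule ℝ E} (hT : IsClosed (T : Set E)) (mem : ∀ s, f s ∈ T) : f' ∈ T :=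
  hT.mem_of_tendsto (hasDerivAt_iff_tendsto_slope.1 hf)
    (Eventually.of_forall fun t => T.smul_mem _ (T.sub_mem (mem t) (mem s)))

variable {B X}

theorem eq_top_of_forall_orbitSpan_le [CompleteSpace E]
    (generates : ∀ T : Submodule ℝ E,
      (∀ i, X i ∈ T) → (∀ i, ∀ y ∈ T, B (X i) y ∈ T) → T = ⊤)
    {T : Submodule ℝ E} (hT : IsClosed (T : Set E)) (le : ∀ l, orbitSpan B X l ≤ T) : T = ⊤ := by
  set core : Submodule ℝ E := ⨅ l, T.comap (expWord (B ∘ X) l).toLinearMap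
  have mem_core : ∀ v, v ∈ core ↔ ∀ l, expWord (B ∘ X) l v ∈ T := fun v => Submodule.mem_iInf _
  suffices core_eq_top : core = ⊤ from
    eq_top_iff.2 fun v _ => (mem_core v).1 (core_eq_top ▸ Submodule.mem_top) []
  refine generates core (fun i => (mem_core _).2 fun l => ?_)
    fun i v hv => (mem_core _).2 fun l => ?_
  · refine le (l ++ [(i, 0)]) ?_
    rw [orbitSpan_append]
    exact Submodule.mem_sup_right (Submodule.mem_map_of_mem
      (Submodule.mem_sup_left (Submodule.mem_span_singleton_self _)))
  · have mem_curve : ∀ s : ℝ, expWord (B ∘ X) l (exp (s • B (X i)) v) ∈ T := fun s => by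
      have mem_append := (mem_core v).1 hv (l ++ [(i, s)])
      rwa [expWord_append, expWord_singleton] at mem_append
    have deriv_curve := (expWord (B ∘ X) l).hasFDerivAt.comp_hasDerivAt (0 : ℝ)
      ((hasDerivAt_exp_smul_const (B (X i)) (0 : ℝ)).clm_apply (hasDerivAt_const (0 : ℝ) v))
    simpa using hasDerivAt_mem_of_forall_mem deriv_curve hT mem_curve

variable [FiniteDimensional ℝ E]

theorem exists_map_orbitSpan_le (B : E →L[ℝ] E →L[ℝ] E) (X : ι → E) :
    ∃ l, ∀ l', (orbitSpan B X l').map (expWord (B ∘ X) l).toLinearMap ≤ orbitSpan B X l := by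
  obtain ⟨_, ⟨l, rfl⟩, maximal⟩ := (wellFounded_gt (α := Submodule ℝ E)).has_min
    (range (orbitSpan B X)) ⟨_, [], rfl⟩
  refine ⟨l, fun l' => ?_⟩
  have append_not_lt := maximal _ ⟨l ++ l', rfl⟩
  rw [orbitSpan_append] at append_not_lt
  exact sup_eq_left.1 (eq_of_le_of_not_lt le_sup_left append_not_lt).symm

theorem exists_orbitSpan_eq_top
    (generates : ∀ T : Submodule ℝ E,
      (∀ i, X i ∈ T) → (∀ i, ∀ y ∈ T, B (X i) y ∈ T) → T = ⊤) :
    ∃ l, orbitSpan B X l = ⊤ := by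
  have : CompleteSpace E := FiniteDimensional.complete ℝ E
  obtain ⟨l, map_le⟩ := exists_map_orbitSpan_le B X
  refine ⟨l, eq_top_iff.2 fun y _ => ?_⟩
  have comap_eq_top := eq_top_of_forall_orbitSpan_le generates
    (Submodule.closed_of_finiteDimensional _) fun l' => Submodule.map_le_iff_le_comap.1 (map_le l')
  obtain ⟨x, rfl⟩ := surjective_expWord (B ∘ X) l y
  exact (comap_eq_top ▸ Submodule.mem_top :
    x ∈ (orbitSpan B X l).comap (expWord (B ∘ X) l).toLinearMap)

end OrbitSpan

namespace GradedBracket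

variable {E : Type*} [NormedAddCommGroup E] [NormedSpace ℝ E] (𝔤 : GradedBracket E)

theorem dilation_eq_smul {v : E} (hv : 𝔤.proj 1 v = v) (ε : ℝ) : 𝔤.dilation ε v = ε • v := by
  rw [← hv, dilation, weighted_proj, pow_one]

theorem dilation_mul_exp [CompleteSpace E] {v : E} (hv : 𝔤.proj 1 v = v) (c t : ℝ) :
    𝔤.dilation c * exp (t • 𝔤.nil v) = exp ((c * t) • 𝔤.nil v) * 𝔤.dilation c := by
  have semiconj : SemiconjBy (𝔤.dilation c) (t • 𝔤.nil v) ((c * t) • 𝔤.nil v) := by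
    refine ContinuousLinearMap.ext fun z => ?_
    simp only [mul_apply_eq_comp, smul_apply, map_smul, dilation_nil, 𝔤.dilation_eq_smul hv,
      smul_smul]
    rw [mul_comm]
  let _ : NormedAlgebra ℚ (E →L[ℝ] E) := NormedAlgebra.restrictScalars ℚ ℝ _
  exact semiconj.exp_right

variable {ι : Type*} {X : ι → E}

theorem orbitSpan_scaleWord [CompleteSpace E] (hX : ∀ i, 𝔤.proj 1 (X i) = X i) {c : ℝ} (hc : c ≠ 0)
    (l : List (ι × ℝ)) :
    orbitSpan 𝔤.nil X (scaleWord c l) =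
      (orbitSpan 𝔤.nil X l).map (𝔤.dilation c).toLinearMap := by
  induction l with
  | nil => exact (Submodule.map_bot _).symm
  | cons a l ih =>
    have scaleWord_cons : scaleWord c (a :: l) = (a.1, c * a.2) :: scaleWord c l := rfl
    have dilation_letter : (𝔤.dilation c).toLinearMap (X a.1) = c • X a.1 :=
      𝔤.dilation_eq_smul (hX _) c
    rw [scaleWord_cons, orbitSpan, orbitSpan, ih, Submodule.map_sup, ← Submodule.map_comp,
      ← Submodule.map_comp, Submodule.map_span, image_singleton, dilation_letter,
      Submodule.span_singleton_smul_eq (IsUnit.mk0 c hc)]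
    congr 2
    exact congrArg (fun u : E →L[ℝ] E => u.toLinearMap) (𝔤.dilation_mul_exp (hX _) c a.2).symm

theorem orbitSpan_scaleWord_eq_top [CompleteSpace E] (hX : ∀ i, 𝔤.proj 1 (X i) = X i) {c : ℝ}
    (hc : c ≠ 0) {l : List (ι × ℝ)} (hl : orbitSpan 𝔤.nil X l = ⊤) :
    orbitSpan 𝔤.nil X (scaleWord c l) = ⊤ := by
  rw [𝔤.orbitSpan_scaleWord hX hc, hl, Submodule.map_top]
  exact LinearMap.range_eq_top.2 (𝔤.dilationEquiv hc).surjective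

-- The word `l · l⁻¹` is trivial, and so are all its rescalings, while its orbit vectors still span.
theorem exists_closed_word [FiniteDimensional ℝ E] [Finite ι] {A : Type*} [NormedRing A]
    [NormedAlgebra ℝ A] [CompleteSpace A] (hX : ∀ i, 𝔤.proj 1 (X i) = X i)
    (generates : ∀ T : Submodule ℝ E,
      (∀ i, X i ∈ T) → (∀ i, ∀ y ∈ T, 𝔤.nil (X i) y ∈ T) → T = ⊤)
    (Y : ι → A) :
    ∃ l : List (ι × ℝ), (∀ i, i ∈ l.map Prod.fst) ∧ ∀ c : ℝ, expWord Y (scaleWord c l) = 1 ∧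
      (c ≠ 0 → orbitSpan 𝔤.nil X (scaleWord c l) = ⊤) := by
  have : CompleteSpace E := FiniteDimensional.complete ℝ E
  cases nonempty_fintype ι
  obtain ⟨l, hl⟩ := exists_orbitSpan_eq_top generates
  refine ⟨Finset.univ.toList.map (fun i => (i, (0 : ℝ))) ++ (l ++ invWord l), fun i => by simp,
    fun c => ⟨?_, fun hc => 𝔤.orbitSpan_scaleWord_eq_top hX hc ?_⟩⟩
  · rw [scaleWord_append, scaleWord_append, expWord_append, expWord_append, scaleWord_map_zero,
      expWord_map_zero, one_mul, scaleWord_invWord, expWord_mul_invWord]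
  · rw [orbitSpan_append, orbitSpan_append, hl, top_sup_eq, Submodule.map_top,
      LinearMap.range_eq_top.2 (surjective_expWord _ _), sup_top_eq]

end GradedBracket

/-! ### The word map in exponential coordinates -/

section WordFold

theorem wordProd_succ {L : Type*} [AddCommGroup L] [Module ℝ L] {H : Type*} [Mul H] [One H]
    (e : L → H) {M : ℕ} (Y : Fin (M + 1) → L) (t : Fin (M + 1) → ℝ) :
    wordProd e Y t = e (t 0 • Y 0) * wordProd e (Fin.tail Y) (Fin.tail t) := by
  rw [wordProd, List.ofFn_succ, List.prod_cons]
  rfl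

variable {E : Type*} [AddCommGroup E] [Module ℝ E] (op : E → E → E)

/-- The iterated product `t₁ Y₁ · (t₂ Y₂ · (⋯))` for a binary operation. -/
def wordFold {M : ℕ} (Y : Fin M → E) (t : Fin M → ℝ) : E :=
  (List.ofFn fun i => t i • Y i).foldr op 0

theorem wordFold_succ {M : ℕ} (Y : Fin (M + 1) → E) (t : Fin (M + 1) → ℝ) :
    wordFold op Y t = op (t 0 • Y 0) (wordFold op (Fin.tail Y) (Fin.tail t)) := by
  rw [wordFold, List.ofFn_succ, List.foldr_cons]
  rfl

variable {op}

theorem wordFold_zero (op_zero : op 0 0 = 0) {M : ℕ} (Y : Fin M → E) : wordFold op Y 0 = 0 := by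
  induction M with
  | zero => rfl
  | succ M ih =>
    rw [wordFold_succ, Pi.zero_apply, zero_smul]
    exact (congrArg (op 0) (ih (Fin.tail Y))).trans op_zero

theorem map_wordFold {E' : Type*} [AddCommGroup E'] [Module ℝ E'] {op' : E' → E' → E'} {f : E → E'}
    (map_zero : f 0 = 0) (map_op : ∀ x y, f (op x y) = op' (f x) (f y)) {M : ℕ}
    {Y : Fin M → E} {Y' : Fin M → E'} {t t' : Fin M → ℝ}
    (map_letter : ∀ i, f (t i • Y i) = t' i • Y' i) :
    f (wordFold op Y t) = wordFold op' Y' t' := by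
  induction M with
  | zero => exact map_zero
  | succ M ih =>
    rw [wordFold_succ, wordFold_succ, map_op, map_letter 0]
    exact congrArg _ (ih fun i => map_letter i.succ)

end WordFold

section WordProdRep

variable {E : Type*} [NormedAddCommGroup E] [NormedSpace ℝ E] {A : Type*} [NormedRing A]
  [NormedAlgebra ℝ A] {ι : Type*} (X : ι → E) {M : ℕ} (g : Fin M → ι) (t : Fin M → ℝ)

theorem wordProd_exp_rep (ρ : E →L[ℝ] A) :
    wordProd (fun v => exp (ρ v)) (X ∘ g) t = expWord (ρ ∘ X) (List.ofFn fun i => (g i, t i)) := by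
  simp only [wordProd, expWord, List.map_ofFn, Function.comp_def, map_smul]

variable [CompleteSpace A] {ρ : E →L[ℝ] A}

theorem eventually_eq_zero_of_exp_rep_eq_one (injective_rep : Function.Injective ρ) :
    ∀ᶠ w in 𝓝 (0 : E), exp (ρ w) = 1 → w = 0 := by
  have strictDeriv_exp : HasStrictFDerivAt (exp : A → A)
      (ContinuousLinearEquiv.refl ℝ A : A →L[ℝ] A) 0 :=
    hasStrictFDerivAt_exp_zero (𝕂 := ℝ)
  have localInverse_one := strictDeriv_exp.localInverse_apply_image
  rw [exp_zero] at localInverse_one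
  filter_upwards [(map_zero ρ ▸ ρ.continuous.tendsto 0).eventually
    strictDeriv_exp.eventually_left_inverse] with w left_inverse exp_eq_one
  refine injective_rep ?_
  rw [map_zero, ← left_inverse, exp_eq_one, localInverse_one]

variable [CompleteSpace E] {B : E →L[ℝ] E →L[ℝ] E}

theorem exists_hasDerivAt_wordProd (hρ : IsRep B ρ) {v : E}
    (hv : v ∈ orbitSpan B X (List.ofFn fun i => (g i, t i))) :
    ∃ c : Fin M → ℝ, HasDerivAt
      (fun s : ℝ => wordProd (fun v => exp (ρ v)) (X ∘ g) (t + s • c))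
      (ρ v * wordProd (fun v => exp (ρ v)) (X ∘ g) t) 0 := by
  induction M generalizing v with
  | zero =>
    have v_eq_zero : v = 0 := (Submodule.mem_bot ℝ).1 hv
    refine ⟨0, (hasDerivAt_const _ (1 : A)).congr_deriv ?_⟩
    rw [v_eq_zero, map_zero, zero_mul]
  | succ M ih =>
    rw [List.ofFn_succ, orbitSpan, Submodule.mem_sup] at hv
    obtain ⟨_, mem_span, _, ⟨w, hw, rfl⟩, rfl⟩ := hv
    obtain ⟨a, rfl⟩ := Submodule.mem_span_singleton.1 mem_span
    obtain ⟨c, deriv_tail⟩ := ih (Fin.tail g) (Fin.tail t) hw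
    set u := ρ (X (g 0))
    have deriv_head : HasDerivAt (fun s : ℝ => exp ((t 0 + s * a) • u))
        (a • (u * exp (t 0 • u))) 0 := by
      refine (HasDerivAt.scomp (0 : ℝ) (hasDerivAt_exp_smul_const' u (t 0 + 0 * a))
        (((hasDerivAt_id (0 : ℝ)).mul_const a).const_add (t 0))).congr_deriv ?_
      rw [zero_mul, add_zero, one_mul]
    refine ⟨Fin.cons a c, ((deriv_head.mul deriv_tail).congr_of_eventuallyEq
      (Eventually.of_forall fun s => ?_)).congr_deriv ?_⟩
    · rw [wordProd_succ, Pi.mul_apply, map_smul]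
      rfl
    · have exp_head : exp (t 0 • u) * ρ w =
          ρ ((exp (t 0 • B (X (g 0))) : E →L[ℝ] E) w) * exp (t 0 • u) := by
        simpa only [map_smul] using exp_rep_mul hρ (t 0 • X (g 0)) w
      rw [wordProd_succ, zero_mul, add_zero, zero_smul, add_zero, ← mul_assoc, exp_head, map_add,
        add_mul, map_smul, map_smul, smul_mul_assoc, smul_mul_assoc, mul_assoc, mul_assoc]
      rfl

variable {X g t}

theorem surjective_of_orbitSpan_eq_top (hρ : IsRep B ρ) (injective_rep : Function.Injective ρ)
    (spans : orbitSpan B X (List.ofFn fun i => (g i, t i)) = ⊤) {W : (Fin M → ℝ) → E}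
    (wordProd_eq : ∀ᶠ s in 𝓝 t, wordProd (fun v => exp (ρ v)) (X ∘ g) s = exp (ρ (W s)))
    (W_zero : W t = 0) {W' : (Fin M → ℝ) →L[ℝ] E} (hW : HasFDerivAt W W' t) :
    Function.Surjective W' := by
  intro v
  obtain ⟨c, deriv_word⟩ := exists_hasDerivAt_wordProd X g t hρ (spans ▸ Submodule.mem_top : v ∈ _)
  refine ⟨c, injective_rep ?_⟩
  rw [wordProd_eq.self_of_nhds, W_zero, map_zero, exp_zero, mul_one] at deriv_word
  have hasFDerivAt_exp : HasFDerivAt (fun s => exp (ρ (W s))) (ρ ∘L W') t := by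
    have hasFDerivAt_exp_at : HasFDerivAt (exp : A → A) (1 : A →L[ℝ] A) (ρ (W t)) := by
      rw [W_zero, map_zero]
      exact hasFDerivAt_exp_zero
    exact hasFDerivAt_exp_at.comp t (ρ.hasFDerivAt.comp t hW)
  have deriv_line : HasDerivAt (fun s : ℝ => t + s • c) c 0 := by
    simpa only [one_smul] using ((hasDerivAt_id' (0 : ℝ)).smul_const c).const_add t
  have line_zero : t + (0 : ℝ) • c = t := by rw [zero_smul, add_zero]
  exact (((hasFDerivAt_exp.congr_of_eventuallyEq wordProd_eq).comp_hasDerivAt_of_eq (0 : ℝ)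
    deriv_line line_zero.symm).unique deriv_word)

end WordProdRep

section WordFoldBch

variable {E : Type*} [NormedAddCommGroup E] [NormedSpace ℝ E] [CompleteSpace E] {M : ℕ}

theorem contDiffAt_wordFold_bch (B : E →L[ℝ] E →L[ℝ] E) (Y : Fin M → E) :
    ContDiffAt ℝ 1 (fun q : (E →L[ℝ] E →L[ℝ] E) × (Fin M → ℝ) => wordFold (bch q.1) Y q.2)
      (B, 0) := by
  induction M with
  | zero => exact contDiffAt_const (c := (0 : E))
  | succ M ih =>
    have contDiff_tail : ContDiff ℝ 1 fun q : (E →L[ℝ] E →L[ℝ] E) × (Fin (M + 1) → ℝ) =>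
        (q.1, Fin.tail q.2) :=
      contDiff_fst.prodMk (contDiff_pi.2 fun i => (contDiff_apply ℝ ℝ i.succ).comp contDiff_snd)
    have contDiffAt_tail := (ih (Fin.tail Y)).comp (B, 0)
      (f := fun q : (E →L[ℝ] E →L[ℝ] E) × (Fin (M + 1) → ℝ) => (q.1, Fin.tail q.2))
      contDiff_tail.contDiffAt
    have contDiff_head : ContDiff ℝ 1 fun q : (E →L[ℝ] E →L[ℝ] E) × (Fin (M + 1) → ℝ) =>
        q.2 0 • Y 0 :=
      ((contDiff_apply ℝ ℝ (0 : Fin (M + 1))).comp contDiff_snd).smul contDiff_const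
    have contDiffAt_bch_at : ContDiffAt ℝ 1
        (fun p : (E →L[ℝ] E →L[ℝ] E) × E × E => bch p.1 p.2.1 p.2.2)
        (B, (0 : ℝ) • Y 0, wordFold (bch B) (Fin.tail Y) 0) := by
      rw [zero_smul, wordFold_zero (bch_zero_zero B)]
      exact contDiffAt_bch B
    simp only [wordFold_succ]
    exact contDiffAt_bch_at.comp (B, (0 : Fin (M + 1) → ℝ))
      (contDiffAt_fst.prodMk (contDiff_head.contDiffAt.prodMk contDiffAt_tail))

theorem tendsto_wordFold_bch (B : E →L[ℝ] E →L[ℝ] E) (Y : Fin M → E) :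
    Tendsto (wordFold (bch B) Y) (𝓝 0) (𝓝 0) := by
  have continuousAt_wordFold := (contDiffAt_wordFold_bch B Y).continuousAt.tendsto.comp
    (Continuous.prodMk_right B).continuousAt.tendsto
  rwa [wordFold_zero (bch_zero_zero B)] at continuousAt_wordFold

theorem eventually_wordProd_eq {H : Type*} [Mul H] [One H] {e : E → H} {B : E →L[ℝ] E →L[ℝ] E}
    (e_zero : e 0 = 1) {r : ℝ} (hr : 0 < r)
    (e_mul : ∀ x y, ‖x‖ < r → ‖y‖ < r → e x * e y = e (bch B x y)) (Y : Fin M → E) :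
    ∀ᶠ t in 𝓝 0, wordProd e Y t = e (wordFold (bch B) Y t) := by
  induction M with
  | zero => exact Eventually.of_forall fun _ => e_zero.symm
  | succ M ih =>
    have tendsto_tail : Tendsto (Fin.tail : (Fin (M + 1) → ℝ) → _) (𝓝 0) (𝓝 0) :=
      (continuous_pi fun i => continuous_apply i.succ).tendsto 0
    have tendsto_head : Tendsto (fun t : Fin (M + 1) → ℝ => t 0 • Y 0) (𝓝 0) (𝓝 0) := by
      refine Continuous.tendsto' (by fun_prop) _ _ ?_
      rw [Pi.zero_apply, zero_smul]
    filter_upwards [tendsto_tail.eventually (ih (Fin.tail Y)),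
      tendsto_head (Metric.ball_mem_nhds 0 hr),
      ((tendsto_wordFold_bch B (Fin.tail Y)).comp tendsto_tail) (Metric.ball_mem_nhds 0 hr)]
      with t tail_eq head_small tail_small
    rw [wordProd_succ, wordFold_succ, tail_eq]
    exact e_mul _ _ (mem_ball_zero_iff.1 head_small) (mem_ball_zero_iff.1 tail_small)

end WordFoldBch

/-! ### Boxes -/

section WordBox

variable {E : Type*} [NormedAddCommGroup E] [NormedSpace ℝ E] {M : ℕ}

/-- The box `Box¹(ε)` in exponential coordinates, for the group law given by the
Baker-Campbell-Hausdorff product of the bracket `B`. -/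
def wordBox (B : E →L[ℝ] E →L[ℝ] E) (Y : Fin M → E) (ε : ℝ) : Set E :=
  wordFold (bch B) Y '' {t | ∑ i, |t i| < ε}

theorem wordBox_mono (B : E →L[ℝ] E →L[ℝ] E) (Y : Fin M → E) : Monotone (wordBox B Y) :=
  fun _ _ le => image_mono fun _ lt => lt_of_lt_of_le lt le

theorem mem_box1 {L : Type*} [AddCommGroup L] [Module ℝ L] {H : Type*} [Mul H] [One H]
    {e : L → H} {Y : Fin M → L} {ε : ℝ} (hε : 0 < ε) {x : H} :
    x ∈ box1 e Y ε ↔ ∃ t : Fin M → ℝ, x = wordProd e Y t ∧ ∑ i, |t i| < ε := by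
  simp only [box1, Set.mem_ofPred_eq, delta1, iInf_lt_iff, exists_prop,
    ENNReal.ofReal_lt_ofReal_iff hε]

theorem box1_eq_image {L : Type*} [AddCommGroup L] [Module ℝ L] {H : Type*} [Mul H] [One H]
    (e : L → H) (Y : Fin M → L) {ε : ℝ} (hε : 0 < ε) :
    box1 e Y ε = wordProd e Y '' {t | ∑ i, |t i| < ε} := by
  ext x
  simp only [mem_box1 hε, mem_image, Set.mem_ofPred_eq, and_comm, eq_comm]

theorem norm_le_sum_abs {ι : Type*} [Fintype ι] (t : ι → ℝ) : ‖t‖ ≤ ∑ i, |t i| :=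
  (pi_norm_le_iff_of_nonneg (Finset.sum_nonneg fun _ _ => abs_nonneg _)).2 fun i =>
    Finset.single_le_sum (f := fun i => |t i|) (fun _ _ => abs_nonneg _) (Finset.mem_univ i)

theorem exists_forall_sum_abs_lt {ι : Type*} [Fintype ι] {P : (ι → ℝ) → Prop}
    (hP : ∀ᶠ t in 𝓝 0, P t) : ∃ σ > 0, ∀ t : ι → ℝ, ∑ i, |t i| < σ → P t := by
  obtain ⟨σ, hσ, ball_subset⟩ := Metric.eventually_nhds_iff_ball.1 hP
  exact ⟨σ, hσ, fun t ht => ball_subset t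
    (mem_ball_zero_iff.2 ((norm_le_sum_abs t).trans_lt ht))⟩

theorem eventually_box1_eq_image_wordBox [CompleteSpace E] {H : Type*} [Mul H] [One H] {e : E → H}
    {B : E →L[ℝ] E →L[ℝ] E} (e_zero : e 0 = 1) {r : ℝ} (hr : 0 < r)
    (e_mul : ∀ x y, ‖x‖ < r → ‖y‖ < r → e x * e y = e (bch B x y)) (Y : Fin M → E) :
    ∀ᶠ ε in 𝓝[>] 0, box1 e Y ε = e '' wordBox B Y ε := by
  obtain ⟨σ, hσ, wordProd_eq⟩ :=
    exists_forall_sum_abs_lt (eventually_wordProd_eq e_zero hr e_mul Y)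
  filter_upwards [Ioo_mem_nhdsGT hσ] with ε ⟨hε, hεσ⟩
  rw [box1_eq_image e Y hε, wordBox, image_image]
  exact image_congr fun t ht => wordProd_eq t (lt_trans ht hεσ)

theorem sum_abs_smul {ι : Type*} [Fintype ι] (c : ℝ) (t : ι → ℝ) :
    ∑ i, |(c • t) i| = |c| * ∑ i, |t i| := by
  simp only [Pi.smul_apply, smul_eq_mul, abs_mul, Finset.mul_sum]

theorem image_wordBox [CompleteSpace E] {B B' : E →L[ℝ] E →L[ℝ] E} {Φ : E ≃L[ℝ] E}
    (hΦ : ∀ x y, Φ (B' x y) = B (Φ x) (Φ y)) {Y : Fin M → E} {c : ℝ} (hc : 0 < c)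
    (hY : ∀ i, Φ (Y i) = c • Y i) (ε : ℝ) :
    Φ '' wordBox B' Y ε = wordBox B Y (c * ε) := by
  have map_word : ∀ t, Φ (wordFold (bch B') Y t) = wordFold (bch B) Y (c • t) := fun t =>
    map_wordFold (map_zero Φ) (fun x y => (bch_map Φ hΦ x y).symm) fun i => by
      rw [map_smul, hY, smul_smul, Pi.smul_apply, smul_eq_mul, mul_comm]
  have smul_simplex : (c • · : (Fin M → ℝ) → _) '' {t | ∑ i, |t i| < ε} =
      {t | ∑ i, |t i| < c * ε} := by
    refine Subset.antisymm (image_subset_iff.2 fun t ht => ?_) fun t ht =>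
      ⟨c⁻¹ • t, ?_, smul_inv_smul₀ hc.ne' t⟩
    · rw [mem_preimage, Set.mem_ofPred_eq, sum_abs_smul, abs_of_pos hc]
      exact mul_lt_mul_of_pos_left ht hc
    · rw [Set.mem_ofPred_eq, sum_abs_smul, abs_of_pos (inv_pos.2 hc), inv_mul_lt_iff₀ hc]
      exact ht
  rw [wordBox, wordBox, ← smul_simplex, image_image, image_image]
  exact image_congr fun t _ => map_word t

end WordBox

theorem map_nhds_prodMk_fst_eq {𝕜 V F : Type*} [NontriviallyNormedField 𝕜] [CompleteSpace 𝕜]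
    [NormedAddCommGroup V] [NormedSpace 𝕜 V] [CompleteSpace V] [NormedAddCommGroup F]
    [NormedSpace 𝕜 F] [CompleteSpace F] {f : 𝕜 × V → F} {f' : 𝕜 × V →L[𝕜] F} {a : 𝕜} {b : V}
    (hf : HasStrictFDerivAt f f' (a, b))
    (surjective : Function.Surjective (f' ∘L ContinuousLinearMap.inr 𝕜 𝕜 V)) :
    map (fun q => (q.1, f q)) (𝓝 (a, b)) = 𝓝 (a, f (a, b)) := by
  refine (hasStrictFDerivAt_fst.prodMk hf).map_nhds_eq_of_surj
    (LinearMap.range_eq_top.2 fun ⟨u, v⟩ => ?_)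
  obtain ⟨w, hw⟩ := surjective (v - f' (u, 0))
  refine ⟨(u, w), Prod.ext rfl ?_⟩
  have split : f' (u, w) = f' (u, 0) + f' (0, w) := by rw [← map_add, Prod.mk_add_mk, add_zero,
    zero_add]
  exact split.trans (add_eq_of_eq_sub' hw)

namespace GradedBracket

variable {E : Type*} [NormedAddCommGroup E] [NormedSpace ℝ E] (𝔤 : GradedBracket E) {M : ℕ}
  (Y : Fin M → E)

/-- The word map in exponential coordinates, for the rescaled brackets. -/
def wordMap (q : ℝ × (Fin M → ℝ)) : E := wordFold (bch (𝔤.scaled q.1)) Y q.2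

theorem wordMap_zero (ε : ℝ) : 𝔤.wordMap Y (ε, 0) = 0 := wordFold_zero (bch_zero_zero _) Y

theorem contDiffAt_wordMap [CompleteSpace E] (ε : ℝ) : ContDiffAt ℝ 1 (𝔤.wordMap Y) (ε, 0) :=
  (contDiffAt_wordFold_bch (𝔤.scaled ε) Y).comp (ε, 0)
    (f := fun q : ℝ × (Fin M → ℝ) => (𝔤.scaled q.1, q.2))
    ((𝔤.contDiff_scaled.comp contDiff_fst).prodMk contDiff_snd).contDiffAt

theorem exists_submersive_word [FiniteDimensional ℝ E] {ι : Type*} [Finite ι] {X : ι → E}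
    (hX : ∀ i, 𝔤.proj 1 (X i) = X i)
    (generates : ∀ T : Submodule ℝ E,
      (∀ i, X i ∈ T) → (∀ i, ∀ y ∈ T, 𝔤.nil (X i) y ∈ T) → T = ⊤) :
    ∃ (M : ℕ) (g : Fin M → ι), Function.Surjective g ∧ ∃ (s : Fin M → ℝ)
      (F' : ℝ × (Fin M → ℝ) →L[ℝ] E), 𝔤.wordMap (X ∘ g) (0, s) = 0 ∧
        HasStrictFDerivAt (𝔤.wordMap (X ∘ g)) F' (0, s) ∧
        Function.Surjective (F' ∘L ContinuousLinearMap.inr ℝ ℝ (Fin M → ℝ)) := by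
  have : CompleteSpace E := FiniteDimensional.complete ℝ E
  obtain ⟨l, mem_l, closed⟩ := 𝔤.exists_closed_word hX generates (𝔤.rep ∘ X)
  set g : Fin l.length → ι := fun i => (l.get i).1
  set s₁ : Fin l.length → ℝ := fun i => (l.get i).2
  have ofFn_eq : ∀ c : ℝ, List.ofFn (fun i => (g i, (c • s₁) i)) = scaleWord c l := fun c => by
    conv_rhs => rw [scaleWord, ← List.ofFn_get l, List.map_ofFn]
    rfl
  obtain ⟨r, hr, exp_rep_mul_exp⟩ := exists_exp_mul_exp_eq 𝔤.isRep_nil 𝔤.isRep_rep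
  have tendsto_smul : Tendsto (fun c : ℝ => c • s₁) (𝓝[≠] 0) (𝓝 0) :=
    tendsto_nhdsWithin_of_tendsto_nhds
      (Continuous.tendsto' (by fun_prop) _ _ (zero_smul ℝ s₁))
  have wordProd_eq := eventually_wordProd_eq (e := fun v => exp (𝔤.rep v))
    (by rw [map_zero, exp_zero]) hr exp_rep_mul_exp (X ∘ g)
  have eq_zero := (tendsto_wordFold_bch 𝔤.nil (X ∘ g)).eventually
    (eventually_eq_zero_of_exp_rep_eq_one 𝔤.rep_injective)
  obtain ⟨c, contDiffAt_c, wordProd_eq_c, eq_zero_c, c_ne_zero⟩ :=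
    ((tendsto_const_nhds.prodMk_nhds tendsto_smul).eventually
      ((𝔤.contDiffAt_wordMap (X ∘ g) 0).eventually (by simp))).and
    ((tendsto_smul.eventually wordProd_eq.eventually_nhds).and
    ((tendsto_smul.eventually eq_zero).and self_mem_nhdsWithin)) |>.exists
  have word_eq_zero : 𝔤.wordMap (X ∘ g) (0, c • s₁) = 0 := eq_zero_c <| by
    rw [← wordProd_eq_c.self_of_nhds, wordProd_exp_rep, ofFn_eq, (closed c).1]
  have strictDeriv := contDiffAt_c.hasStrictFDerivAt one_ne_zero
  refine ⟨l.length, g, fun i => ?_, c • s₁, _, word_eq_zero, strictDeriv, ?_⟩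
  · obtain ⟨a, mem_a, rfl⟩ := List.mem_map.1 (mem_l i)
    obtain ⟨n, rfl⟩ := List.mem_iff_get.1 mem_a
    exact ⟨n, rfl⟩
  · exact surjective_of_orbitSpan_eq_top 𝔤.isRep_rep 𝔤.rep_injective
      (by rw [ofFn_eq]; exact (closed c).2 c_ne_zero) wordProd_eq_c word_eq_zero
      (strictDeriv.hasFDerivAt.comp (c • s₁) (hasFDerivAt_prodMk_right 0 (c • s₁)))

/-- The boxes of some fixed size of all the rescaled brackets `𝔤.scaled ε`, with `ε` near `0`,
contain a common ball. -/
def HasUniformBoxes : Prop :=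
  ∃ ρ > 0, ∃ C, ∀ᶠ ε in 𝓝 0, Metric.ball 0 ρ ⊆ wordBox (𝔤.scaled ε) Y C

variable {Y}

theorem exists_hasUniformBoxes [FiniteDimensional ℝ E] {ι : Type*} [Finite ι] {X : ι → E}
    (hX : ∀ i, 𝔤.proj 1 (X i) = X i)
    (generates : ∀ T : Submodule ℝ E,
      (∀ i, X i ∈ T) → (∀ i, ∀ y ∈ T, 𝔤.nil (X i) y ∈ T) → T = ⊤) :
    ∃ (M : ℕ) (g : Fin M → ι), Function.Surjective g ∧ 𝔤.HasUniformBoxes (X ∘ g) := by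
  have : CompleteSpace E := FiniteDimensional.complete ℝ E
  obtain ⟨M, g, surjective_g, s, F', word_eq_zero, strictDeriv, surjective⟩ :=
    𝔤.exists_submersive_word hX generates
  have cost_lt : ∀ᶠ q : ℝ × (Fin M → ℝ) in 𝓝 (0, s), ∑ i, |q.2 i| < ∑ i, |s i| + 1 :=
    (by fun_prop : Continuous fun q : ℝ × (Fin M → ℝ) => ∑ i, |q.2 i|).continuousAt.eventually_lt
      continuousAt_const (lt_add_one _)
  have image_mem := image_mem_map (m := fun q => (q.1, 𝔤.wordMap (X ∘ g) q)) cost_lt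
  rw [map_nhds_prodMk_fst_eq strictDeriv surjective, word_eq_zero, Metric.mem_nhds_iff]
    at image_mem
  obtain ⟨ρ, hρ, ball_subset⟩ := image_mem
  refine ⟨M, g, surjective_g, ρ, hρ, ∑ i, |s i| + 1, ?_⟩
  filter_upwards [Metric.ball_mem_nhds 0 hρ] with ε hε y hy
  have mem_ball : (ε, y) ∈ Metric.ball ((0 : ℝ), (0 : E)) ρ := by
    rw [← ball_prod_same]
    exact ⟨hε, hy⟩
  obtain ⟨⟨_, t⟩, ht, word_eq⟩ := ball_subset mem_ball
  obtain ⟨rfl, rfl⟩ := Prod.mk.inj word_eq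
  exact ⟨t, ht, rfl⟩

theorem exists_wordBox_scaled_subset_ball [CompleteSpace E] (Y : Fin M → E) {ρ : ℝ} (hρ : 0 < ρ) :
    ∃ σ > 0, ∀ᶠ ε in 𝓝 0, wordBox (𝔤.scaled ε) Y σ ⊆ Metric.ball 0 ρ := by
  have tendsto_wordMap := (𝔤.contDiffAt_wordMap Y 0).continuousAt.tendsto
  rw [wordMap_zero] at tendsto_wordMap
  have eventually_mem := (tendsto_wordMap (Metric.ball_mem_nhds 0 hρ))
  rw [Filter.mem_map, nhds_prod_eq] at eventually_mem
  obtain ⟨P, hP, Q, hQ, mem_ball⟩ := eventually_prod_iff.1 eventually_mem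
  obtain ⟨σ, hσ, forall_Q⟩ := exists_forall_sum_abs_lt hQ
  refine ⟨σ, hσ, hP.mono fun ε hε => image_subset_iff.2 fun t ht => ?_⟩
  exact mem_ball hε (forall_Q t ht)

variable {𝔤} [CompleteSpace E] (hY : ∀ i, 𝔤.proj 1 (Y i) = Y i)

include hY in
theorem dilation_image_wordBox_scaled {c : ℝ} (hc : 0 < c) (ε : ℝ) :
    𝔤.dilationEquiv hc.ne' '' wordBox (𝔤.scaled c) Y ε = wordBox 𝔤.bracket Y (c * ε) :=
  image_wordBox (𝔤.dilation_scaled c) hc (fun i => 𝔤.dilation_eq_smul (hY i) c) ε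

include hY in
theorem dilation_image_wordBox_nil {c : ℝ} (hc : 0 < c) (ε : ℝ) :
    𝔤.dilationEquiv hc.ne' '' wordBox 𝔤.nil Y ε = wordBox 𝔤.nil Y (c * ε) :=
  image_wordBox (𝔤.dilation_nil c) hc (fun i => 𝔤.dilation_eq_smul (hY i) c) ε

namespace HasUniformBoxes

variable (h : 𝔤.HasUniformBoxes Y)

include h

omit [CompleteSpace E] in
theorem exists_wordBox_nil_mem_nhds : ∃ C, wordBox 𝔤.nil Y C ∈ 𝓝 0 := by
  obtain ⟨ρ, hρ, C, ball_subset⟩ := h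
  exact ⟨C, mem_of_superset (Metric.ball_mem_nhds 0 hρ) ball_subset.self_of_nhds⟩

include hY

theorem exists_wordBox_subset : ∃ C > 1, ∀ᶠ ε in 𝓝[>] 0,
    wordBox 𝔤.nil Y ε ⊆ wordBox 𝔤.bracket Y (C * ε) ∧
      wordBox 𝔤.bracket Y ε ⊆ wordBox 𝔤.nil Y (C * ε) := by
  obtain ⟨ρ, hρ, C, ball_subset⟩ := h
  obtain ⟨σ, hσ, subset_ball⟩ := 𝔤.exists_wordBox_scaled_subset_ball Y hρ
  refine ⟨max (C / σ) 2, lt_max_of_lt_right one_lt_two, ?_⟩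
  have tendsto_div : Tendsto (· / σ) (𝓝[>] 0) (𝓝 0) :=
    tendsto_nhdsWithin_of_tendsto_nhds
      (Continuous.tendsto' (by fun_prop) _ _ (zero_div σ))
  filter_upwards [tendsto_div.eventually ball_subset, tendsto_div.eventually subset_ball,
    self_mem_nhdsWithin] with ε ball_subset_ε subset_ball_ε hε
  have hc : 0 < ε / σ := div_pos hε hσ
  have cost_le : ε / σ * C ≤ max (C / σ) 2 * ε := by
    rw [div_mul_comm]
    exact mul_le_mul_of_nonneg_right (le_max_left _ _) (le_of_lt hε)
  have ε_eq : ε = ε / σ * σ := (div_mul_cancel₀ ε hσ.ne').symm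
  constructor
  · calc wordBox 𝔤.nil Y ε = 𝔤.dilationEquiv hc.ne' '' wordBox 𝔤.nil Y σ := by
          rw [dilation_image_wordBox_nil hY hc, ← ε_eq]
      _ ⊆ 𝔤.dilationEquiv hc.ne' '' wordBox (𝔤.scaled (ε / σ)) Y C :=
          image_mono (subset_ball.self_of_nhds.trans ball_subset_ε)
      _ ⊆ _ := by
          rw [dilation_image_wordBox_scaled hY hc]
          exact wordBox_mono _ Y cost_le
  · calc wordBox 𝔤.bracket Y ε = 𝔤.dilationEquiv hc.ne' '' wordBox (𝔤.scaled (ε / σ)) Y σ := by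
          rw [dilation_image_wordBox_scaled hY hc, ← ε_eq]
      _ ⊆ 𝔤.dilationEquiv hc.ne' '' wordBox 𝔤.nil Y C :=
          image_mono (subset_ball_ε.trans ball_subset.self_of_nhds)
      _ ⊆ _ := by
          rw [dilation_image_wordBox_nil hY hc]
          exact wordBox_mono _ Y cost_le

theorem wordBox_bracket_mem_nhds {ε : ℝ} (hε : 0 < ε) :
    wordBox 𝔤.bracket Y ε ∈ 𝓝 0 := by
  obtain ⟨ρ, hρ, C, ball_subset⟩ := h
  have tendsto_mul : Tendsto (· * C) (𝓝[>] 0) (𝓝 0) :=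
    tendsto_nhdsWithin_of_tendsto_nhds
      (Continuous.tendsto' (by fun_prop) _ _ (zero_mul C))
  obtain ⟨c, cost_lt, ball_subset_c, hc⟩ := ((tendsto_mul.eventually (gt_mem_nhds hε)).and
    ((ball_subset.filter_mono nhdsWithin_le_nhds).and self_mem_nhdsWithin)).exists
  refine mem_of_superset ?_ (wordBox_mono _ Y cost_lt.le)
  rw [← dilation_image_wordBox_scaled hY hc, ← map_zero (𝔤.dilationEquiv (ne_of_gt hc)),
    ← (𝔤.dilationEquiv (ne_of_gt hc)).map_nhds_eq]
  exact image_mem_map (mem_of_superset (Metric.ball_mem_nhds 0 hρ) ball_subset_c)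

end HasUniformBoxes

end GradedBracket

/-! ### Left-invariant vector fields and the exponential map -/

section LieGroup

variable {E : Type*} [NormedAddCommGroup E] [NormedSpace ℝ E]
  {G : Type*} [TopologicalSpace G] [ChartedSpace E G] [Group G]
  {v : GroupLieAlgebra 𝓘(ℝ, E) G}

theorem mulInvariantVectorField_one (v : GroupLieAlgebra 𝓘(ℝ, E) G) :
    mulInvariantVectorField (I := 𝓘(ℝ, E)) v (1 : G) = v := by
  have one_mul_eq_id : ((1 : G) * ·) = id := funext one_mul
  rw [mulInvariantVectorField, one_mul_eq_id, mfderiv_id]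
  rfl

variable [LieGroup 𝓘(ℝ, E) (minSmoothness ℝ 3) G]

theorem contMDiff_one_mulInvariantVectorField (v : GroupLieAlgebra 𝓘(ℝ, E) G) :
    ContMDiff 𝓘(ℝ, E) (𝓘(ℝ, E).prod 𝓘(ℝ, E)) 1
      (fun g : G => (⟨g, mulInvariantVectorField v g⟩ : TangentBundle 𝓘(ℝ, E) G)) :=
  (contMDiff_mulInvariantVectorField (I := 𝓘(ℝ, E)) v).of_le
    (one_le_two.trans le_minSmoothness)

theorem mdifferentiableAt_mul_left (a b : G) :
    MDifferentiableAt 𝓘(ℝ, E) 𝓘(ℝ, E) (a * ·) b :=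
  (contMDiff_mul_left (I := 𝓘(ℝ, E)) (n := minSmoothness ℝ 3)).contMDiffAt.mdifferentiableAt
    (lt_of_lt_of_le (by simp) le_minSmoothness).ne'

theorem mfderiv_mul_left_mulInvariantVectorField (v : GroupLieAlgebra 𝓘(ℝ, E) G) (a b : G) :
    mfderiv 𝓘(ℝ, E) 𝓘(ℝ, E) (a * ·) b (mulInvariantVectorField v b) =
      mulInvariantVectorField (I := 𝓘(ℝ, E)) v (a * b) := by
  have mul_eq_comp : (a * b * ·) = (a * ·) ∘ (b * ·) := funext (mul_assoc a b)
  simp only [mulInvariantVectorField]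
  rw [mul_eq_comp, mfderiv_comp (I' := 𝓘(ℝ, E)) 1 (mdifferentiableAt_mul_left a (b * 1))
    (mdifferentiableAt_mul_left b 1)]
  congr 2
  simp

theorem isMIntegralCurveOn_mul_left {γ : ℝ → G} {s : Set ℝ}
    (hγ : IsMIntegralCurveOn (I := 𝓘(ℝ, E)) γ (mulInvariantVectorField v) s) (a : G) :
    IsMIntegralCurveOn (I := 𝓘(ℝ, E)) (fun t => a * γ t) (mulInvariantVectorField v) s := by
  intro t ht
  refine ((mdifferentiableAt_mul_left a (γ t)).hasMFDerivAt.comp_hasMFDerivWithinAt t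
    (hγ t ht)).congr_mfderiv (ContinuousLinearMap.ext fun c : ℝ => ?_)
  change mfderiv 𝓘(ℝ, E) 𝓘(ℝ, E) (a * ·) (γ t) (c • mulInvariantVectorField v (γ t)) =
    c • mulInvariantVectorField v (a * γ t)
  rw [map_smul, mfderiv_mul_left_mulInvariantVectorField]

variable [T2Space G]

theorem lieExp_eq_of_isMIntegralCurve {γ : ℝ → G} (γ_zero : γ 0 = 1)
    (hγ : IsMIntegralCurve (I := 𝓘(ℝ, E)) γ (mulInvariantVectorField v)) :
    lieExp v = γ 1 := by
  have exists_curve : ∃ γ : ℝ → G, γ 0 = 1 ∧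
      IsMIntegralCurve (I := 𝓘(ℝ, E)) γ (mulInvariantVectorField (I := 𝓘(ℝ, E)) v) :=
    ⟨γ, γ_zero, hγ⟩
  rw [lieExp, dif_pos exists_curve]
  exact congrFun (isMIntegralCurve_Ioo_eq_of_contMDiff_boundaryless (t₀ := 0)
    (contMDiff_one_mulInvariantVectorField v) exists_curve.choose_spec.2 hγ
    (exists_curve.choose_spec.1.trans γ_zero.symm)) 1

theorem lieExp_smul_eq {γ : ℝ → G} (γ_zero : γ 0 = 1)
    (hγ : IsMIntegralCurve (I := 𝓘(ℝ, E)) γ (mulInvariantVectorField v)) (s : ℝ) :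
    lieExp (s • v) = γ s := by
  have rescaled := hγ.comp_mul s
  rw [← mulInvariantVectorField_smul] at rescaled
  rw [lieExp_eq_of_isMIntegralCurve (by simp [γ_zero]) rescaled, Function.comp_apply, one_mul]

variable [CompleteSpace E]

theorem exists_isMIntegralCurve (v : GroupLieAlgebra 𝓘(ℝ, E) G) :
    ∃ γ : ℝ → G, γ 0 = 1 ∧
      IsMIntegralCurve (I := 𝓘(ℝ, E)) γ (mulInvariantVectorField (I := 𝓘(ℝ, E)) v) := by
  obtain ⟨γ, γ_zero, hγ⟩ := exists_isMIntegralCurveAt_of_contMDiffAt_boundaryless (t₀ := 0)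
    (contMDiff_one_mulInvariantVectorField v).contMDiffAt (x₀ := (1 : G))
  obtain ⟨ε, hε, integral⟩ := isMIntegralCurveAt_iff'.1 hγ
  rw [Real.ball_eq_Ioo, zero_sub, zero_add] at integral
  exact exists_isMIntegralCurve_of_isMIntegralCurveOn (contMDiff_one_mulInvariantVectorField v) hε
    (fun x => ⟨fun t => x * γ t, by simp only [γ_zero, mul_one],
      isMIntegralCurveOn_mul_left integral x⟩) 1

theorem isMIntegralCurve_lieExp (v : GroupLieAlgebra 𝓘(ℝ, E) G) :
    IsMIntegralCurve (I := 𝓘(ℝ, E)) (fun s : ℝ => (lieExp (s • v) : G))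
      (mulInvariantVectorField v) := by
  obtain ⟨γ, γ_zero, hγ⟩ := exists_isMIntegralCurve v
  rwa [funext (lieExp_smul_eq γ_zero hγ)]

theorem lieExp_zero : (lieExp (0 : GroupLieAlgebra 𝓘(ℝ, E) G) : G) = 1 := by
  obtain ⟨γ, γ_zero, hγ⟩ := exists_isMIntegralCurve (0 : GroupLieAlgebra 𝓘(ℝ, E) G)
  rw [← zero_smul ℝ 0, lieExp_smul_eq γ_zero hγ, γ_zero]

end LieGroup

/-! ### The left-invariant frame in the chart at the identity -/

theorem contDiffAt_clm_of_apply {F F' P : Type*} [NormedAddCommGroup F] [NormedSpace ℝ F]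
    [FiniteDimensional ℝ F] [NormedAddCommGroup F'] [NormedSpace ℝ F'] [NormedAddCommGroup P]
    [NormedSpace ℝ P] {f : P → F →L[ℝ] F'} {x : P} {n : ℕ∞ω}
    (h : ∀ v, ContDiffAt ℝ n (fun y => f y v) x) : ContDiffAt ℝ n f x := by
  let e := (ContinuousLinearEquiv.ofFinrankEq (𝕜 := ℝ) (F := Fin (Module.finrank ℝ F) → ℝ)
    (Module.finrank_fin_fun ℝ).symm).arrowCongr (1 : F' ≃L[ℝ] F') |>.trans
      (ContinuousLinearEquiv.piRing _)
  rw [← e.comp_contDiffAt_iff]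
  exact contDiffAt_pi.2 fun i => h _

section LeftFrame

variable {E : Type*} [NormedAddCommGroup E] [NormedSpace ℝ E]
  (G : Type*) [TopologicalSpace G] [ChartedSpace E G] [Group G]

/-- The left-invariant frame in the chart at the identity: `leftFrame G x v` is the left-invariant
vector field with value `v` at the identity, evaluated at the point with coordinates `x`. -/
def leftFrame [IsManifold 𝓘(ℝ, E) 1 G] (x : E) : E →L[ℝ] E :=
  tangentCoordChange 𝓘(ℝ, E) ((extChartAt 𝓘(ℝ, E) (1 : G)).symm x) 1
      ((extChartAt 𝓘(ℝ, E) (1 : G)).symm x) ∘L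
    (mfderiv 𝓘(ℝ, E) 𝓘(ℝ, E) ((extChartAt 𝓘(ℝ, E) (1 : G)).symm x * ·) 1 : E →L[ℝ] E)

theorem leftFrame_apply [IsManifold 𝓘(ℝ, E) 1 G] (x v : E) :
    leftFrame G x v = tangentCoordChange 𝓘(ℝ, E) ((extChartAt 𝓘(ℝ, E) (1 : G)).symm x) 1
      ((extChartAt 𝓘(ℝ, E) (1 : G)).symm x)
      (mulInvariantVectorField (I := 𝓘(ℝ, E)) (G := G) v
        ((extChartAt 𝓘(ℝ, E) (1 : G)).symm x)) := rfl

theorem leftFrame_extChartAt_one [IsManifold 𝓘(ℝ, E) 1 G] :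
    leftFrame G (extChartAt 𝓘(ℝ, E) (1 : G) 1) = ContinuousLinearMap.id ℝ E := by
  ext v
  rw [leftFrame_apply, extChartAt_to_inv]
  exact (tangentCoordChange_self (I := 𝓘(ℝ, E)) (mem_extChartAt_source (1 : G))).trans
    (mulInvariantVectorField_one (G := G) v)

theorem contDiffAt_leftFrame [FiniteDimensional ℝ E] [LieGroup 𝓘(ℝ, E) (minSmoothness ℝ 3) G] :
    ContDiffAt ℝ 2 (leftFrame G) (extChartAt 𝓘(ℝ, E) (1 : G) 1) := by
  refine contDiffAt_clm_of_apply fun v => ?_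
  have contMDiffAt_field : ContMDiffAt _ _ 2 _ (1 : G) :=
    (contMDiffAt_mulInvariantVectorField (I := 𝓘(ℝ, E)) (G := G) v).of_le le_minSmoothness
  rw [contMDiffAt_iff] at contMDiffAt_field
  exact (contMDiffAt_field.2.contDiffAt (by simp)).snd

variable {G}

theorem hasMFDerivAt_extChartAt_symm_comp [IsManifold 𝓘(ℝ, E) 1 G] {v : E} {α : ℝ → E} {t : ℝ}
    (mem_target : α t ∈ (extChartAt 𝓘(ℝ, E) (1 : G)).target)
    (hα : HasDerivAt α (leftFrame G (α t) v) t) :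
    HasMFDerivAt 𝓘(ℝ, ℝ) 𝓘(ℝ, E) (fun t => (extChartAt 𝓘(ℝ, E) (1 : G)).symm (α t)) t
      ((1 : ℝ →L[ℝ] ℝ).smulRight (mulInvariantVectorField (I := 𝓘(ℝ, E)) (G := G) v
        ((extChartAt 𝓘(ℝ, E) (1 : G)).symm (α t)))) := by
  rw [leftFrame_apply] at hα
  set φ := extChartAt 𝓘(ℝ, E) (1 : G)
  set g : G := φ.symm (α t) with hg
  have mem_source : g ∈ φ.source := φ.map_target mem_target
  have mem_self : g ∈ (extChartAt 𝓘(ℝ, E) g).source := mem_extChartAt_source g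
  have coordChange_coordChange : ∀ w : E,
      tangentCoordChange 𝓘(ℝ, E) 1 g g (tangentCoordChange 𝓘(ℝ, E) g 1 g w) = w := fun w =>
    (tangentCoordChange_comp (x := (1 : G)) ⟨⟨mem_self, mem_source⟩, mem_self⟩).trans
      (tangentCoordChange_self mem_self)
  have hasFDerivAt_transition :
      HasFDerivAt (extChartAt 𝓘(ℝ, E) g ∘ φ.symm) (tangentCoordChange 𝓘(ℝ, E) 1 g g) (α t) := by
    have within := hasFDerivWithinAt_tangentCoordChange (I := 𝓘(ℝ, E)) ⟨mem_source, mem_self⟩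
    rw [hg, φ.right_inv mem_target] at within
    rw [modelWithCornersSelf_coe, range_id] at within
    exact hasFDerivWithinAt_univ.1 within
  have hasDerivAt_chart : HasDerivAt ((extChartAt 𝓘(ℝ, E) g ∘ φ.symm) ∘ α)
      (mulInvariantVectorField (I := 𝓘(ℝ, E)) (G := G) v g : E) t :=
    (hasFDerivAt_transition.comp_hasDerivAt t hα).congr_deriv (coordChange_coordChange _)
  refine ⟨(continuousAt_extChartAt_symm'' mem_target).comp hα.continuousAt, ?_⟩
  rw [modelWithCornersSelf_coe, range_id]
  exact hasDerivAt_chart.hasFDerivAt.hasFDerivWithinAt.congr_fderiv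
    (ContinuousLinearMap.ext fun _ => rfl)

end LeftFrame

/-! ### The Baker-Campbell-Hausdorff formula in a Lie group -/

section MaurerCartan

variable {E : Type*} [NormedAddCommGroup E] [NormedSpace ℝ E]

theorem mlieBracket_eq_lieBracket (V W : (x : E) → TangentSpace 𝓘(ℝ, E) x) (x : E) :
    VectorField.mlieBracket 𝓘(ℝ, E) V W x = VectorField.lieBracket ℝ V W x := by
  rw [← VectorField.mlieBracketWithin_univ, VectorField.mlieBracketWithin_eq_lieBracketWithin]
  exact congrFun VectorField.lieBracketWithin_univ x

variable (G : Type*) [TopologicalSpace G] [ChartedSpace E G] [Group G]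

variable (E) in
/-- The Lie algebra of a Lie group is, as a vector space, the model space. -/
def lieEquiv : GroupLieAlgebra 𝓘(ℝ, E) G ≃L[ℝ] E := ContinuousLinearEquiv.refl ℝ E

/-- The exponential map, as a map on the model space. -/
def expModel (v : E) : G := lieExp ((lieEquiv E G).symm v)

/-- The exponential map in the chart at the identity. -/
def expChart (v : E) : E := extChartAt 𝓘(ℝ, E) (1 : G) (expModel G v)

theorem leftFrame_eq_mpullback [IsManifold 𝓘(ℝ, E) 1 G] {x : E}
    (hx : x ∈ (extChartAt 𝓘(ℝ, E) (1 : G)).target) (v : E) :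
    leftFrame G x v = VectorField.mpullback 𝓘(ℝ, E) 𝓘(ℝ, E) (extChartAt 𝓘(ℝ, E) (1 : G)).symm
      (mulInvariantVectorField (I := 𝓘(ℝ, E)) (G := G) v) x := by
  have chart_comp_symm :=
    mfderiv_extChartAt_comp_mfderivWithin_extChartAt_symm (I := 𝓘(ℝ, E)) hx
  have symm_comp_chart :=
    mfderivWithin_extChartAt_symm_comp_mfderiv_extChartAt (I := 𝓘(ℝ, E)) hx
  rw [modelWithCornersSelf_coe, range_id, mfderivWithin_univ] at chart_comp_symm symm_comp_chart
  have mem_source : (extChartAt 𝓘(ℝ, E) (1 : G)).symm x ∈ (chartAt E (1 : G)).source := by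
    rw [← extChartAt_source 𝓘(ℝ, E)]
    exact (extChartAt 𝓘(ℝ, E) (1 : G)).map_target hx
  rw [VectorField.mpullback, ContinuousLinearMap.inverse_eq symm_comp_chart chart_comp_symm,
    leftFrame_apply, (hasMFDerivAt_extChartAt (I := 𝓘(ℝ, E)) mem_source).mfderiv,
    mfderiv_chartAt_eq_tangentCoordChange (I := 𝓘(ℝ, E)) mem_source]
  rfl

variable [LieGroup 𝓘(ℝ, E) (minSmoothness ℝ 3) G]

theorem lieBracket_leftFrame [CompleteSpace E] {x : E}
    (hx : x ∈ (extChartAt 𝓘(ℝ, E) (1 : G)).target) (v w : E) :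
    VectorField.lieBracket ℝ (fun y => leftFrame G y v) (fun y => leftFrame G y w) x =
      leftFrame G x (lieEquiv E G ⁅(lieEquiv E G).symm v, (lieEquiv E G).symm w⁆) := by
  have target_mem : (extChartAt 𝓘(ℝ, E) (1 : G)).target ∈ 𝓝 x :=
    (isOpen_extChartAt_target (1 : G)).mem_nhds hx
  have eventuallyEq : ∀ v : E, (fun y => leftFrame G y v) =ᶠ[𝓝 x]
      VectorField.mpullback 𝓘(ℝ, E) 𝓘(ℝ, E) (extChartAt 𝓘(ℝ, E) (1 : G)).symm
        (mulInvariantVectorField (I := 𝓘(ℝ, E)) (G := G) v) := fun v =>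
    eventually_of_mem target_mem fun y hy => leftFrame_eq_mpullback G hy v
  have pullback_bracket := VectorField.mpullback_mlieBracket (I := 𝓘(ℝ, E)) (I' := 𝓘(ℝ, E))
    (n := minSmoothness ℝ 3) (f := (extChartAt 𝓘(ℝ, E) (1 : G)).symm) (x₀ := x)
    (V := mulInvariantVectorField (I := 𝓘(ℝ, E)) (G := G) v)
    (W := mulInvariantVectorField (I := 𝓘(ℝ, E)) (G := G) w)
    (mdifferentiableAt_mulInvariantVectorField _) (mdifferentiableAt_mulInvariantVectorField _)
    ((contMDiffOn_extChartAt_symm (1 : G)).contMDiffAt target_mem)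
    (minSmoothness_monotone (by norm_cast))
  rw [(eventuallyEq v).lieBracket_vectorField_eq (eventuallyEq w), leftFrame_eq_mpullback G hx,
    ← mlieBracket_eq_lieBracket]
  refine pullback_bracket.symm.trans ?_
  exact congrArg (fun V => VectorField.mpullback 𝓘(ℝ, E) 𝓘(ℝ, E)
    (extChartAt 𝓘(ℝ, E) (1 : G)).symm V x) (mulInvariantVector_mlieBracket _ _).symm

variable [FiniteDimensional ℝ E] {B : E →L[ℝ] E →L[ℝ] E}

theorem maurerCartan_leftFrame
    (hB : ∀ v w, B v w = lieEquiv E G ⁅(lieEquiv E G).symm v, (lieEquiv E G).symm w⁆)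
    {x : E} (hx : x ∈ (extChartAt 𝓘(ℝ, E) (1 : G)).target)
    (differentiableAt : DifferentiableAt ℝ (leftFrame G) x) (v w : E) :
    fderiv ℝ (leftFrame G) x (leftFrame G x v) w - fderiv ℝ (leftFrame G) x (leftFrame G x w) v =
      leftFrame G x (B v w) := by
  have : CompleteSpace E := FiniteDimensional.complete ℝ E
  have fderiv_apply : ∀ u a : E, fderiv ℝ (fun y => leftFrame G y u) x a =
      fderiv ℝ (leftFrame G) x a u := fun u a => by
    rw [fderiv_clm_apply differentiableAt (differentiableAt_const u)]
    simp
  rw [hB, ← lieBracket_leftFrame G hx, VectorField.lieBracket, fderiv_apply, fderiv_apply]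

theorem exists_isMaurerCartanFrame_leftFrame
    (hB : ∀ v w, B v w = lieEquiv E G ⁅(lieEquiv E G).symm v, (lieEquiv E G).symm w⁆) :
    ∃ R > 0, Metric.ball (extChartAt 𝓘(ℝ, E) (1 : G) 1) R ⊆ (extChartAt 𝓘(ℝ, E) (1 : G)).target ∧
      ∃ K, IsMaurerCartanFrame B (leftFrame G) (fderiv ℝ (leftFrame G))
        (Metric.ball (extChartAt 𝓘(ℝ, E) (1 : G) 1) R) K := by
  set x₀ := extChartAt 𝓘(ℝ, E) (1 : G) 1
  have contDiffAt_fderiv : ContDiffAt ℝ 1 (fderiv ℝ (leftFrame G)) x₀ :=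
    (contDiffAt_leftFrame G).fderiv_right (by norm_num)
  obtain ⟨K, s, hs, lipschitz⟩ := contDiffAt_fderiv.exists_lipschitzOnWith
  have eventually_norm_lt : ∀ᶠ x in 𝓝 x₀,
      ‖fderiv ℝ (leftFrame G) x‖₊ < ‖fderiv ℝ (leftFrame G) x₀‖₊ + 1 :=
    contDiffAt_fderiv.continuousAt.nnnorm.eventually_lt continuousAt_const (lt_add_one _)
  obtain ⟨R, hR, ball_subset⟩ := Metric.eventually_nhds_iff_ball.1
    (((contDiffAt_leftFrame G).eventually (by simp)).and (eventually_norm_lt.and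
      ((eventually_mem_set.2 (extChartAt_target_mem_nhds (I := 𝓘(ℝ, E)) (1 : G))).and hs)))
  have differentiableAt : ∀ x ∈ Metric.ball x₀ R, DifferentiableAt ℝ (leftFrame G) x :=
    fun x hx => (ball_subset x hx).1.differentiableAt two_ne_zero
  exact ⟨R, hR, fun x hx => (ball_subset x hx).2.2.1, max K (‖fderiv ℝ (leftFrame G) x₀‖₊ + 1),
    { isOpen := Metric.isOpen_ball
      convex := convex_ball x₀ R
      hasFDerivAt := fun x hx => (differentiableAt x hx).hasFDerivAt
      lipschitzOnWith := (lipschitz.mono fun x hx => (ball_subset x hx).2.2.2).weaken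
        (le_max_left _ _)
      norm_le := fun x hx => (ball_subset x hx).2.1.le.trans (le_max_right _ _)
      maurerCartan := fun x hx =>
        maurerCartan_leftFrame G hB (ball_subset x hx).2.2.1 (differentiableAt x hx) }⟩

variable [T2Space G]

omit [FiniteDimensional ℝ E] in
theorem isMIntegralCurve_expModel [CompleteSpace E] (v : E) :
    IsMIntegralCurve (I := 𝓘(ℝ, E)) (fun s : ℝ => expModel G (s • v))
      (mulInvariantVectorField (I := 𝓘(ℝ, E)) (G := G) v) :=
  isMIntegralCurve_lieExp (G := G) ((lieEquiv E G).symm v)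

omit [FiniteDimensional ℝ E] in
theorem expModel_zero [CompleteSpace E] : expModel G (0 : E) = 1 := lieExp_zero

omit [FiniteDimensional ℝ E] in
theorem mul_expModel_eq_of_hasDerivAt [CompleteSpace E] {g : G} {v : E} {α : ℝ → E}
    (mem_target : ∀ t ∈ Ioo (-2 : ℝ) 2, α t ∈ (extChartAt 𝓘(ℝ, E) (1 : G)).target)
    (hα : ∀ t ∈ Ioo (-2 : ℝ) 2, HasDerivAt α (leftFrame G (α t) v) t)
    (init : (extChartAt 𝓘(ℝ, E) (1 : G)).symm (α 0) = g) {t : ℝ} (ht : t ∈ Ioo (-2 : ℝ) 2) :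
    g * expModel G (t • v) = (extChartAt 𝓘(ℝ, E) (1 : G)).symm (α t) := by
  have translated := isMIntegralCurveOn_mul_left
    ((isMIntegralCurve_expModel G v).isMIntegralCurveOn (Ioo (-2) 2)) g
  refine isMIntegralCurveOn_Ioo_eqOn_of_contMDiff_boundaryless (t₀ := 0) (by norm_num)
    (contMDiff_one_mulInvariantVectorField v) translated (fun s hs =>
      (hasMFDerivAt_extChartAt_symm_comp (mem_target s hs) (hα s hs)).hasMFDerivWithinAt) ?_ ht
  simp only [zero_smul, expModel_zero, mul_one, init]

theorem exists_hasDerivAt_expChart {R : ℝ} (hR : 0 < R)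
    (ball_subset : Metric.ball (extChartAt 𝓘(ℝ, E) (1 : G) 1) R ⊆
      (extChartAt 𝓘(ℝ, E) (1 : G)).target) :
    ∃ r > 0, ∀ v : E, ‖v‖ < r → ∀ t ∈ Ioo (-2 : ℝ) 2,
      expModel G (t • v) ∈ (extChartAt 𝓘(ℝ, E) (1 : G)).source ∧
      expChart G (t • v) ∈ Metric.ball (extChartAt 𝓘(ℝ, E) (1 : G) 1) R ∧
      HasDerivAt (fun s : ℝ => expChart G (s • v)) (leftFrame G (expChart G (t • v)) v) t := by
  have : CompleteSpace E := FiniteDimensional.complete ℝ E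
  obtain ⟨r, hr, exists_solution⟩ :=
    exists_solution_mem_ball ((contDiffAt_leftFrame (E := E) G).of_le one_le_two) hR
  refine ⟨r, hr, fun v hv => ?_⟩
  obtain ⟨α, init, -, hα⟩ := exists_solution _ (Metric.mem_ball_self hr) v hv
  have mem_target : ∀ t ∈ Ioo (-2 : ℝ) 2, α t ∈ (extChartAt 𝓘(ℝ, E) (1 : G)).target :=
    fun t ht => ball_subset (hα t ht).1
  have expModel_eq : ∀ t ∈ Ioo (-2 : ℝ) 2,
      expModel G (t • v) = (extChartAt 𝓘(ℝ, E) (1 : G)).symm (α t) := fun t ht => by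
    rw [← mul_expModel_eq_of_hasDerivAt G mem_target (fun t ht => (hα t ht).2)
      (by rw [init, extChartAt_to_inv]) ht, one_mul]
  have expChart_eq : ∀ t ∈ Ioo (-2 : ℝ) 2, expChart G (t • v) = α t := fun t ht => by
    rw [expChart, expModel_eq t ht, PartialEquiv.right_inv _ (mem_target t ht)]
  intro t ht
  rw [expChart_eq t ht, expModel_eq t ht]
  exact ⟨PartialEquiv.map_target _ (mem_target t ht), (hα t ht).1,
    (hα t ht).2.congr_of_eventuallyEq (eventually_of_mem (isOpen_Ioo.mem_nhds ht) expChart_eq)⟩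

theorem exists_hasFDerivAt_expChart
    (hB : ∀ v w, B v w = lieEquiv E G ⁅(lieEquiv E G).symm v, (lieEquiv E G).symm w⁆) :
    ∃ r > 0, ∀ v : E, ‖v‖ < r → expModel G v ∈ (extChartAt 𝓘(ℝ, E) (1 : G)).source ∧
      HasFDerivAt (expChart G) (leftFrame G (expChart G v) ∘L dexpFactor (B v)) v := by
  have : CompleteSpace E := FiniteDimensional.complete ℝ E
  obtain ⟨R, hR, ball_subset, K, frame⟩ := exists_isMaurerCartanFrame_leftFrame G hB
  obtain ⟨r, hr, curve⟩ := exists_hasDerivAt_expChart G hR ball_subset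
  refine ⟨r, hr, fun v hv => ⟨?_, ?_⟩⟩
  · simpa only [one_smul] using (curve v hv 1 (by norm_num)).1
  · have curve' : ∀ w ∈ Metric.ball (0 : E) r, ∀ s ∈ Icc (0 : ℝ) 1, _ := fun w hw s hs =>
      (curve w (mem_ball_zero_iff.1 hw) s (Icc_zero_one_subset_Ioo hs)).2
    exact frame.hasFDerivAt_timeOne Metric.isOpen_ball (fun w hw s hs => (curve' w hw s hs).2)
      (fun w hw s hs => (curve' w hw s hs).1) (mem_ball_zero_iff.2 hv)

theorem exists_expModel_mul
    (hB : ∀ v w, B v w = lieEquiv E G ⁅(lieEquiv E G).symm v, (lieEquiv E G).symm w⁆)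
    (hRep : IsRep B B) :
    ∃ r > 0, ∀ x y : E, ‖x‖ < r → ‖y‖ < r →
      expModel G x * expModel G y = expModel G (bch B x y) := by
  have : CompleteSpace E := FiniteDimensional.complete ℝ E
  obtain ⟨R, hR, hexp⟩ := exists_hasFDerivAt_expChart G hB
  obtain ⟨r, hr, exists_curve⟩ := exists_bch_curve hRep hR
  refine ⟨r, hr, fun x y hx hy => ?_⟩
  obtain ⟨w, rfl, w_one, hw⟩ := exists_curve x y hx hy
  have symm_expChart : ∀ t ∈ Ioo (-2 : ℝ) 2,
      (extChartAt 𝓘(ℝ, E) (1 : G)).symm (expChart G (w t)) = expModel G (w t) :=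
    fun t ht => (extChartAt 𝓘(ℝ, E) (1 : G)).left_inv (hexp _ (hw t ht).1).1
  have solves : ∀ t ∈ Ioo (-2 : ℝ) 2, HasDerivAt (fun t => expChart G (w t))
      (leftFrame G (expChart G (w t)) y) t := fun t ht => by
    obtain ⟨norm_lt, w', deriv_w, dexp_eq⟩ := hw t ht
    refine ((hexp _ norm_lt).2.comp_hasDerivAt t deriv_w).congr_deriv ?_
    rw [ContinuousLinearMap.comp_apply, dexp_eq]
  have one_mem : (1 : ℝ) ∈ Ioo (-2 : ℝ) 2 := by norm_num
  have mul_eq := mul_expModel_eq_of_hasDerivAt G (α := fun t => expChart G (w t))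
    (fun t ht => (extChartAt 𝓘(ℝ, E) (1 : G)).map_source (hexp _ (hw t ht).1).1) solves
    (symm_expChart 0 (by norm_num)) one_mem
  rw [one_smul, symm_expChart 1 one_mem, w_one] at mul_eq
  exact mul_eq

theorem image_expModel_mem_nhds
    (hB : ∀ v w, B v w = lieEquiv E G ⁅(lieEquiv E G).symm v, (lieEquiv E G).symm w⁆)
    {S : Set E} (hS : S ∈ 𝓝 0) : expModel G '' S ∈ 𝓝 1 := by
  have : CompleteSpace E := FiniteDimensional.complete ℝ E
  obtain ⟨r, hr, hexp⟩ := exists_hasFDerivAt_expChart G hB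
  have expChart_zero : expChart G (0 : E) = extChartAt 𝓘(ℝ, E) (1 : G) 1 := by
    rw [expChart, expModel_zero]
  have continuousAt_deriv :
      ContinuousAt (fun v => leftFrame G (expChart G v) ∘L dexpFactor (B v)) 0 := by
    refine ContinuousAt.clm_comp ?_ (continuous_dexpFactor.comp B.continuous).continuousAt
    refine ContinuousAt.comp (f := expChart G) (g := leftFrame G) ?_
      (hexp 0 (norm_zero.trans_lt hr)).2.continuousAt
    rw [expChart_zero]
    exact (contDiffAt_leftFrame G).continuousAt
  have strictDeriv := hasStrictFDerivAt_of_hasFDerivAt_of_continuousAt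
    (eventually_of_mem (Metric.ball_mem_nhds 0 hr) fun v hv =>
      (hexp v (mem_ball_zero_iff.1 hv)).2) continuousAt_deriv
  rw [expChart_zero, leftFrame_extChartAt_one, map_zero, dexpFactor_zero] at strictDeriv
  have map_nhds := strictDeriv.map_nhds_eq_of_surj (LinearMap.range_eq_top.2 fun v => ⟨v, rfl⟩)
  have image_mem := image_mem_map (m := expChart G) (inter_mem hS (Metric.ball_mem_nhds 0 hr))
  rw [map_nhds, expChart_zero] at image_mem
  filter_upwards [(continuousAt_extChartAt (I := 𝓘(ℝ, E)) (1 : G)).preimage_mem_nhds image_mem,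
    extChartAt_source_mem_nhds (I := 𝓘(ℝ, E)) (1 : G)] with g ⟨v, ⟨hv, norm_lt⟩, chart_eq⟩ hg
  exact ⟨v, hv, (extChartAt 𝓘(ℝ, E) (1 : G)).injOn (hexp v (mem_ball_zero_iff.1 norm_lt)).1 hg
    chart_eq⟩

end MaurerCartan

/-! ### The graded bracket of an adapted decomposition -/

section Filtration

variable {L : Type*} [LieRing L] [LieAlgebra ℝ L] {D : Submodule ℝ L}

theorem bracketFiltration_mono : Monotone (bracketFiltration D) := by
  refine monotone_nat_of_le_succ fun i => ?_
  cases i with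
  | zero => exact bot_le
  | succ i => exact le_sup_left

theorem lie_mem_bracketFiltration_succ {i : ℕ} {x y : L} (hx : x ∈ D)
    (hy : y ∈ bracketFiltration D i) : ⁅x, y⁆ ∈ bracketFiltration D (i + 1) := by
  cases i with
  | zero =>
    rw [(Submodule.mem_bot ℝ).1 hy, lie_zero]
    exact zero_mem _
  | succ i => exact Submodule.mem_sup_right (Submodule.subset_span ⟨x, hx, y, hy, rfl⟩)

theorem bracketFiltration_add_two_le {i : ℕ} {T : Submodule ℝ L}
    (le : bracketFiltration D (i + 1) ≤ T)
    (lie_mem : ∀ x ∈ D, ∀ y ∈ bracketFiltration D (i + 1), ⁅x, y⁆ ∈ T) :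
    bracketFiltration D (i + 2) ≤ T := by
  refine sup_le le (Submodule.span_le.2 ?_)
  rintro _ ⟨x, hx, y, hy, rfl⟩
  exact lie_mem x hx y hy

theorem lie_mem_bracketFiltration_add (i : ℕ) {j : ℕ} {x y : L}
    (hx : x ∈ bracketFiltration D i) (hy : y ∈ bracketFiltration D j) :
    ⁅x, y⁆ ∈ bracketFiltration D (i + j) := by
  match i with
  | 0 =>
    rw [(Submodule.mem_bot ℝ).1 hx, zero_lie]
    exact zero_mem _
  | 1 =>
    rw [add_comm]
    exact lie_mem_bracketFiltration_succ hx hy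
  | i + 2 =>
    let T : Submodule ℝ L := (bracketFiltration D (i + 2 + j)).comap (LieAlgebra.ad ℝ L y)
    have mem_iff : ∀ z, z ∈ T ↔ ⁅z, y⁆ ∈ bracketFiltration D (i + 2 + j) := fun z => by
      rw [← lie_skew, neg_mem_iff]
      rfl
    refine (mem_iff x).1 (bracketFiltration_add_two_le (fun z hz => ?_) (fun d hd z hz => ?_) hx)
    · exact (mem_iff z).2 (bracketFiltration_mono (by omega)
        (lie_mem_bracketFiltration_add (i + 1) hz hy))
    · rw [mem_iff, lie_lie]
      exact sub_mem
        (bracketFiltration_mono (by omega)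
          (lie_mem_bracketFiltration_succ hd (lie_mem_bracketFiltration_add (i + 1) hz hy)))
        (bracketFiltration_mono (by omega)
          (lie_mem_bracketFiltration_add (i + 1) hz (lie_mem_bracketFiltration_succ hd hy)))

variable {W : ℕ → Submodule ℝ L} [DirectSum.Decomposition W]

theorem gradedProj_mem (j : ℕ) (x : L) : gradedProj W j x ∈ W j :=
  (DirectSum.decompose W x j).2

theorem gradedProj_of_mem {j : ℕ} {x : L} (hx : x ∈ W j) : gradedProj W j x = x :=
  DirectSum.decompose_of_mem_same W hx

theorem gradedProj_of_mem_of_ne {i j : ℕ} {x : L} (hx : x ∈ W i) (hij : i ≠ j) :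
    gradedProj W j x = 0 :=
  DirectSum.decompose_of_mem_ne W hx hij

variable (hW : ∀ i : ℕ, (⨆ (j : ℕ) (_ : j ≤ i), W j) = bracketFiltration D i)

include hW

omit [DirectSum.Decomposition W] in
theorem le_bracketFiltration (j : ℕ) : W j ≤ bracketFiltration D j := by
  rw [← hW]
  exact le_iSup₂_of_le j le_rfl le_rfl

omit [DirectSum.Decomposition W] in
theorem bracketFiltration_le {i : ℕ} {T : Submodule ℝ L} (le : ∀ j ≤ i, W j ≤ T) :
    bracketFiltration D i ≤ T := by
  rw [← hW]
  exact iSup₂_le le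

omit [DirectSum.Decomposition W] in
theorem eq_zero_of_mem_layer_zero {x : L} (hx : x ∈ W 0) : x = 0 :=
  (Submodule.mem_bot ℝ).1 (le_bracketFiltration hW 0 hx)

theorem gradedProj_eq_zero {i j : ℕ} (hij : i < j) {x : L} (hx : x ∈ bracketFiltration D i) :
    gradedProj W j x = 0 :=
  bracketFiltration_le hW (T := LinearMap.ker (gradedProj W j))
    (fun _ hk _ hz => gradedProj_of_mem_of_ne hz (by omega)) hx

theorem gradedProj_one_of_mem {x : L} (hx : x ∈ D) : gradedProj W 1 x = x := by
  refine bracketFiltration_le hW (T := LinearMap.eqLocus (gradedProj W 1) LinearMap.id) (i := 1)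
    (fun j hj z hz => ?_) hx
  rcases Nat.le_one_iff_eq_zero_or_eq_one.1 hj with rfl | rfl
  · rw [eq_zero_of_mem_layer_zero hW hz]
    exact zero_mem _
  · exact gradedProj_of_mem hz

theorem mem_layer_one {x : L} (hx : x ∈ D) : x ∈ W 1 :=
  gradedProj_one_of_mem hW hx ▸ gradedProj_mem 1 x

variable {m : ℕ} (hm : bracketFiltration D m = ⊤)

include hm

theorem eq_zero_of_mem_layer {j : ℕ} (hj : m < j) {x : L} (hx : x ∈ W j) : x = 0 := by
  rw [← gradedProj_of_mem hx, gradedProj_eq_zero hW hj (hm ▸ Submodule.mem_top)]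

theorem sum_gradedProj (x : L) : ∑ j ∈ Finset.range (m + 1), gradedProj W j x = x := by
  classical
  conv_rhs => rw [← DirectSum.sum_support_decompose W x]
  refine (Finset.sum_subset (fun j hj => ?_) fun j _ hj => ?_).symm
  · by_contra notMem
    rw [Finset.mem_range, not_lt] at notMem
    exact DFinsupp.mem_support_iff.1 hj
      (Subtype.ext (eq_zero_of_mem_layer hW hm notMem (gradedProj_mem j x)))
  · rw [DFinsupp.notMem_support_iff] at hj
    exact congrArg Subtype.val hj

theorem nilAd_of_mem {j k : ℕ} {x y : L} (hx : x ∈ W j) (hy : y ∈ W k) :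
    nilAd W m x y = gradedProj W (j + k) ⁅x, y⁆ := by
  simp only [nilAd, LinearMap.sum_apply, LinearMap.comp_apply, LieAlgebra.ad_apply]
  rw [Finset.sum_eq_single j, Finset.sum_eq_single k, gradedProj_of_mem hx, gradedProj_of_mem hy]
  · intro k' _ hk'
    rw [gradedProj_of_mem_of_ne hy hk'.symm, lie_zero, map_zero]
  · intro hk
    rw [Finset.mem_range, not_lt] at hk
    rw [eq_zero_of_mem_layer hW hm hk hy, map_zero, lie_zero, map_zero]
  · intro j' _ hj'
    refine Finset.sum_eq_zero fun k' _ => ?_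
    rw [gradedProj_of_mem_of_ne hx hj'.symm, zero_lie, map_zero]
  · intro hj
    rw [Finset.mem_range, not_lt] at hj
    refine Finset.sum_eq_zero fun k' _ => ?_
    rw [eq_zero_of_mem_layer hW hm hj hx, map_zero, zero_lie, map_zero]

theorem layer_add_two_le {i : ℕ} {T : Submodule ℝ L} (layer_le : W (i + 1) ≤ T)
    (nilAd_mem : ∀ x ∈ D, ∀ y ∈ T, nilAd W m x y ∈ T) : W (i + 2) ≤ T := by
  have gradedProj_lie_mem : ∀ x ∈ D, ∀ y ∈ bracketFiltration D (i + 1),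
      gradedProj W (i + 2) ⁅x, y⁆ ∈ T := fun x hx y hy => by
    refine bracketFiltration_le hW
      (T := T.comap (gradedProj W (i + 2) ∘ₗ (LieAlgebra.ad ℝ L x : L →ₗ[ℝ] L)))
      (fun k hk z hz => ?_) hy
    change gradedProj W (i + 2) ⁅x, z⁆ ∈ T
    rcases hk.lt_or_eq with hk | rfl
    · rw [gradedProj_eq_zero hW (by omega : k + 1 < i + 2)
        (lie_mem_bracketFiltration_succ hx (le_bracketFiltration hW k hz))]
      exact zero_mem _
    · rw [show i + 2 = 1 + (i + 1) by omega, ← nilAd_of_mem hW hm (mem_layer_one hW hx) hz]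
      exact nilAd_mem x hx z (layer_le hz)
  have le_comap : bracketFiltration D (i + 2) ≤ T.comap (gradedProj W (i + 2)) := by
    refine bracketFiltration_add_two_le (fun z hz => ?_) gradedProj_lie_mem
    rw [Submodule.mem_comap, gradedProj_eq_zero hW (by omega) hz]
    exact zero_mem _
  exact fun z hz => gradedProj_of_mem hz ▸ le_comap (le_bracketFiltration hW _ hz)

theorem eq_top_of_nilAd_mem {T : Submodule ℝ L} (hD : D ≤ T)
    (nilAd_mem : ∀ x ∈ D, ∀ y ∈ T, nilAd W m x y ∈ T) : T = ⊤ := by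
  have layer_le : ∀ i, W i ≤ T := fun i => by
    induction i with
    | zero => exact (le_bracketFiltration hW 0).trans bot_le
    | succ i ih =>
      cases i with
      | zero => exact (le_bracketFiltration hW 1).trans hD
      | succ i => exact layer_add_two_le hW hm ih nilAd_mem
  exact top_unique (hm ▸ bracketFiltration_le hW fun j _ => layer_le j)

end Filtration

section Transport

variable {E : Type*} [NormedAddCommGroup E] [NormedSpace ℝ E] [FiniteDimensional ℝ E]
  {L : Type*} [LieRing L] [LieAlgebra ℝ L] (ι : L ≃ₗ[ℝ] E)

/-- Transport of endomorphisms of `L` to bounded operators on the normed space `E`. -/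
def transport : Module.End ℝ L ≃ₐ[ℝ] (E →L[ℝ] E) :=
  (ι.conjAlgEquiv ℝ).trans (Module.End.toContinuousLinearMap E)

theorem transport_apply (f : Module.End ℝ L) (x : E) : transport ι f x = ι (f (ι.symm x)) := rfl

/-- Transport of the Lie bracket of `L` to the normed space `E`. -/
def transportBracket : E →L[ℝ] E →L[ℝ] E :=
  LinearMap.toContinuousLinearMap
    ((transport ι).toLinearMap ∘ₗ (LieAlgebra.ad ℝ L : L →ₗ[ℝ] Module.End ℝ L) ∘ₗ
      (ι.symm : E →ₗ[ℝ] L))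

theorem transportBracket_apply (x y : E) : transportBracket ι x y = ι ⁅ι.symm x, ι.symm y⁆ := rfl

theorem isRep_transportBracket : IsRep (transportBracket ι) (transportBracket ι) := by
  intro x y
  ext z
  simp only [sub_apply, mul_apply_eq_comp, transportBracket_apply, LinearEquiv.symm_apply_apply,
    lie_lie, map_sub]

variable {D : Submodule ℝ L} {m : ℕ} (hm : bracketFiltration D m = ⊤)
  {W : ℕ → Submodule ℝ L} [DirectSum.Decomposition W]
  (hW : ∀ i : ℕ, (⨆ (j : ℕ) (_ : j ≤ i), W j) = bracketFiltration D i)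

/-- The bracket of `L`, graded by a decomposition adapted to the filtration by iterated brackets
and transported to the normed space `E`. -/
def gradedBracket : GradedBracket E where
  step := m
  proj j := transport ι (gradedProj W j)
  bracket := transportBracket ι
  proj_proj_same i x := by
    simp only [transport_apply, LinearEquiv.symm_apply_apply]
    rw [gradedProj_of_mem (gradedProj_mem i _)]
  proj_proj_of_ne i j x hij := by
    simp only [transport_apply, LinearEquiv.symm_apply_apply]
    rw [gradedProj_of_mem_of_ne (gradedProj_mem j _) hij.symm, map_zero]
  sum_proj x := by
    simp only [transport_apply]
    rw [← map_sum, sum_gradedProj hW hm, LinearEquiv.apply_symm_apply]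
  proj_zero x := by
    rw [transport_apply, eq_zero_of_mem_layer_zero hW (gradedProj_mem 0 _), map_zero]
  bracket_skew x y := by
    rw [transportBracket_apply, transportBracket_apply, ← lie_skew, map_neg]
  isRep_bracket := isRep_transportBracket ι
  proj_bracket i j k x y hi := by
    simp only [transport_apply, transportBracket_apply, LinearEquiv.symm_apply_apply]
    rw [gradedProj_eq_zero hW hi, map_zero]
    exact lie_mem_bracketFiltration_add j (le_bracketFiltration hW j (gradedProj_mem _ _))
      (le_bracketFiltration hW k (gradedProj_mem _ _))

theorem gradedBracket_bracket (x y : E) :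
    (gradedBracket ι hm hW).bracket x y = ι ⁅ι.symm x, ι.symm y⁆ := rfl

theorem gradedBracket_proj_one {x : L} (hx : x ∈ D) :
    (gradedBracket ι hm hW).proj 1 (ι x) = ι x := by
  simp only [gradedBracket, transport_apply, LinearEquiv.symm_apply_apply]
  rw [gradedProj_one_of_mem hW hx]

theorem gradedBracket_nil (x : E) :
    (gradedBracket ι hm hW).nil x = transport ι (nilAd W m (ι.symm x)) := by
  ext y
  rw [GradedBracket.nil_apply, transport_apply, nilAd]
  simp only [LinearMap.sum_apply, map_sum, LinearMap.comp_apply, gradedBracket, transport_apply,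
    transportBracket_apply, LinearEquiv.symm_apply_apply, LieAlgebra.ad_apply]

theorem gradedBracket_generates {κ : Type*} {X : κ → L} (span_eq : Submodule.span ℝ (range X) = D)
    (T : Submodule ℝ E) (mem : ∀ i, ι (X i) ∈ T)
    (nil_mem : ∀ i, ∀ y ∈ T, (gradedBracket ι hm hW).nil (ι (X i)) y ∈ T) : T = ⊤ := by
  have le_of_mem : ∀ S : Submodule ℝ L, (∀ i, X i ∈ S) → D ≤ S := fun S hS =>
    span_eq ▸ Submodule.span_le.2 (range_subset_iff.2 hS)
  have comap_eq_top : T.comap (ι : L →ₗ[ℝ] E) = ⊤ := by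
    refine eq_top_of_nilAd_mem hW hm (le_of_mem _ mem) fun x hx y hy => ?_
    have nil_mem_x : (gradedBracket ι hm hW).nil (ι x) (ι y) ∈ T :=
      le_of_mem (T.comap
        (((gradedBracket ι hm hW).nil.flip (ι y) : E →ₗ[ℝ] E) ∘ₗ (ι : L →ₗ[ℝ] E)))
        (fun i => nil_mem i _ hy) hx
    rwa [gradedBracket_nil, transport_apply, ι.symm_apply_apply, ι.symm_apply_apply] at nil_mem_x
  refine eq_top_iff.2 fun x _ => ?_
  have mem_comap : ι.symm x ∈ T.comap (ι : L →ₗ[ℝ] E) := comap_eq_top ▸ Submodule.mem_top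
  rwa [Submodule.mem_comap, LinearEquiv.coe_coe, ι.apply_symm_apply] at mem_comap

end Transport

/-! ### The Baker-Campbell-Hausdorff product of the nilpotentisation -/

namespace GradedBracket

variable {E : Type*} [NormedAddCommGroup E] [NormedSpace ℝ E] (𝔤 : GradedBracket E)

/-- The operators that raise the degree by at least `k`. -/
def raising (k : ℕ) : Submodule ℝ (E →L[ℝ] E) where
  carrier := {u | ∀ i j x, i < j + k → 𝔤.proj i (u (𝔤.proj j x)) = 0}
  zero_mem' i j x _ := by rw [zero_apply, map_zero]
  add_mem' hu hv i j x lt := by rw [add_apply, map_add, hu i j x lt, hv i j x lt, add_zero]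
  smul_mem' c u hu i j x lt := by rw [smul_apply, map_smul, hu i j x lt, smul_zero]

theorem one_mem_raising : (1 : E →L[ℝ] E) ∈ 𝔤.raising 0 := fun i j x lt =>
  𝔤.proj_proj_of_ne i j x (ne_of_lt lt)

theorem mul_mem_raising {k l : ℕ} {u v : E →L[ℝ] E} (hu : u ∈ 𝔤.raising k)
    (hv : v ∈ 𝔤.raising l) : u * v ∈ 𝔤.raising (k + l) := fun i j x lt => by
  rw [mul_apply_eq_comp, ← 𝔤.sum_proj (v (𝔤.proj j x)), map_sum, map_sum]
  refine Finset.sum_eq_zero fun n _ => ?_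
  by_cases hn : n < j + l
  · rw [hv n j x hn, map_zero, map_zero]
  · exact hu i n _ (by omega)

theorem raising_antitone : Antitone 𝔤.raising :=
  fun _ _ le _ hu i j x _ => hu i j x (by omega)

theorem pow_mem_raising {u : E →L[ℝ] E} (hu : u ∈ 𝔤.raising 1) (n : ℕ) :
    u ^ n ∈ 𝔤.raising n := by
  induction n with
  | zero => exact 𝔤.one_mem_raising
  | succ n ih => exact 𝔤.mul_mem_raising ih hu

theorem eq_zero_of_mem_raising {k : ℕ} (hk : 𝔤.step < k) {u : E →L[ℝ] E}
    (hu : u ∈ 𝔤.raising k) : u = 0 := by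
  ext x
  refine 𝔤.ext_proj fun i hi => ?_
  rw [← 𝔤.sum_proj x, map_sum, map_sum, zero_apply, map_zero]
  exact Finset.sum_eq_zero fun j _ => hu i j x (by omega)

theorem pow_eq_zero_of_mem_raising {u : E →L[ℝ] E} (hu : u ∈ 𝔤.raising 1) {n : ℕ}
    (hn : n ∉ Finset.range (𝔤.step + 1)) : u ^ n = 0 :=
  𝔤.eq_zero_of_mem_raising (by rw [Finset.mem_range] at hn; omega) (𝔤.pow_mem_raising hu n)

theorem nil_mem_raising (x : E) : 𝔤.nil x ∈ 𝔤.raising 1 := fun i j y lt => by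
  rw [nil_apply, map_sum]
  refine Finset.sum_eq_zero fun k _ => ?_
  rw [map_sum]
  refine Finset.sum_eq_zero fun l _ => ?_
  by_cases hl : l = j
  · by_cases hk : k = 0
    · rw [hk, 𝔤.proj_zero, map_zero, zero_apply, map_zero, map_zero]
    · exact 𝔤.proj_proj_of_ne _ _ _ (by omega)
  · rw [𝔤.proj_proj_of_ne _ _ _ hl, map_zero, map_zero, map_zero]

theorem exp_eq_sum {u : E →L[ℝ] E} (hu : u ∈ 𝔤.raising 1) :
    exp u = ∑ j ∈ Finset.range (𝔤.step + 1), (j.factorial : ℝ)⁻¹ • u ^ j := by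
  rw [exp_eq_tsum ℝ]
  exact tsum_eq_sum fun n hn => by rw [𝔤.pow_eq_zero_of_mem_raising hu hn, smul_zero]

theorem logSeries_eq_sum {u : E →L[ℝ] E} (hu : u ∈ 𝔤.raising 1) :
    logSeries u = ∑ k ∈ Finset.range (𝔤.step + 1), ((-1) ^ k / ((k : ℝ) + 1)) • u ^ k :=
  tsum_eq_sum fun n hn => by rw [𝔤.pow_eq_zero_of_mem_raising hu hn, smul_zero]

theorem exp_sub_one_mem_raising {u : E →L[ℝ] E} (hu : u ∈ 𝔤.raising 1) :
    exp u - 1 ∈ 𝔤.raising 1 := by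
  rw [𝔤.exp_eq_sum hu, Finset.sum_range_succ']
  simp only [Nat.factorial_zero, Nat.cast_one, inv_one, pow_zero, one_smul, add_sub_cancel_right]
  exact sum_mem fun j _ => Submodule.smul_mem _ _
    (𝔤.raising_antitone (by omega) (𝔤.pow_mem_raising hu (j + 1)))

theorem exp_mul_exp_sub_one_mem_raising {u v : E →L[ℝ] E} (hu : u ∈ 𝔤.raising 1)
    (hv : v ∈ 𝔤.raising 1) : exp u * exp v - 1 ∈ 𝔤.raising 1 := by
  have hu' := 𝔤.exp_sub_one_mem_raising hu
  have hv' := 𝔤.exp_sub_one_mem_raising hv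
  have expand : exp u * exp v - 1 =
      (exp u - 1) * (exp v - 1) + ((exp u - 1) + (exp v - 1)) := by noncomm_ring
  rw [expand]
  exact add_mem (𝔤.raising_antitone one_le_two (𝔤.mul_mem_raising hu' hv')) (add_mem hu' hv')

end GradedBracket

section NilBCH

variable {E : Type*} [NormedAddCommGroup E] [NormedSpace ℝ E] [FiniteDimensional ℝ E]
  {L : Type*} [LieRing L] [LieAlgebra ℝ L] (ι : L ≃ₗ[ℝ] E)

/-- Evaluation at a real number `t` of polynomials with coefficients in `End L`, followed by
transport to bounded operators on `E`. -/
def polyEval (t : ℝ) : Polynomial (Module.End ℝ L) →+* (E →L[ℝ] E) :=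
  Polynomial.eval₂RingHom' ((transport ι : Module.End ℝ L →ₐ[ℝ] (E →L[ℝ] E)) : _ →+* _)
    (algebraMap ℝ (E →L[ℝ] E) t) fun _ => (Algebra.commutes _ _).symm

theorem polyEval_C (t : ℝ) (a : Module.End ℝ L) :
    polyEval ι t (Polynomial.C a) = transport ι a :=
  Polynomial.eval₂_C _ _

theorem polyEval_monomial (t : ℝ) (n : ℕ) (a : Module.End ℝ L) :
    polyEval ι t (Polynomial.monomial n a) = t ^ n • transport ι a := by
  refine (Polynomial.eval₂_monomial _ _).trans ?_
  rw [← map_pow, ← Algebra.commutes, ← Algebra.smul_def]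
  rfl

theorem polyEval_smul (t c : ℝ) (P : Polynomial (Module.End ℝ L)) :
    polyEval ι t (c • P) = c • polyEval ι t P := by
  rw [Algebra.smul_def, map_mul, Polynomial.algebraMap_apply, polyEval_C, AlgEquiv.commutes,
    ← Algebra.smul_def]

theorem polyEval_apply (t : ℝ) (P : Polynomial (Module.End ℝ L)) (y : L) :
    polyEval ι t P (ι y) = ∑ n ∈ P.support, t ^ n • ι (P.coeff n y) := by
  conv_lhs => rw [P.as_sum_support]
  rw [map_sum, sum_apply]
  refine Finset.sum_congr rfl fun n _ => ?_
  rw [polyEval_monomial, smul_apply, transport_apply, ι.symm_apply_apply]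

theorem integral_polyEval (P : Polynomial (Module.End ℝ L)) (y : L) :
    ∫ t in (0 : ℝ)..1, polyEval ι t P (ι y) = ι (P.sum fun n a => ((n : ℝ) + 1)⁻¹ • a y) := by
  simp only [polyEval_apply]
  rw [intervalIntegral.integral_finsetSum fun n _ =>
    (Continuous.intervalIntegrable (by fun_prop) _ _), Polynomial.sum_def, map_sum]
  refine Finset.sum_congr rfl fun n _ => ?_
  rw [intervalIntegral.integral_smul_const, integral_pow, map_smul, one_pow,
    zero_pow n.succ_ne_zero, sub_zero, one_div]

variable {D : Submodule ℝ L} {m : ℕ} (hm : bracketFiltration D m = ⊤)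
  {W : ℕ → Submodule ℝ L} [DirectSum.Decomposition W]
  (hW : ∀ i : ℕ, (⨆ (j : ℕ) (_ : j ≤ i), W j) = bracketFiltration D i)

theorem exp_gradedBracket_nil (x : L) (t : ℝ) :
    exp (t • (gradedBracket ι hm hW).nil (ι x)) = ∑ j ∈ Finset.range (m + 1),
      t ^ j • transport ι ((j.factorial : ℝ)⁻¹ • nilAd W m x ^ j) := by
  set 𝔤 := gradedBracket ι hm hW with h𝔤
  rw [𝔤.exp_eq_sum (Submodule.smul_mem _ t (𝔤.nil_mem_raising (ι x))), h𝔤, gradedBracket_nil,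
    ι.symm_apply_apply]
  refine Finset.sum_congr rfl fun j _ => ?_
  rw [map_smul, map_pow, smul_pow, smul_comm]

theorem bch_gradedBracket_nil (x y : L) :
    bch (gradedBracket ι hm hW).nil (ι x) (ι y) = ι (nilBCH W m x y) := by
  set 𝔤 := gradedBracket ι hm hW
  rw [bch, nilBCH, map_add, ← integral_polyEval]
  congr 1
  refine intervalIntegral.integral_congr fun t _ => congrArg (fun u : E →L[ℝ] E => u (ι y)) ?_
  have polyEval_eq : polyEval ι t (Polynomial.C (∑ j ∈ Finset.range (m + 1),
      (j.factorial : ℝ)⁻¹ • nilAd W m x ^ j) * ∑ j ∈ Finset.range (m + 1),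
        Polynomial.monomial j ((j.factorial : ℝ)⁻¹ • nilAd W m y ^ j)) =
      exp (𝔤.nil (ι x)) * exp (t • 𝔤.nil (ι y)) := by
    rw [← one_smul ℝ (𝔤.nil (ι x)), exp_gradedBracket_nil, exp_gradedBracket_nil, map_mul,
      polyEval_C, map_sum, map_sum]
    simp only [one_pow, one_smul, polyEval_monomial]
  have logSeries_eq := 𝔤.logSeries_eq_sum (𝔤.exp_mul_exp_sub_one_mem_raising
    (𝔤.nil_mem_raising (ι x)) (Submodule.smul_mem _ t (𝔤.nil_mem_raising (ι y))))
  rw [bchPsi, logSeries_eq, ← polyEval_eq]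
  simp only [map_mul, map_sum, polyEval_smul, map_pow, map_sub, map_one]
  rfl

theorem wordProd_nilpotentisation {M : ℕ} (Y : Fin M → L) (t : Fin M → ℝ) :
    wordProd (Nilpotentisation.exp : L → Nilpotentisation W m) Y t =
      Nilpotentisation.exp
        (ι.symm (wordFold (bch (gradedBracket ι hm hW).nil) (ι ∘ Y) t)) := by
  induction M with
  | zero => exact congrArg Nilpotentisation.exp (map_zero ι.symm).symm
  | succ M ih =>
    rw [wordProd_succ, wordFold_succ, ih]
    refine congrArg Nilpotentisation.exp (ι.injective ?_)
    rw [← bch_gradedBracket_nil ι hm hW, ι.apply_symm_apply, ι.apply_symm_apply, map_smul]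
    rfl

end NilBCH

/-! ### Boxes in a Lie group and in its nilpotentisation -/

section Comparison

variable {E : Type*} [NormedAddCommGroup E] [NormedSpace ℝ E] {G : Type*} [TopologicalSpace G]
  [ChartedSpace E G] [Group G] {M : ℕ}
  (Y : Fin M → GroupLieAlgebra 𝓘(ℝ, E) G)

theorem wordProd_expModel : wordProd (expModel G) (lieEquiv E G ∘ Y) = wordProd lieExp Y := by
  ext t
  simp only [wordProd, expModel, Function.comp_apply, ← map_smul,
    ContinuousLinearEquiv.symm_apply_apply]

variable [FiniteDimensional ℝ E] [LieGroup 𝓘(ℝ, E) (minSmoothness ℝ 3) G]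
  {D : Submodule ℝ (GroupLieAlgebra 𝓘(ℝ, E) G)} {m : ℕ} (hm : bracketFiltration D m = ⊤)
  {W : ℕ → Submodule ℝ (GroupLieAlgebra 𝓘(ℝ, E) G)} [DirectSum.Decomposition W]
  (hW : ∀ i : ℕ, (⨆ (j : ℕ) (_ : j ≤ i), W j) = bracketFiltration D i)

/-- The bracket of the Lie algebra of `G`, graded by an adapted decomposition and carried by the
model space of `G`. -/
def modelBracket : GradedBracket E := gradedBracket (lieEquiv E G).toLinearEquiv hm hW

theorem image_box1_nilpotentisation {ε : ℝ} (hε : 0 < ε) :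
    (fun y : Nilpotentisation W m => (lieExp y.log : G)) '' box1 Nilpotentisation.exp Y ε =
      expModel G '' wordBox (modelBracket hm hW).nil (lieEquiv E G ∘ Y) ε := by
  rw [box1_eq_image _ Y hε, wordBox, image_image, image_image]
  refine image_congr fun t _ => ?_
  rw [wordProd_nilpotentisation (lieEquiv E G).toLinearEquiv hm hW]
  rfl

theorem exists_isOpen_forall_exp_eq_wordProd
    (h : (modelBracket hm hW).HasUniformBoxes (lieEquiv E G ∘ Y)) :
    ∃ V : Set (GroupLieAlgebra 𝓘(ℝ, E) G), IsOpen V ∧ 0 ∈ V ∧ ∀ y ∈ V, ∃ τ : Fin M → ℝ,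
      (Nilpotentisation.exp y : Nilpotentisation W m) = wordProd Nilpotentisation.exp Y τ := by
  obtain ⟨C, box_mem⟩ := h.exists_wordBox_nil_mem_nhds
  rw [← map_zero (lieEquiv E G)] at box_mem
  obtain ⟨V, V_subset, isOpen_V, zero_mem_V⟩ :=
    mem_nhds_iff.1 ((lieEquiv E G).continuous.continuousAt.preimage_mem_nhds box_mem)
  refine ⟨V, isOpen_V, zero_mem_V, fun y hy => ?_⟩
  obtain ⟨τ, -, fold_eq⟩ := V_subset hy
  refine ⟨τ, ?_⟩
  rw [wordProd_nilpotentisation (lieEquiv E G).toLinearEquiv hm hW]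
  exact congrArg Nilpotentisation.exp
    ((lieEquiv E G).toLinearEquiv.eq_symm_apply.2 fold_eq.symm)

variable [T2Space G]

theorem eventually_box1_lieExp_eq : ∀ᶠ ε in 𝓝[>] 0,
    box1 lieExp Y ε = expModel G '' wordBox (modelBracket hm hW).bracket (lieEquiv E G ∘ Y) ε := by
  have : CompleteSpace E := FiniteDimensional.complete ℝ E
  obtain ⟨r, hr, expModel_mul⟩ := exists_expModel_mul G
    (gradedBracket_bracket (lieEquiv E G).toLinearEquiv hm hW) (modelBracket hm hW).isRep_bracket
  filter_upwards [eventually_box1_eq_image_wordBox (expModel_zero G) hr expModel_mul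
    (lieEquiv E G ∘ Y), self_mem_nhdsWithin] with ε box1_eq hε
  rw [modelBracket, ← box1_eq, box1_eq_image _ _ hε, box1_eq_image _ _ hε, wordProd_expModel]

variable {hm hW} (hY : ∀ i, Y i ∈ D)
  (h : (modelBracket hm hW).HasUniformBoxes (lieEquiv E G ∘ Y))

include hY h

theorem exists_isOpen_forall_eq_wordProd_lieExp :
    ∃ U : Set G, IsOpen U ∧ 1 ∈ U ∧ ∀ x ∈ U, ∃ t : Fin M → ℝ, x = wordProd lieExp Y t := by
  have : CompleteSpace E := FiniteDimensional.complete ℝ E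
  obtain ⟨ε, box1_eq, hε⟩ :=
    ((eventually_box1_lieExp_eq Y hm hW).and self_mem_nhdsWithin).exists
  have box1_mem : box1 lieExp Y ε ∈ 𝓝 (1 : G) := by
    rw [box1_eq]
    exact image_expModel_mem_nhds G (gradedBracket_bracket (lieEquiv E G).toLinearEquiv hm hW)
      (h.wordBox_bracket_mem_nhds
        (fun i => gradedBracket_proj_one (lieEquiv E G).toLinearEquiv hm hW (hY i)) hε)
  obtain ⟨U, U_subset, isOpen_U, one_mem⟩ := mem_nhds_iff.1 box1_mem
  refine ⟨U, isOpen_U, one_mem, fun x hx => ?_⟩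
  obtain ⟨t, eq_word, -⟩ := (mem_box1 hε).1 (U_subset hx)
  exact ⟨t, eq_word⟩

theorem exists_box1_subset :
    ∃ C : ℝ, 1 < C ∧ ∃ ε₀ : ℝ, 0 < ε₀ ∧ ∀ ε : ℝ, 0 < ε → ε < ε₀ →
      (fun y : Nilpotentisation W m => (lieExp y.log : G)) '' box1 Nilpotentisation.exp Y ε ⊆
        box1 lieExp Y (C * ε) ∧
      box1 lieExp Y (C * ε) ⊆
        (fun y : Nilpotentisation W m => (lieExp y.log : G)) ''
          box1 Nilpotentisation.exp Y (C ^ 2 * ε) := by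
  have : CompleteSpace E := FiniteDimensional.complete ℝ E
  obtain ⟨C, one_lt, subset⟩ := h.exists_wordBox_subset
    fun i => gradedBracket_proj_one (lieEquiv E G).toLinearEquiv hm hW (hY i)
  obtain ⟨ε₀, hε₀, Ioo_subset⟩ := mem_nhdsGT_iff_exists_Ioo_subset.1
    (subset.and (eventually_nhdsGT_zero_mul_left (one_pos.trans one_lt)
      (subset.and (eventually_box1_lieExp_eq Y hm hW))))
  refine ⟨C, one_lt, ε₀, hε₀, fun ε hε lt => ?_⟩
  obtain ⟨⟨nil_subset, -⟩, ⟨-, bracket_subset⟩, box1_eq⟩ := Ioo_subset ⟨hε, lt⟩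
  rw [image_box1_nilpotentisation Y hm hW hε,
    image_box1_nilpotentisation Y hm hW (by positivity : 0 < C ^ 2 * ε), box1_eq, pow_two,
    mul_assoc]
  exact ⟨image_mono nil_subset, image_mono bracket_subset⟩

end Comparison

end

end BallBox

open BallBox

theorem mainTheorem3_general {E : Type*} [NormedAddCommGroup E] [NormedSpace ℝ E]
    [FiniteDimensional ℝ E] {G : Type*} [TopologicalSpace G] [ChartedSpace E G] [Group G]
    [LieGroup 𝓘(ℝ, E) (minSmoothness ℝ 3) G] [T2Space G]
    (D : Submodule ℝ (GroupLieAlgebra 𝓘(ℝ, E) G)) (m : ℕ) (hm : bracketFiltration D m = ⊤)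
    (W : ℕ → Submodule ℝ (GroupLieAlgebra 𝓘(ℝ, E) G)) [DirectSum.Decomposition W]
    (hW : ∀ i : ℕ, (⨆ (j : ℕ) (_ : j ≤ i), W j) = bracketFiltration D i)
    {κ : Type*} [Finite κ] (X : κ → GroupLieAlgebra 𝓘(ℝ, E) G)
    (span_eq : Submodule.span ℝ (Set.range X) = D) :
    ∃ (M : ℕ) (g : Fin M → κ), Function.Surjective g ∧
      (∃ U : Set G, IsOpen U ∧ 1 ∈ U ∧
        ∀ x ∈ U, ∃ t : Fin M → ℝ, x = wordProd lieExp (fun i => X (g i)) t) ∧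
      (∃ V : Set (GroupLieAlgebra 𝓘(ℝ, E) G), IsOpen V ∧ 0 ∈ V ∧
        ∀ y ∈ V, ∃ τ : Fin M → ℝ,
          (Nilpotentisation.exp y : Nilpotentisation W m) =
            wordProd Nilpotentisation.exp (fun i => X (g i)) τ) ∧
      ∃ C : ℝ, 1 < C ∧ ∃ ε₀ : ℝ, 0 < ε₀ ∧ ∀ ε : ℝ, 0 < ε → ε < ε₀ →
        (fun y : Nilpotentisation W m => (lieExp y.log : G)) ''
            box1 Nilpotentisation.exp (fun i => X (g i)) ε ⊆
          box1 lieExp (fun i => X (g i)) (C * ε) ∧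
        box1 lieExp (fun i => X (g i)) (C * ε) ⊆
          (fun y : Nilpotentisation W m => (lieExp y.log : G)) ''
            box1 Nilpotentisation.exp (fun i => X (g i)) (C ^ 2 * ε) := by
  have mem_D : ∀ i, X i ∈ D := fun i => span_eq ▸ Submodule.subset_span (Set.mem_range_self i)
  obtain ⟨M, g, surjective_g, uniformBoxes⟩ := (modelBracket hm hW).exists_hasUniformBoxes
    (fun i => gradedBracket_proj_one (lieEquiv E G).toLinearEquiv hm hW (mem_D i))
    (gradedBracket_generates (lieEquiv E G).toLinearEquiv hm hW span_eq)
  exact ⟨M, g, surjective_g,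
    exists_isOpen_forall_eq_wordProd_lieExp _ (fun i => mem_D (g i)) uniformBoxes,
    exists_isOpen_forall_exp_eq_wordProd _ hm hW uniformBoxes,
    exists_box1_subset _ (fun i => mem_D (g i)) uniformBoxes⟩

theorem mainTheorem3 {E : Type*} [NormedAddCommGroup E] [NormedSpace ℝ E] [FiniteDimensional ℝ E]
    {G : Type*} [TopologicalSpace G] [ChartedSpace E G] [Group G] [LieGroup 𝓘(ℝ, E) ∞ G]
    [T2Space G] [ConnectedSpace G]
    -- `D` generates the Lie algebra
    (D : Submodule ℝ (GroupLieAlgebra 𝓘(ℝ, E) G)) (m : ℕ) (hm : bracketFiltration D m = ⊤)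
    -- a direct sum decomposition of the Lie algebra adapted to the filtration
    (W : ℕ → Submodule ℝ (GroupLieAlgebra 𝓘(ℝ, E) G)) [DirectSum.Decomposition W]
    (hW : ∀ i : ℕ, (⨆ (j : ℕ) (_ : j ≤ i), W j) = bracketFiltration D i)
    -- a basis of `D`
    {p : ℕ} (X : Module.Basis (Fin p) ℝ D) :
    ∃ (M : ℕ) (g : Fin M → Fin p), Function.Surjective g ∧
      (∃ U : Set G, IsOpen U ∧ 1 ∈ U ∧
        ∀ x ∈ U, ∃ t : Fin M → ℝ,
          x = wordProd lieExp (fun i => (X (g i) : GroupLieAlgebra 𝓘(ℝ, E) G)) t) ∧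
      (∃ V : Set (GroupLieAlgebra 𝓘(ℝ, E) G), IsOpen V ∧ 0 ∈ V ∧
        ∀ y ∈ V, ∃ τ : Fin M → ℝ,
          (Nilpotentisation.exp y : Nilpotentisation W m) =
            wordProd Nilpotentisation.exp
              (fun i => (X (g i) : GroupLieAlgebra 𝓘(ℝ, E) G)) τ) ∧
      ∃ C : ℝ, 1 < C ∧ ∃ ε₀ : ℝ, 0 < ε₀ ∧ ∀ ε : ℝ, 0 < ε → ε < ε₀ →
        (fun y : Nilpotentisation W m => (lieExp y.log : G)) ''
            box1 Nilpotentisation.exp (fun i => (X (g i) : GroupLieAlgebra 𝓘(ℝ, E) G)) ε ⊆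
          box1 lieExp (fun i => (X (g i) : GroupLieAlgebra 𝓘(ℝ, E) G)) (C * ε) ∧
        box1 lieExp (fun i => (X (g i) : GroupLieAlgebra 𝓘(ℝ, E) G)) (C * ε) ⊆
          (fun y : Nilpotentisation W m => (lieExp y.log : G)) ''
            box1 Nilpotentisation.exp (fun i => (X (g i) : GroupLieAlgebra 𝓘(ℝ, E) G))
              (C ^ 2 * ε) := by
  refine mainTheorem3_general D m hm W hW (fun i => (X i : GroupLieAlgebra 𝓘(ℝ, E) G)) ?_
  rw [Set.range_comp' Subtype.val X, ← D.coe_subtype, Submodule.span_image, X.span_eq,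
    Submodule.map_subtype_top]
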